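/- Throughout, $M$ is a compact smooth manifold with boundary, of dimension $d\ge 1$, with a smooth Riemannian metric $g$ (inner product $\langle\cdot,\cdot\rangle$, norm $|\cdot|$, Levi-Civita connection $\nabla$). For $x\in\partial M$ let $\nu(x)$ be the inward unit normal and let $\Lambda(x,\xi)=-\langle\nabla_\xi\nu,\xi\rangle$, $\xi\in T_x\partial M$, be the second fundamental form of $\partial M$ (positive for Euclidean balls). $(M,g)$ is called a simple Riemannian manifold if $\Lambda(x,\xi)>0$ for all $x\in\partial M$ and $0\ne\xi\in T_x\partial M$, and if for each $x\in M$ the exponential map $\exp_x\colon\exp_x^{-1}(M)\to M$ is a $C^\infty$ diffeomorphism. Here $\exp_x v=\gamma(1)$, where $\gamma\colon[0,1]\to M$ is the geodesic with $\gamma(0)=x$, $\dot\gamma(0)=v$, and $\exp_x^{-1}(M)\subset T_xM$ is the set of those $v$ for which such a geodesic in $M$ exists. Let $q\colon M\to\mathbb{R}$ be smooth and $H_0\in\mathbb{R}$. An $H$-geodesic is a curve $\gamma$ in $M$ with $\nabla_{\dot\gamma}\dot\gamma=-\nabla q(\gamma)$; its energy $\frac12|\dot\gamma|^2+q(\gamma)$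 is constant. The Hamiltonian exponential map at energy $H_0$ is the partial map $\exp^H_x\colon T_xM\to M$, $\exp^H_x(t\xi)=\gamma(t)$, for $t\ge 0$ and $\xi\in T_xM$ with $\frac12|\xi|^2+q(x)=H_0$, where $\gamma\colon[0,t]\to M$ is the $H$-geodesic with $\gamma(0)=x$, $\dot\gamma(0)=\xi$; its domain, written $(\exp^H_x)^{-1}(M)$, consists of those $t\xi$ for which this $H$-geodesic exists in $M$ on $[0,t]$. The manifold $M$ (with $g$ and $q$) is called simple at energy $H_0$ if $\exp^H_x\colon(\exp^H_x)^{-1}(M)\to M$ is a $C^\infty$ diffeomorphism for each $x\in M$, and if $\Lambda(x,\xi)>-d_xq(\nu(x))$ for all $x\in\partial M$ and $\xi\in T_x\partial M$ with $\frac12|\xi|^2+q(x)=H_0$. **Lemma.** If $(M,g)$ is a simple Riemannian manifold and $q\colon M\to\mathbb{R}$ is smooth, then there is $E_0\in\mathbb{R}$ such that $M$ is simple at energy $H_0$ for every $H_0\ge E_0$. -/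

import Mathlib

open Set
open scoped Manifold ContDiff

noncomputable section

namespace PotentialFlow

/-- Coordinate space `ℝ^d` of a `d`-dimensional manifold. -/
abbrev Coord (d : ℕ) : Type := EuclideanSpace ℝ (Fin d)

/-- Smooth Riemannian metrics on a smooth `d`-dimensional manifold with boundary `M`
(modelled on the closed half space `{y | 0 ≤ y 0}` of `ℝ^d`). -/
abbrev Metric (d : ℕ) [NeZero d] (M : Type*) [TopologicalSpace M]
    [ChartedSpace (EuclideanHalfSpace d) M] [IsManifold (𝓡∂ d) ∞ M] : Type _ :=
  Bundle.ContMDiffRiemannianMetric (𝓡∂ d) ∞ (Coord d)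
    (fun x : M => TangentSpace (𝓡∂ d) x)

section

variable {d : ℕ} [NeZero d] {M : Type*} [TopologicalSpace M]
  [ChartedSpace (EuclideanHalfSpace d) M]

/-- The tangent vector of `M` at the point with coordinates `y` in the chart around `x₀`,
whose components in that chart are `u` (that is, `∑ i, u i ∂ᵢ`). -/
def coordVec (x₀ : M) (y u : Coord d) :
    TangentSpace (𝓡∂ d) ((extChartAt (𝓡∂ d) x₀).symm y) :=
  mfderivWithin 𝓘(ℝ, Coord d) (𝓡∂ d) (extChartAt (𝓡∂ d) x₀).symm (range (𝓡∂ d)) y u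

/-- The differential `d_x q (v)` of a function `q : M → ℝ`. -/
def differential (q : M → ℝ) (x : M) (v : TangentSpace (𝓡∂ d) x) : ℝ :=
  mfderiv (𝓡∂ d) 𝓘(ℝ, ℝ) q x v

/-- The component of a tangent vector at `x` transversal to the boundary, in the chart at `x`
(Mathlib identifies `T_x M` with `ℝ^d` through this chart, which takes values in
`{y | 0 ≤ y 0}`). For `x ∈ ∂M` it vanishes exactly on `T_x ∂M`, and it is positive exactly on
the vectors that point strictly into `M`. -/
def transversal (x : M) (v : TangentSpace (𝓡∂ d) x) : ℝ :=
  (show Coord d from v) 0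

variable [IsManifold (𝓡∂ d) ∞ M]

/-- The metric in the chart around `x₀`: `∑ g_{ij}(y) uⁱ wʲ`. -/
def metricCoord (g : Metric d M) (x₀ : M) (y u w : Coord d) : ℝ :=
  g.inner ((extChartAt (𝓡∂ d) x₀).symm y) (coordVec x₀ y u) (coordVec x₀ y w)

/-- Christoffel symbols of the first kind of the Levi-Civita connection in the chart around
`x₀`: `∑ Γ_{ij,k}(y) uⁱ vʲ wᵏ = g(∇_u v, w)` for the constant-coefficient fields `u, v, w`, with
`Γ_{ij,k} = (∂ᵢ g_{jk} + ∂ⱼ g_{ik} - ∂ₖ g_{ij}) / 2`. At boundary points the partial derivatives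
are the one-sided ones. -/
def christoffel (g : Metric d M) (x₀ : M) (y u v w : Coord d) : ℝ :=
  (fderivWithin ℝ (fun z => metricCoord g x₀ z v w) (range (𝓡∂ d)) y u
    + fderivWithin ℝ (fun z => metricCoord g x₀ z u w) (range (𝓡∂ d)) y v
    - fderivWithin ℝ (fun z => metricCoord g x₀ z u v) (range (𝓡∂ d)) y w) / 2

/-- `γ : [0, T] → M` (with `0 < T`) is of class `C²` and solves Newton's equation
`∇_{γ'} γ' = -∇q(γ)` on `[0, T]`. The equation is written in local coordinates and tested
against every vector `w`: `g(c'', w) + Γ(c', c', w) = -dq(w)`, where `c` is the coordinate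
expression of `γ`. -/
structure IsHGeodesic (g : Metric d M) (q : M → ℝ) (T : ℝ) (γ : ℝ → M) : Prop where
  contMDiffOn : ContMDiffOn 𝓘(ℝ, ℝ) (𝓡∂ d) 2 γ (Icc 0 T)
  newton : ∀ t ∈ Icc 0 T, ∀ x₀ : M, γ t ∈ (extChartAt (𝓡∂ d) x₀).source →
    ∀ w : Coord d,
      let c : ℝ → Coord d := fun s => extChartAt (𝓡∂ d) x₀ (γ s)
      let c' : ℝ → Coord d := derivWithin c (Icc 0 T)
      let c'' : ℝ → Coord d := derivWithin c' (Icc 0 T)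
      metricCoord g x₀ (c t) (c'' t) w + christoffel g x₀ (c t) (c' t) (c' t) w
        = - differential q ((extChartAt (𝓡∂ d) x₀).symm (c t)) (coordVec x₀ (c t) w)

/-- `γ : [0, T] → M` starts at the point `x` with velocity `ξ`. -/
def StartsAt (x : M) (ξ : TangentSpace (𝓡∂ d) x) (T : ℝ) (γ : ℝ → M) : Prop :=
  γ 0 = x ∧
    (mfderivWithin 𝓘(ℝ, ℝ) (𝓡∂ d) γ (Icc 0 T) 0 (1 : ℝ) : Coord d) = ξ

/-- The energy `|ξ|²/2 + q(x)` of `ξ ∈ T_x M`. -/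
def energy (g : Metric d M) (q : M → ℝ) (x : M) (ξ : TangentSpace (𝓡∂ d) x) : ℝ :=
  g.inner x ξ ξ / 2 + q x

/-- `ν` is the inward unit normal of `∂M` at the boundary point `x`. -/
structure IsInwardUnitNormal (g : Metric d M) (x : M) (ν : TangentSpace (𝓡∂ d) x) : Prop where
  inward : 0 < transversal x ν
  unit : g.inner x ν ν = 1
  orthogonal : ∀ w : TangentSpace (𝓡∂ d) x, transversal x w = 0 → g.inner x ν w = 0

/-- The second fundamental form `Λ(x, ξ) = g(∇_ξ X, ν)` of `∂M` at `x ∈ ∂M`, for `ξ ∈ T_x ∂M` and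
the inward unit normal `ν`, where `X` is a field tangent to `∂M` with `X(x) = ξ`; here `X` is the
field with constant components in the chart at `x`. Equivalently `Λ(x, ξ) = -g(∇_ξ ν, ξ)`; it is
positive for the boundary of a Euclidean ball. -/
def secondFundamentalForm (g : Metric d M) (x : M) (ν ξ : TangentSpace (𝓡∂ d) x) : ℝ :=
  christoffel g x (extChartAt (𝓡∂ d) x x) ξ ξ ν

/-- `∂M` is strictly convex: its second fundamental form is positive definite. -/
def IsStrictlyConvexBoundary (g : Metric d M) : Prop :=
  ∀ x ∈ (𝓡∂ d).boundary M, ∀ ν, IsInwardUnitNormal g x ν →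
    ∀ ξ : TangentSpace (𝓡∂ d) x, transversal x ξ = 0 → ξ ≠ 0 →
      0 < secondFundamentalForm g x ν ξ

/-- `∂M` is strictly convex for the flow of `∇_{γ'} γ' = -∇q(γ)` at energy `H₀`:
`Λ(x, ξ) > -d_x q (ν(x))` for every `ξ ∈ T ∂M` of energy `H₀`. -/
def IsStrictlyConvexBoundaryAtEnergy (g : Metric d M) (q : M → ℝ) (H₀ : ℝ) : Prop :=
  ∀ x ∈ (𝓡∂ d).boundary M, ∀ ν, IsInwardUnitNormal g x ν →
    ∀ ξ : TangentSpace (𝓡∂ d) x, transversal x ξ = 0 → energy g q x ξ = H₀ →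
      - differential q x ν < secondFundamentalForm g x ν ξ

/-- Graph of the Riemannian exponential map: `exp_x v = γ(1)` for the geodesic
`γ : [0, 1] → M` with `γ(0) = x`, `γ'(0) = v`. -/
def ExpGraph (g : Metric d M) (x : M) (v : TangentSpace (𝓡∂ d) x) (y : M) : Prop :=
  ∃ γ : ℝ → M, IsHGeodesic g (fun _ => 0) 1 γ ∧ StartsAt x v 1 γ ∧ γ 1 = y

/-- Graph of the Hamiltonian exponential map at energy `H₀`: `exp^H_x (t ξ) = γ(t)` for `t ≥ 0`,
`ξ ∈ T_x M` of energy `H₀` and the `H`-geodesic `γ : [0, t] → M` with `γ(0) = x`, `γ'(0) = ξ`. -/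
def HExpGraph (g : Metric d M) (q : M → ℝ) (H₀ : ℝ) (x : M) (v : TangentSpace (𝓡∂ d) x)
    (y : M) : Prop :=
  ∃ (t : ℝ) (ξ : TangentSpace (𝓡∂ d) x), energy g q x ξ = H₀ ∧ v = t • ξ ∧
    ((t = 0 ∧ y = x) ∨
      (0 < t ∧ ∃ γ : ℝ → M, IsHGeodesic g q t γ ∧ StartsAt x ξ t γ ∧ γ t = y))

/-- The domain `exp_x⁻¹(M) ⊆ T_x M` of the Riemannian exponential map. -/
def expDomain (g : Metric d M) (x : M) : Set (TangentSpace (𝓡∂ d) x) :=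
  {v | ∃ y, ExpGraph g x v y}

/-- The domain `(exp^H_x)⁻¹(M) ⊆ T_x M` of the Hamiltonian exponential map at energy `H₀`. -/
def hExpDomain (g : Metric d M) (q : M → ℝ) (H₀ : ℝ) (x : M) : Set (TangentSpace (𝓡∂ d) x) :=
  {v | ∃ y, HExpGraph g q H₀ x v y}

open Classical in
/-- The Riemannian exponential map; only its values on `expDomain g x` are meaningful. -/
def expMap (g : Metric d M) (x : M) (v : TangentSpace (𝓡∂ d) x) : M :=
  if h : ∃ y, ExpGraph g x v y then h.choose else x

open Classical in
/-- The Hamiltonian exponential map at energy `H₀`; only its values on `hExpDomain g q H₀ x` are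
meaningful. -/
def hExpMap (g : Metric d M) (q : M → ℝ) (H₀ : ℝ) (x : M) (v : TangentSpace (𝓡∂ d) x) : M :=
  if h : ∃ y, HExpGraph g q H₀ x v y then h.choose else x

end

/-- `f` restricts to a (smooth) diffeomorphism from the subset `D` of `ℝ^d` onto `M`. -/
def IsDiffeoOnto {d : ℕ} [NeZero d] {M : Type*} [TopologicalSpace M]
    [ChartedSpace (EuclideanHalfSpace d) M] (f : Coord d → M) (D : Set (Coord d)) : Prop :=
  ContMDiffOn 𝓘(ℝ, Coord d) (𝓡∂ d) ∞ f D ∧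
    ∃ L : M → Coord d, ContMDiff (𝓡∂ d) 𝓘(ℝ, Coord d) ∞ L ∧
      (∀ v ∈ D, L (f v) = v) ∧ ∀ y, L y ∈ D ∧ f (L y) = y

section

variable {d : ℕ} [NeZero d] {M : Type*} [TopologicalSpace M]
  [ChartedSpace (EuclideanHalfSpace d) M] [IsManifold (𝓡∂ d) ∞ M]

/-- `(M, g)` is a simple Riemannian manifold (`M` compact): `∂M` is strictly convex and, for every
`x`, the exponential map is a diffeomorphism from `exp_x⁻¹(M)` onto `M`. -/
def IsSimple (g : Metric d M) : Prop :=
  IsStrictlyConvexBoundary g ∧ ∀ x : M, IsDiffeoOnto (expMap g x) (expDomain g x)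

/-- `(M, g, q)` (`M` compact) is simple at energy `H₀`: `∂M` is strictly convex for the flow at
energy `H₀` and, for every `x`, the Hamiltonian exponential map is a diffeomorphism from
`(exp^H_x)⁻¹(M)` onto `M`. -/
def IsSimpleAtEnergy (g : Metric d M) (q : M → ℝ) (H₀ : ℝ) : Prop :=
  IsStrictlyConvexBoundaryAtEnergy g q H₀ ∧
    ∀ x : M, IsDiffeoOnto (hExpMap g q H₀ x) (hExpDomain g q H₀ x)

end

end PotentialFlow

end

/-!
Simplicity is stable under weak perturbations, and a potential is a weak perturbation at high
energy: an `H`-geodesic from `x` of energy `H₀`, run through on `[0, 1]` with initial velocity `v`,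
solves `∇_{γ'} γ' = -δ |v|² ∇q` with `δ = 1 / (2 (H₀ - q(x)))` (`Represents.hExpGraph_iff`). The
factor `|v|²` keeps the equation homogeneous: `exp^H_x` is the time-one map of a flow that is smooth
even at `v = 0`, and for `δ = 0` it is the Riemannian exponential map. As `M` is compact, `δ` tends
to zero with `1 / H₀`, uniformly in `x`.

The inverse of one exponential map of the simple manifold `M` is a global coordinate `E : M → ℝ^d`.
Its image is a compact set `D`, in general with boundary. By extension across the boundary of the
half-space (`exists_contDiff_extension`), the metric and the potential extend to all of `ℝ^d` with
any given finite order of differentiability (`IsGlobalCoordinate.exists_represents`), so that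
trajectories can be continued beyond `D`. An `H`-geodesic of `M` becomes a trajectory that stays in
`D` (`Represents.exists_isHGeodesic_iff`).

In coordinates, `IsSimpleRegion.eventually_simple` states that for all small `δ` and all `x, y ∈ D`
there is exactly one trajectory in `D` of strength `δ |v|²` from `x` to `y`, and that its initial
velocity `v` is differentiable in `y`. This rests on three facts.
* The differential of each Riemannian exponential map is invertible, so the inverse function theorem
  gives solutions near a given one. They stay in `D` by strict convexity: a boundary function has no
  interior negative minimum along a short trajectory (`IsFlowBox.eventually_mem`). This gives
  existence for small `δ`, by compactness of `D × D`.
* The initial velocities are bounded uniformly in small `δ` (`IsSimpleRegion.exists_bound`).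
* Two solutions with the same end points would, as `δ → 0`, accumulate at two geodesics with the
  same end points. These coincide, which contradicts local uniqueness
  (`IsSimpleRegion.eventually_unique`).

The inverse so obtained is smooth: to prove that it is `C^k`, the data are extended with
sufficiently many derivatives and the inverse function theorem is applied again
(`Represents.isDiffeoOnto_hExpMap`). The convexity condition at energy `H₀` holds because the second
fundamental form is quadratic in `ξ`, whereas `dq(ν)` is bounded
(`Represents.exists_isStrictlyConvexBoundaryAtEnergy`).
-/

namespace PotentialFlow

open Filter Topology

/-! ### Extension from a half-space by reflections -/

section Extension

universe u

variable {V W : Type u} [NormedAddCommGroup V] [NormedSpace ℝ V]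
  [NormedAddCommGroup W] [NormedSpace ℝ W]

/-- The affine-linear map `y ↦ y - (1 + c) ℓ(y) e`. If `ℓ e = 1` it fixes the hyperplane `ℓ = 0`
pointwise and multiplies `ℓ` by `-c`. -/
noncomputable def reflect (ℓ : V →L[ℝ] ℝ) (e : V) (c : ℝ) : V →L[ℝ] V :=
  ContinuousLinearMap.id ℝ V - (1 + c) • ℓ.smulRight e

/-- Extension of a function from the half-space `0 ≤ ℓ` by a linear combination of reflections. -/
noncomputable def reflectExt (ℓ : V →L[ℝ] ℝ) (e : V) {N : ℕ} (a c : Fin N → ℝ) (f : V → W)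
    (y : V) : W :=
  open Classical in
  if 0 ≤ ℓ y then f y else ∑ j, a j • f (reflect ℓ e (c j) y)

lemma reflect_apply (ℓ : V →L[ℝ] ℝ) (e : V) (c : ℝ) (y : V) :
    reflect ℓ e c y = y - ((1 + c) * ℓ y) • e := by
  simp [reflect, smul_smul]

lemma map_reflect {ℓ : V →L[ℝ] ℝ} {e : V} (he : ℓ e = 1) (c : ℝ) (y : V) :
    ℓ (reflect ℓ e c y) = -c * ℓ y := by
  simp [reflect_apply, he]; ring

lemma reflectExt_of_nonneg {ℓ : V →L[ℝ] ℝ} {e : V} {N : ℕ} {a c : Fin N → ℝ} {f : V → W} {y : V}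
    (hy : 0 ≤ ℓ y) : reflectExt ℓ e a c f y = f y := if_pos hy

lemma reflectExt_of_nonpos {ℓ : V →L[ℝ] ℝ} {e : V} {N : ℕ} {a c : Fin N → ℝ}
    (ha : ∑ j, a j = 1) {f : V → W} {y : V} (hy : ℓ y ≤ 0) :
    reflectExt ℓ e a c f y = ∑ j, a j • f (reflect ℓ e (c j) y) := by
  -- On the hyperplane the reflections fix `y`, and the weights sum to one.
  rcases hy.lt_or_eq with h | h
  · exact if_neg (not_le.2 h)
  · simp [reflectExt, h, reflect_apply, ← Finset.sum_smul, ha]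

lemma isClosed_nonneg (ℓ : V →L[ℝ] ℝ) : IsClosed {y | 0 ≤ ℓ y} :=
  isClosed_le continuous_const ℓ.continuous

lemma isClosed_nonpos (ℓ : V →L[ℝ] ℝ) : IsClosed {y | ℓ y ≤ 0} :=
  isClosed_le ℓ.continuous continuous_const

lemma uniqueDiffOn_nonneg {ℓ : V →L[ℝ] ℝ} {e : V} (he : ℓ e = 1) :
    UniqueDiffOn ℝ {y | 0 ≤ ℓ y} := by
  refine uniqueDiffOn_convex ((convex_Ici (0 : ℝ)).linear_preimage ℓ.toLinearMap) ⟨e, ?_⟩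
  refine mem_interior.2 ⟨{y | 0 < ℓ y}, fun y hy => by have h : 0 < ℓ y := hy; exact h.le,
    isOpen_lt continuous_const ℓ.continuous, ?_⟩
  simp [he]

lemma mapsTo_reflect {ℓ : V →L[ℝ] ℝ} {e : V} (he : ℓ e = 1) {c : ℝ} (hc : 0 ≤ c) :
    MapsTo (reflect ℓ e c) {y | ℓ y ≤ 0} {y | 0 ≤ ℓ y} := by
  intro y hy
  simp only [mem_ofPred_eq, map_reflect he] at hy ⊢
  nlinarith

lemma continuous_reflectExt {ℓ : V →L[ℝ] ℝ} {e : V} (he : ℓ e = 1) {N : ℕ} {a c : Fin N → ℝ}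
    (hc : ∀ j, 0 ≤ c j) (ha : ∑ j, a j = 1) {f : V → W} (hf : ContinuousOn f {y | 0 ≤ ℓ y}) :
    Continuous (reflectExt ℓ e a c f) := by
  rw [← continuousOn_univ]
  have hU : (univ : Set V) = {y | 0 ≤ ℓ y} ∪ {y | ℓ y ≤ 0} := by
    ext y; simp [le_total]
  rw [hU]
  refine ContinuousOn.union_of_isClosed ?_ ?_ (isClosed_nonneg ℓ) (isClosed_nonpos ℓ)
  · exact hf.congr fun y hy => reflectExt_of_nonneg hy
  · refine ContinuousOn.congr ?_ fun y hy => reflectExt_of_nonpos ha hy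
    refine continuousOn_finsetSum _ fun j _ => ContinuousOn.const_smul ?_ _
    exact hf.comp (reflect ℓ e (c j)).continuous.continuousOn (mapsTo_reflect he (hc j))

lemma hasFDerivAt_reflectExt {ℓ : V →L[ℝ] ℝ} {e : V} (he : ℓ e = 1) {N : ℕ} {a c : Fin N → ℝ}
    (hc : ∀ j, 0 ≤ c j) (ha : ∑ j, a j = 1) (ha' : ∑ j, a j * (-c j) = 1)
    {f : V → W} (hf : DifferentiableOn ℝ f {y | 0 ≤ ℓ y}) (y : V) :
    HasFDerivAt (reflectExt ℓ e a c f)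
      (reflectExt ℓ e a c (fun z => (fderivWithin ℝ f {y | 0 ≤ ℓ y} z).comp
          (ContinuousLinearMap.id ℝ V - ℓ.smulRight e)) y
        + reflectExt ℓ e (fun j => a j * (-c j)) c
          (fun z => (fderivWithin ℝ f {y | 0 ≤ ℓ y} z).comp (ℓ.smulRight e)) y) y := by
  set H : Set V := {y | 0 ≤ ℓ y} with hH
  have hU : (univ : Set V) = {y | 0 ≤ ℓ y} ∪ {y | ℓ y ≤ 0} := by
    ext y; simp [le_total]
  rw [← hasFDerivWithinAt_univ, hU]
  refine HasFDerivWithinAt.union ?_ ?_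
  · by_cases hy : 0 ≤ ℓ y
    · rw [reflectExt_of_nonneg hy, reflectExt_of_nonneg hy, ← ContinuousLinearMap.comp_add,
        sub_add_cancel, ContinuousLinearMap.comp_id]
      exact ((hf y hy).hasFDerivWithinAt).congr (fun z hz => reflectExt_of_nonneg hz)
        (reflectExt_of_nonneg hy)
    · refine HasFDerivWithinAt.of_notMem_closure ?_
      rwa [(isClosed_nonneg ℓ).closure_eq]
  · by_cases hy : ℓ y ≤ 0
    · rw [reflectExt_of_nonpos ha hy, reflectExt_of_nonpos ha' hy, ← Finset.sum_add_distrib]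
      have key : HasFDerivWithinAt (fun z => ∑ j, a j • f (reflect ℓ e (c j) z))
          (∑ j, a j • (fderivWithin ℝ f H (reflect ℓ e (c j) y)).comp (reflect ℓ e (c j)))
          {y | ℓ y ≤ 0} y := by
        refine HasFDerivWithinAt.fun_sum fun j _ => HasFDerivWithinAt.const_smul ?_ _
        exact ((hf _ (mapsTo_reflect he (hc j) hy)).hasFDerivWithinAt).comp y
          (reflect ℓ e (c j)).hasFDerivWithinAt (mapsTo_reflect he (hc j))
      refine (key.congr (fun z hz => reflectExt_of_nonpos ha hz)
        (reflectExt_of_nonpos ha hy)).congr_fderiv ?_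
      refine Finset.sum_congr rfl fun j _ => ?_
      ext v
      simp only [reflect, smul_apply, ContinuousLinearMap.comp_apply,
        sub_apply, add_apply, map_sub, map_smul,
        ContinuousLinearMap.id_apply, ContinuousLinearMap.smulRight_apply]
      module
    · refine HasFDerivWithinAt.of_notMem_closure ?_
      rwa [(isClosed_nonpos ℓ).closure_eq]

/-- If the weights `a` and dilation factors `c` satisfy the moment conditions `∑ aⱼ (-cⱼ)ᵐ = 1` for
`m ≤ n`, then extension by reflections preserves the class `C^n`: differentiating in the directions
tangent to the hyperplane keeps the weights, and the normal derivative replaces `aⱼ` by `-aⱼ cⱼ`. -/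
theorem contDiff_reflectExt {ℓ : V →L[ℝ] ℝ} {e : V} (he : ℓ e = 1) {N : ℕ} {c : Fin N → ℝ}
    (hc : ∀ j, 0 ≤ c j) (n : ℕ) :
    ∀ {W : Type u} [NormedAddCommGroup W] [NormedSpace ℝ W] {a : Fin N → ℝ},
      (∀ m ≤ n, ∑ j, a j * (-c j) ^ m = 1) → ∀ {f : V → W}, ContDiffOn ℝ n f {y | 0 ≤ ℓ y} →
      ContDiff ℝ n (reflectExt ℓ e a c f) := by
  induction n with
  | zero =>
    intro W _ _ a ha f hf
    have h0 : ∑ j, a j = 1 := by simpa using ha 0 le_rfl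
    exact contDiff_zero.2 (continuous_reflectExt he hc h0 hf.continuousOn)
  | succ n ih =>
    intro W _ _ a ha f hf
    have h0 : ∑ j, a j = 1 := by simpa using ha 0 (Nat.zero_le _)
    have h1 : ∑ j, a j * (-c j) = 1 := by simpa using ha 1 (by omega)
    have hf' := (contDiffOn_succ_iff_fderivWithin (n := (n : WithTop ℕ∞))
      (uniqueDiffOn_nonneg he)).1 (by exact_mod_cast hf)
    rw [Nat.cast_add, Nat.cast_one]
    refine contDiff_succ_iff_hasFDerivAt (n := n) |>.2 ⟨_, ?_,
      hasFDerivAt_reflectExt he hc h0 h1 hf'.1⟩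
    refine ContDiff.add (ih (fun m hm => ha m (by omega)) ?_)
      (ih (fun m hm => ?_) ?_)
    · exact hf'.2.2.clm_comp contDiffOn_const
    · rw [← ha (m + 1) (by omega)]
      exact Finset.sum_congr rfl fun j _ => by ring
    · exact hf'.2.2.clm_comp contDiffOn_const

/-- Weights satisfying the moment conditions exist since the Vandermonde matrix is invertible. -/
lemma exists_reflect_weights (n : ℕ) :
    ∃ a : Fin (n + 1) → ℝ, ∀ m ≤ n, ∑ j, a j * (-((j : ℕ) : ℝ)) ^ m = 1 := by
  set A := Matrix.vandermonde (fun j : Fin (n + 1) => -((j : ℕ) : ℝ))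
  have hA : IsUnit A.det := by
    refine isUnit_iff_ne_zero.2 (Matrix.det_vandermonde_ne_zero_iff.2 fun i j hij => ?_)
    exact Fin.ext (by exact_mod_cast neg_injective hij)
  refine ⟨Matrix.vecMul 1 A⁻¹, fun m hm => ?_⟩
  have h := congrFun (Matrix.vecMul_vecMul (1 : Fin (n + 1) → ℝ) A⁻¹ A) ⟨m, by omega⟩
  rw [Matrix.nonsing_inv_mul A hA, Matrix.vecMul_one] at h
  simpa [Matrix.vecMul, dotProduct, A, Matrix.vandermonde_apply] using h

/-- A function of class `C^n` on a half-space near a point has a `C^n` extension. -/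
theorem exists_contDiff_extension [FiniteDimensional ℝ V] {ℓ : V →L[ℝ] ℝ} {e : V} (he : ℓ e = 1)
    (n : ℕ) {f : V → W} {p : V} (hp : 0 ≤ ℓ p) (hf : ContDiffWithinAt ℝ n f {y | 0 ≤ ℓ y} p) :
    ∃ F : V → W, ContDiff ℝ n F ∧ F =ᶠ[𝓝[{y | 0 ≤ ℓ y}] p] f := by
  obtain ⟨u, hu, hfu⟩ := hf.contDiffOn le_rfl (by simp)
  rw [insert_eq_of_mem (show p ∈ {y | 0 ≤ ℓ y} from hp)] at hu
  obtain ⟨r, hr, hru⟩ := Metric.mem_nhdsWithin_iff.1 hu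
  let χ : ContDiffBump p := ⟨r / 3, r / 2, by positivity, by linarith⟩
  have hχf : ContDiffOn ℝ n (fun y => χ y • f y) {y | 0 ≤ ℓ y} := by
    intro y hy
    by_cases hyr : y ∈ Metric.ball p r
    · have : ContDiffWithinAt ℝ n f (Metric.ball p r ∩ {y | 0 ≤ ℓ y}) y :=
        (hfu.2.mono hru) y ⟨hyr, hy⟩
      rw [inter_comm, contDiffWithinAt_inter'
        (mem_nhdsWithin_of_mem_nhds (Metric.isOpen_ball.mem_nhds hyr))] at this
      exact χ.contDiff.contDiffWithinAt.smul this
    · have h0 : (fun y => χ y • f y) =ᶠ[𝓝 y] fun _ => 0 := by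
        have : y ∈ (Metric.closedBall p (r / 2))ᶜ := by
          simp only [mem_compl_iff, Metric.mem_closedBall, not_le]
          simp only [Metric.mem_ball, not_lt] at hyr
          linarith
        filter_upwards [Metric.isClosed_closedBall.isOpen_compl.mem_nhds this] with z hz
        simp only [mem_compl_iff, Metric.mem_closedBall, not_le] at hz
        rw [χ.zero_of_le_dist hz.le, zero_smul]
      exact (contDiffAt_const.congr_of_eventuallyEq h0).contDiffWithinAt
  obtain ⟨a, ha⟩ := exists_reflect_weights n
  refine ⟨reflectExt ℓ e a (fun j => ((j : ℕ) : ℝ)) fun y => χ y • f y,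
    contDiff_reflectExt he (fun j => by positivity) n ha hχf, ?_⟩
  filter_upwards [self_mem_nhdsWithin,
    mem_nhdsWithin_of_mem_nhds (Metric.ball_mem_nhds p (show 0 < r / 3 by positivity))]
    with y hy hyr
  rw [reflectExt_of_nonneg hy, χ.one_of_mem_closedBall (Metric.ball_subset_closedBall hyr),
    one_smul]

end Extension

/-! ### Composition operators on spaces of continuous functions -/

section Nemytskii

universe u

variable {K : Type*} [TopologicalSpace K] [CompactSpace K]
  {Y Z : Type u} [NormedAddCommGroup Y] [NormedSpace ℝ Y] [NormedAddCommGroup Z] [NormedSpace ℝ Z]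

/-- Pointwise application of a continuous family of operators, as a bounded bilinear map. -/
noncomputable def pointwiseApply :
    C(K, Y →L[ℝ] Z) →L[ℝ] C(K, Y) →L[ℝ] C(K, Z) :=
  LinearMap.mkContinuous₂
    (LinearMap.mk₂ ℝ (fun (B : C(K, Y →L[ℝ] Z)) (η : C(K, Y)) =>
        (⟨fun t => B t (η t), B.continuous.clm_apply η.continuous⟩ : C(K, Z)))
      (fun _ _ _ => by ext; simp) (fun _ _ _ => by ext; simp)
      (fun _ _ _ => by ext; simp) (fun _ _ _ => by ext; simp)) 1
    (fun B η => by
      rw [one_mul]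
      refine (ContinuousMap.norm_le _ (by positivity)).2 fun t => ?_
      exact (B t).le_of_opNorm_le_of_le (B.norm_coe_le_norm t) (η.norm_coe_le_norm t))

@[simp] lemma pointwiseApply_apply (B : C(K, Y →L[ℝ] Z)) (η : C(K, Y)) (t : K) :
    pointwiseApply B η t = B t (η t) := rfl

lemma hasFDerivAt_comp_continuousMap {X : Y → Z} (hX : ContDiff ℝ 1 X) (γ : C(K, Y)) :
    HasFDerivAt (fun γ : C(K, Y) => (⟨X, hX.continuous⟩ : C(Y, Z)).comp γ)
      (pointwiseApply ((⟨fderiv ℝ X, hX.continuous_fderiv one_ne_zero⟩ : C(Y, Y →L[ℝ] Z)).comp γ))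
      γ := by
  set DX : C(Y, Y →L[ℝ] Z) := ⟨fderiv ℝ X, hX.continuous_fderiv one_ne_zero⟩
  rw [hasFDerivAt_iff_isLittleO_nhds_zero, Asymptotics.isLittleO_iff]
  intro ε hε
  have hcont : Tendsto (fun η : C(K, Y) => DX.comp (γ + η)) (𝓝 0) (𝓝 (DX.comp γ)) := by
    have : Continuous fun η : C(K, Y) => DX.comp (γ + η) :=
      (ContinuousMap.continuous_postcomp DX).comp (continuous_const.add continuous_id)
    simpa using this.tendsto 0
  have hev : ∀ᶠ η : C(K, Y) in 𝓝 0, dist (DX.comp (γ + η)) (DX.comp γ) < ε :=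
    hcont.eventually (Metric.ball_mem_nhds (DX.comp γ) hε)
  obtain ⟨δ, hδ, hδε⟩ := Metric.eventually_nhds_iff.1 hev
  filter_upwards [Metric.ball_mem_nhds (0 : C(K, Y)) hδ] with η hη
  refine (ContinuousMap.norm_le _ (by positivity)).2 fun t => ?_
  have hηt : γ t + η t ∈ Metric.ball (γ t) δ := by
    simp only [Metric.mem_ball, dist_self_add_left]
    exact (η.norm_coe_le_norm t).trans_lt (by simpa using hη)
  -- The oscillation of the derivative near `γ t` is controlled through constant perturbations.
  have hb : ∀ u ∈ Metric.ball (γ t) δ, ‖fderiv ℝ X u - fderiv ℝ X (γ t)‖ ≤ ε := by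
    intro u hu
    have h1 : dist (ContinuousMap.const K (u - γ t)) 0 < δ := by
      rw [dist_zero_right]
      refine ((ContinuousMap.norm_le _ (norm_nonneg (u - γ t))).2 fun s => le_rfl).trans_lt ?_
      rwa [← dist_eq_norm]
    have h2 := (ContinuousMap.dist_le hε.le).1 (hδε h1).le t
    simpa [DX, dist_eq_norm] using h2
  have := (convex_ball (γ t) δ).norm_image_sub_le_of_norm_fderiv_le'
    (fun u _ => hX.differentiable one_ne_zero u) hb (Metric.mem_ball_self hδ) hηt
  calc _ = ‖X (γ t + η t) - X (γ t) - fderiv ℝ X (γ t) (γ t + η t - γ t)‖ := by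
        simp [DX]
    _ ≤ ε * ‖η t‖ := by simpa using this
    _ ≤ ε * ‖η‖ := by gcongr; exact η.norm_coe_le_norm t

/-- Composition with a `C^n` map is a `C^n` operation on continuous functions. -/
theorem contDiff_comp_continuousMap (n : ℕ) :
    ∀ {Z : Type u} [NormedAddCommGroup Z] [NormedSpace ℝ Z] {X : Y → Z} (hX : ContDiff ℝ n X),
      ContDiff ℝ n (fun γ : C(K, Y) => (⟨X, hX.continuous⟩ : C(Y, Z)).comp γ) := by
  induction n with
  | zero =>
    intro Z _ _ X hX
    exact contDiff_zero.2 (ContinuousMap.continuous_postcomp _)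
  | succ n ih =>
    intro Z _ _ X hX
    have h1 : ContDiff ℝ 1 X := hX.of_le (by exact_mod_cast Nat.succ_le_succ (Nat.zero_le n))
    have h2 : ContDiff ℝ n (fderiv ℝ X) :=
      hX.fderiv_right (by exact_mod_cast le_rfl)
    suffices h : ContDiff ℝ ((n : WithTop ℕ∞) + 1)
        (fun γ : C(K, Y) => (⟨X, hX.continuous⟩ : C(Y, Z)).comp γ) by exact_mod_cast h
    refine contDiff_succ_iff_hasFDerivAt.2 ⟨_, ?_, hasFDerivAt_comp_continuousMap h1⟩
    exact pointwiseApply.contDiff.comp (ih h2)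

end Nemytskii

/-! ### Smooth dependence of flows on initial values -/

section Flow

/-- A perturbation of the identity of a Banach space by a `C^n` map with Lipschitz constant `1/2`
has a global inverse of class `C^n`. -/
theorem exists_contDiff_inverse_id_sub {B : Type*} [NormedAddCommGroup B] [NormedSpace ℝ B]
    [CompleteSpace B] {n : ℕ} (hn : 1 ≤ n) {T : B → B} (hT : ContDiff ℝ n T)
    (hTlip : ∀ x y, ‖T x - T y‖ ≤ 1 / 2 * ‖x - y‖) :
    ∃ Θ : B → B, ContDiff ℝ n Θ ∧ ∀ b, Θ b - T (Θ b) = b := by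
  have hΨ : ContDiff ℝ n (fun x => x - T x) := contDiff_id.sub hT
  have hlin : ApproximatesLinearOn (fun x => x - T x)
      ((ContinuousLinearEquiv.refl ℝ B :) : B →L[ℝ] B) univ (1 / 2) := by
    intro x _ y _
    have := hTlip x y
    rw [← norm_neg] at this
    simpa [sub_sub_sub_comm] using this
  have hc : Subsingleton B ∨ (1 / 2 : NNReal) <
      ‖((ContinuousLinearEquiv.refl ℝ B).symm : B →L[ℝ] B)‖₊⁻¹ := by
    rcases subsingleton_or_nontrivial B with h | h
    · exact Or.inl h
    · right
      have : ‖((ContinuousLinearEquiv.refl ℝ B).symm : B →L[ℝ] B)‖₊ = 1 :=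
        NNReal.eq (ContinuousLinearMap.norm_id (𝕜 := ℝ) (E := B))
      rw [this, inv_one]
      exact NNReal.half_lt_self one_ne_zero
  have hn0 : (n : WithTop ℕ∞) ≠ 0 := by
    have : n ≠ 0 := by omega
    exact_mod_cast this
  have hderiv : ∀ x, ∃ A : B ≃L[ℝ] B, HasFDerivAt (fun x => x - T x) (A : B →L[ℝ] B) x := by
    intro x
    have hle : ‖fderiv ℝ T x‖ < 1 := by
      have : ‖fderiv ℝ T x‖ ≤ (1 / 2 : NNReal) :=
        norm_fderiv_le_of_lipschitz ℝ (LipschitzWith.of_dist_le_mul fun y z => by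
          simpa [dist_eq_norm] using hTlip y z)
      exact this.trans_lt (by norm_num)
    exact ⟨ContinuousLinearEquiv.ofUnit (Units.oneSub (fderiv ℝ T x) hle),
      (hasFDerivAt_id x).sub (hT.differentiable hn0 x).hasFDerivAt⟩
  choose A hA using hderiv
  exact ⟨(hlin.toHomeomorph _ hc).symm,
    Homeomorph.contDiff_symm (hlin.toHomeomorph _ hc) (f₀' := A) hA hΨ,
    (hlin.toHomeomorph _ hc).apply_symm_apply⟩

variable {Y : Type} [NormedAddCommGroup Y] [NormedSpace ℝ Y]

/-- The solution operator `ζ ↦ (t ↦ ∫₀ᵗ e^{-l(t-s)} ζ(s) ds)` of `η' = -l η + ζ`, `η(0) = 0`. -/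
noncomputable def dampedIntegral (l : ℝ) (ζ : C(Icc (0 : ℝ) 1, Y)) (t : ℝ) : Y :=
  Real.exp (-l * t) • ∫ s in (0 : ℝ)..t, Real.exp (l * s) • ζ (projIcc 0 1 zero_le_one s)

lemma continuous_dampedIntegrand (l : ℝ) (ζ : C(Icc (0 : ℝ) 1, Y)) :
    Continuous fun s : ℝ => Real.exp (l * s) • ζ (projIcc 0 1 zero_le_one s) := by
  have := ζ.continuous.comp (continuous_projIcc (h := zero_le_one (α := ℝ)))
  exact Continuous.smul (by fun_prop) this

lemma continuous_dampedIntegral (l : ℝ) (ζ : C(Icc (0 : ℝ) 1, Y)) :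
    Continuous (dampedIntegral l ζ) := by
  refine Continuous.smul (by fun_prop) ?_
  exact intervalIntegral.continuous_primitive
    (fun a b => (continuous_dampedIntegrand l ζ).intervalIntegrable a b) 0

lemma norm_dampedIntegral_le {l : ℝ} (hl : 0 < l) (ζ : C(Icc (0 : ℝ) 1, Y)) {t : ℝ} (ht : 0 ≤ t) :
    ‖dampedIntegral l ζ t‖ ≤ l⁻¹ * ‖ζ‖ := by
  have h1 : ‖∫ s in (0 : ℝ)..t, Real.exp (l * s) • ζ (projIcc 0 1 zero_le_one s)‖
      ≤ ∫ s in (0 : ℝ)..t, Real.exp (l * s) * ‖ζ‖ := by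
    refine intervalIntegral.norm_integral_le_of_norm_le ht ?_ ?_
    · refine Eventually.of_forall fun s _ => ?_
      rw [norm_smul, Real.norm_eq_abs, abs_of_pos (Real.exp_pos _)]
      gcongr
      exact ζ.norm_coe_le_norm _
    · exact Continuous.intervalIntegrable (by fun_prop) _ _
  have h2 : ∫ s in (0 : ℝ)..t, Real.exp (l * s) * ‖ζ‖
      = l⁻¹ * Real.exp (l * t) * ‖ζ‖ - l⁻¹ * Real.exp (l * 0) * ‖ζ‖ := by
    refine intervalIntegral.integral_eq_sub_of_hasDerivAt
      (f := fun s => l⁻¹ * Real.exp (l * s) * ‖ζ‖) (fun s _ => ?_)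
      (Continuous.intervalIntegrable (by fun_prop) _ _)
    have := (((hasDerivAt_id s).const_mul l).exp.const_mul l⁻¹).mul_const ‖ζ‖
    refine this.congr_deriv ?_
    simp only [id, mul_one]
    field_simp
  rw [dampedIntegral, norm_smul, Real.norm_eq_abs, abs_of_pos (Real.exp_pos _)]
  calc _ ≤ Real.exp (-l * t) * (l⁻¹ * Real.exp (l * t) * ‖ζ‖) := by
        gcongr
        refine h1.trans (h2.le.trans ?_)
        have : 0 ≤ l⁻¹ * Real.exp (l * 0) * ‖ζ‖ := by positivity
        linarith
    _ = (Real.exp (-l * t) * Real.exp (l * t)) * (l⁻¹ * ‖ζ‖) := by ring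
    _ = l⁻¹ * ‖ζ‖ := by rw [← Real.exp_add]; simp

/-- `dampedIntegral` as a bounded operator on continuous functions. -/
noncomputable def dampedIntegralL {l : ℝ} (hl : 0 < l) :
    C(Icc (0 : ℝ) 1, Y) →L[ℝ] C(Icc (0 : ℝ) 1, Y) :=
  LinearMap.mkContinuous
    { toFun := fun ζ => ⟨fun t => dampedIntegral l ζ t,
        (continuous_dampedIntegral l ζ).comp continuous_subtype_val⟩
      map_add' := fun ζ ξ => by
        ext t
        simp only [ContinuousMap.coe_mk, ContinuousMap.add_apply, dampedIntegral, smul_add]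
        rw [intervalIntegral.integral_add
          ((continuous_dampedIntegrand l ζ).intervalIntegrable _ _)
          ((continuous_dampedIntegrand l ξ).intervalIntegrable _ _), smul_add]
      map_smul' := fun c ζ => by
        ext t
        simp only [ContinuousMap.coe_mk, ContinuousMap.smul_apply, dampedIntegral, RingHom.id_apply]
        simp only [smul_comm (Real.exp _) c]
        rw [intervalIntegral.integral_smul, smul_comm] } l⁻¹
    (fun ζ => (ContinuousMap.norm_le _ (by positivity)).2 fun t =>
      norm_dampedIntegral_le hl ζ t.2.1)

lemma dampedIntegralL_apply {l : ℝ} (hl : 0 < l) (ζ : C(Icc (0 : ℝ) 1, Y)) (t : Icc (0 : ℝ) 1) :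
    dampedIntegralL hl ζ t = dampedIntegral l ζ t := rfl

lemma norm_dampedIntegralL_le {l : ℝ} (hl : 0 < l) :
    ‖dampedIntegralL (Y := Y) hl‖ ≤ l⁻¹ :=
  LinearMap.mkContinuous_norm_le _ (by positivity) _

/-- Multiplication by `e^{l t}` on continuous functions on `[0, 1]`. -/
noncomputable def expMul (l : ℝ) : C(Icc (0 : ℝ) 1, Y) →L[ℝ] C(Icc (0 : ℝ) 1, Y) :=
  pointwiseApply ⟨fun t : Icc (0 : ℝ) 1 => Real.exp (l * t) • ContinuousLinearMap.id ℝ Y,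
    by fun_prop⟩

@[simp] lemma expMul_apply (l : ℝ) (η : C(Icc (0 : ℝ) 1, Y)) (t : Icc (0 : ℝ) 1) :
    expMul l η t = Real.exp (l * t) • η t := rfl

lemma norm_dampedIntegralL_sub_le {l : ℝ} (hl : 0 < l) {K : NNReal}
    {N : C(Icc (0 : ℝ) 1, Y) → C(Icc (0 : ℝ) 1, Y)}
    (hN : ∀ γ₁ γ₂ t, ‖N γ₁ t - N γ₂ t‖ ≤ K * ‖γ₁ t - γ₂ t‖) (η₁ η₂ : C(Icc (0 : ℝ) 1, Y)) :
    ‖dampedIntegralL hl (expMul (-l) (N (expMul l η₁)))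
      - dampedIntegralL hl (expMul (-l) (N (expMul l η₂)))‖ ≤ l⁻¹ * K * ‖η₁ - η₂‖ := by
  rw [← map_sub, ← map_sub, mul_assoc]
  have h : ‖expMul (-l) (N (expMul l η₁) - N (expMul l η₂))‖ ≤ K * ‖η₁ - η₂‖ := by
    refine (ContinuousMap.norm_le _ (by positivity)).2 fun t => ?_
    rw [expMul_apply, norm_smul, Real.norm_eq_abs, abs_of_pos (Real.exp_pos _)]
    have h1 : ‖(N (expMul l η₁) - N (expMul l η₂)) t‖
        ≤ K * (Real.exp (l * t) * ‖η₁ - η₂‖) := by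
      refine (hN _ _ t).trans ?_
      simp only [expMul_apply]
      rw [← smul_sub, norm_smul, Real.norm_eq_abs, abs_of_pos (Real.exp_pos _)]
      gcongr
      exact (η₁ - η₂).norm_coe_le_norm t
    calc _ ≤ Real.exp (-l * t) * (K * (Real.exp (l * t) * ‖η₁ - η₂‖)) := by gcongr
      _ = (Real.exp (-l * t) * Real.exp (l * t)) * (K * ‖η₁ - η₂‖) := by ring
      _ = _ := by rw [← Real.exp_add]; simp
  refine (ContinuousLinearMap.le_opNorm _ _).trans ?_
  exact mul_le_mul (norm_dampedIntegralL_le hl) h (norm_nonneg _) (by positivity)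

/-- Existence of a global flow on `[0, 1]` which depends on the initial value as smoothly as the
vector field, for globally Lipschitz fields. In terms of `η(t) = e^{-lt} γ(t)` with `l` large, the
integral equation is a Lipschitz-small perturbation of the identity on `C([0, 1], Y)`, so that the
inverse function theorem applies globally. -/
theorem exists_flow_of_lipschitz [CompleteSpace Y] {n : ℕ} (hn : 1 ≤ n) {X : Y → Y}
    (hX : ContDiff ℝ n X) {K : NNReal} (hK : LipschitzWith K X) :
    ∃ φ : Y → ℝ → Y, (∀ a, φ a 0 = a) ∧ (∀ t ∈ Icc (0 : ℝ) 1, ContDiff ℝ n fun a => φ a t) ∧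
      ∀ a, ∀ t ∈ Icc (0 : ℝ) 1, HasDerivAt (φ a) (X (φ a t)) t := by
  obtain ⟨l, hldef⟩ : ∃ l : ℝ, l = 2 * K + 1 := ⟨_, rfl⟩
  have hl : 0 < l := by rw [hldef]; positivity
  let N : C(Icc (0 : ℝ) 1, Y) → C(Icc (0 : ℝ) 1, Y) := fun γ =>
    (⟨X, hX.continuous⟩ : C(Y, Y)).comp γ
  let T : C(Icc (0 : ℝ) 1, Y) → C(Icc (0 : ℝ) 1, Y) := fun η =>
    dampedIntegralL hl (expMul (-l) (N (expMul l η)))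
  have hT : ContDiff ℝ n T :=
    (dampedIntegralL hl).contDiff.comp ((expMul (-l)).contDiff.comp
      ((contDiff_comp_continuousMap n hX).comp (expMul l).contDiff))
  have hTlip : ∀ η₁ η₂, ‖T η₁ - T η₂‖ ≤ 1 / 2 * ‖η₁ - η₂‖ := by
    intro η₁ η₂
    refine (norm_dampedIntegralL_sub_le hl (fun γ₁ γ₂ t => hK.norm_sub_le _ _) η₁ η₂).trans ?_
    gcongr
    rw [inv_mul_le_iff₀ hl, hldef]
    linarith
  obtain ⟨Θ, hΘ, hΘT⟩ := exists_contDiff_inverse_id_sub hn hT hTlip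
  let γ : Y → C(Icc (0 : ℝ) 1, Y) := fun a =>
    expMul l (Θ (expMul (-l) (ContinuousMap.const _ a)))
  have hγ : ContDiff ℝ n γ := by
    have hconst : ContDiff ℝ n fun a : Y => ContinuousMap.const (Icc (0 : ℝ) 1) a :=
      (ContinuousLinearMap.const (M := Y) ℝ (Icc (0 : ℝ) 1)).contDiff
    exact (expMul l).contDiff.comp (hΘ.comp ((expMul (Y := Y) (-l)).contDiff.comp hconst))
  have hfix : ∀ a (t : Icc (0 : ℝ) 1), γ a t
      = a + ∫ s in (0 : ℝ)..t, X (γ a (projIcc 0 1 zero_le_one s)) := by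
    intro a t
    set η := Θ (expMul (-l) (ContinuousMap.const _ a)) with hη
    have h1 : η - T η = expMul (-l) (ContinuousMap.const _ a) := hΘT _
    have h2 := DFunLike.congr_fun h1 t
    simp only [ContinuousMap.sub_apply, expMul_apply, ContinuousMap.const_apply,
      sub_eq_iff_eq_add] at h2
    have h3 : γ a t = Real.exp (l * t) • η t := rfl
    rw [h3, h2, smul_add, smul_smul, ← Real.exp_add]
    simp only [T, dampedIntegralL_apply, dampedIntegral]
    rw [smul_smul, ← Real.exp_add]
    simp only [neg_mul, add_neg_cancel, Real.exp_zero, one_smul]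
    congr 1
    refine intervalIntegral.integral_congr fun s hs => ?_
    rw [uIcc_of_le t.2.1] at hs
    have hs' : (projIcc 0 1 zero_le_one s : ℝ) = s := by
      rw [projIcc_of_mem zero_le_one ⟨hs.1, hs.2.trans t.2.2⟩]
    simp only [expMul_apply, hs', smul_smul, ← Real.exp_add]
    simp [N, γ, η]
  refine ⟨fun a t => a + ∫ s in (0 : ℝ)..t, X (γ a (projIcc 0 1 zero_le_one s)), ?_, ?_, ?_⟩
  · intro a; simp
  · intro t ht
    have : (fun a => a + ∫ s in (0 : ℝ)..t, X (γ a (projIcc 0 1 zero_le_one s)))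
        = fun a => ContinuousMap.evalCLM ℝ (⟨t, ht⟩ : Icc (0 : ℝ) 1) (γ a) :=
      funext fun a => (hfix a ⟨t, ht⟩).symm
    rw [this]
    exact (ContinuousMap.evalCLM ℝ (⟨t, ht⟩ : Icc (0 : ℝ) 1)).contDiff.comp hγ
  · intro a t ht
    have hc : Continuous fun s => X (γ a (projIcc 0 1 zero_le_one s)) :=
      hX.continuous.comp ((γ a).continuous.comp continuous_projIcc)
    have h1 := (intervalIntegral.integral_hasDerivAt_right (hc.intervalIntegrable 0 t)
      hc.stronglyMeasurable.stronglyMeasurableAtFilter hc.continuousAt).const_add a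
    have h2 := hfix a ⟨t, ht⟩
    rw [projIcc_of_mem zero_le_one ht, h2] at h1
    exact h1

/-- A vector field of class `C^n` coincides near a given compact set `K` with a field that has a
global flow `φ` of class `C^n`. -/
theorem exists_flow [FiniteDimensional ℝ Y] {n : ℕ} (hn : 1 ≤ n) {X : Y → Y} (hX : ContDiff ℝ n X)
    {K : Set Y} (hK : IsCompact K) :
    ∃ (φ : Y → ℝ → Y) (U : Set Y) (C : ℝ), IsOpen U ∧ K ⊆ U ∧ (∀ a, φ a 0 = a) ∧
      (∀ t ∈ Icc (0 : ℝ) 1, ContDiff ℝ n fun a => φ a t) ∧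
      (∀ a b, ∀ t ∈ Icc (0 : ℝ) 1, dist (φ a t) (φ b t) ≤ dist a b * C) ∧
      (∀ a, ContinuousOn (φ a) (Icc 0 1)) ∧
      (∀ a, ∀ t ∈ Icc (0 : ℝ) 1, φ a t ∈ U → HasDerivAt (φ a) (X (φ a t)) t) ∧
      ∀ z : ℝ → Y, (∀ t ∈ Icc (0 : ℝ) 1, HasDerivWithinAt z (X (z t)) (Icc 0 1) t) →
        (∀ t ∈ Icc (0 : ℝ) 1, z t ∈ K) → ∀ t ∈ Icc (0 : ℝ) 1, z t = φ (z 0) t := by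
  obtain ⟨R, hR, hKR⟩ : ∃ R : ℝ, 0 < R ∧ K ⊆ Metric.ball (0 : Y) R := by
    obtain ⟨R, hR⟩ := hK.isBounded.subset_ball (0 : Y)
    exact ⟨max R 1, by positivity, hR.trans (Metric.ball_subset_ball (le_max_left _ _))⟩
  let χ : ContDiffBump (0 : Y) := ⟨R, R + 1, hR, by linarith⟩
  have hχX : ContDiff ℝ n fun y => χ y • X y := χ.contDiff.smul hX
  have hn0 : (n : WithTop ℕ∞) ≠ 0 := by
    have : n ≠ 0 := by omega
    exact_mod_cast this
  obtain ⟨L, hL⟩ := ContDiff.lipschitzWith_of_hasCompactSupport (𝕂 := ℝ)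
    (χ.hasCompactSupport.smul_right (f' := X)) hχX hn0
  have hχ1 : ∀ y ∈ Metric.ball (0 : Y) R, χ y • X y = X y := fun y hy => by
    rw [χ.one_of_mem_closedBall (Metric.ball_subset_closedBall hy), one_smul]
  obtain ⟨φ, h0, hsm, hd⟩ := exists_flow_of_lipschitz hn hχX hL
  have hcont : ∀ a, ContinuousOn (φ a) (Icc 0 1) := fun a t ht =>
    (hd a t ht).continuousAt.continuousWithinAt
  have hd' : ∀ a, ∀ t ∈ Ico (0 : ℝ) 1,
      HasDerivWithinAt (φ a) (χ (φ a t) • X (φ a t)) (Ici t) t :=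
    fun a t ht => (hd a t (Ico_subset_Icc_self ht)).hasDerivWithinAt
  refine ⟨φ, Metric.ball 0 R, Real.exp L, Metric.isOpen_ball, hKR, h0, hsm, ?_, hcont, ?_, ?_⟩
  · intro a b t ht
    refine (dist_le_of_trajectories_ODE (v := fun _ y => χ y • X y) (fun _ => hL) (hcont a) (hd' a)
      (hcont b) (hd' b) (by rw [h0, h0]) t ht).trans ?_
    gcongr
    rw [sub_zero]
    exact mul_le_of_le_one_right L.2 ht.2
  · intro a t ht hU
    have := hd a t ht
    rwa [hχ1 _ hU] at this
  · intro z hz hzK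
    refine ODE_solution_unique (v := fun _ y => χ y • X y) (fun _ => hL)
      (fun t ht => (hz t ht).continuousWithinAt) (fun t ht => ?_) (hcont _) (hd' _) (h0 _).symm
    rw [hχ1 _ (hKR (hzK t (Ico_subset_Icc_self ht)))]
    exact (hz t (Ico_subset_Icc_self ht)).mono_of_mem_nhdsWithin
      (mem_of_superset (Ico_mem_nhdsGE ht.2) fun s hs => ⟨ht.1.trans hs.1, hs.2.le⟩)

end Flow

/-! ### The inverse function theorem in finite dimension -/

section LocalInverse

/-- The `C^n` inverse function theorem for self-maps of a finite-dimensional space: injectivity of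
the derivative suffices. -/
theorem exists_contDiffAt_localInverse {E : Type*} [NormedAddCommGroup E] [NormedSpace ℝ E]
    [FiniteDimensional ℝ E] {n : WithTop ℕ∞} (hn : n ≠ 0) {f : E → E} {a : E}
    (hf : ContDiffAt ℝ n f a) {A : E →L[ℝ] E} (hA : HasFDerivAt f A a)
    (hinj : Function.Injective A) :
    ∃ g : E → E, ContDiffAt ℝ n g (f a) ∧ g (f a) = a ∧ (∀ᶠ y in 𝓝 (f a), f (g y) = y) ∧
      ∀ᶠ x in 𝓝 a, g (f x) = x := by
  have : CompleteSpace E := FiniteDimensional.complete ℝ E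
  let B : E ≃L[ℝ] E := (LinearEquiv.ofInjectiveEndo A.toLinearMap hinj).toContinuousLinearEquiv
  have hB : HasFDerivAt f (B : E →L[ℝ] E) a := by
    convert hA using 1
    ext x
    rfl
  exact ⟨hf.localInverse hB hn, hf.to_localInverse hB hn, hf.localInverse_apply_image hB hn,
    (hf.hasStrictFDerivAt' hB hn).eventually_right_inverse,
    (hf.hasStrictFDerivAt' hB hn).eventually_left_inverse⟩

end LocalInverse

/-! ### Trajectories and conservation of energy -/

section Trajectories

variable {V : Type} [NormedAddCommGroup V] [NormedSpace ℝ V]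

/-- `c` is a solution on `[0, T]` of the second-order equation `c'' = acc(c, c', τ)` with velocity
`c'`; the real parameter `τ` is the strength of the potential. -/
structure IsTrajectory (acc : V → V → ℝ → V) (τ T : ℝ) (c c' : ℝ → V) : Prop where
  deriv : ∀ t ∈ Icc 0 T, HasDerivWithinAt c (c' t) (Icc 0 T) t
  deriv' : ∀ t ∈ Icc 0 T, HasDerivWithinAt c' (acc (c t) (c' t) τ) (Icc 0 T) t

/-- There is a trajectory on `[0, 1]`, of strength `τ` and contained in `D`, from `x` to `y` with
initial velocity `v`. -/
def Joins (acc : V → V → ℝ → V) (D : Set V) (x v : V) (τ : ℝ) (y : V) : Prop :=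
  ∃ c c' : ℝ → V, IsTrajectory acc τ 1 c c' ∧ (∀ t ∈ Icc (0 : ℝ) 1, c t ∈ D) ∧
    c 0 = x ∧ c' 0 = v ∧ c 1 = y

/-- `acc` is homogeneous of degree two in the velocity, the strength of the potential counting
twice. Slowing down a trajectory by a factor `s` multiplies the strength by `s²`. -/
def IsHomogeneous (acc : V → V → ℝ → V) : Prop :=
  ∀ p u τ s, acc p (s • u) (s ^ 2 * τ) = s ^ 2 • acc p u τ

lemma IsTrajectory.rescale {acc : V → V → ℝ → V} (hacc : IsHomogeneous acc) {τ T S : ℝ}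
    {r : ℝ} (hr : 0 ≤ r) (hrS : r * S ≤ T) {c c' : ℝ → V}
    (h : IsTrajectory acc τ T c c') :
    IsTrajectory acc (r ^ 2 * τ) S (fun t => c (r * t)) (fun t => r • c' (r * t)) := by
  have hmaps : MapsTo (fun t => r * t) (Icc 0 S) (Icc 0 T) := fun t ht =>
    ⟨mul_nonneg hr ht.1, (mul_le_mul_of_nonneg_left ht.2 hr).trans hrS⟩
  have hlin : ∀ t, HasDerivWithinAt (fun t => r * t) r (Icc 0 S) t := fun t => by
    simpa using ((hasDerivAt_id t).const_mul r).hasDerivWithinAt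
  refine ⟨fun t ht => (h.deriv _ (hmaps ht)).scomp t (hlin t) hmaps, fun t ht => ?_⟩
  rw [hacc, pow_two, mul_smul]
  exact ((h.deriv' _ (hmaps ht)).scomp t (hlin t) hmaps).const_smul r

lemma Joins.mem_left {acc : V → V → ℝ → V} {D : Set V} {x v y : V} {τ : ℝ}
    (h : Joins acc D x v τ y) : x ∈ D := by
  obtain ⟨c, c', -, hD, rfl, -, -⟩ := h
  exact hD 0 ⟨le_rfl, zero_le_one⟩

lemma Joins.mem_right {acc : V → V → ℝ → V} {D : Set V} {x v y : V} {τ : ℝ}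
    (h : Joins acc D x v τ y) : y ∈ D := by
  obtain ⟨c, c', -, hD, -, -, rfl⟩ := h
  exact hD 1 ⟨zero_le_one, le_rfl⟩

/-- A shorter initial piece of a trajectory, run through on `[0, 1]`. -/
lemma Joins.rescale {acc : V → V → ℝ → V} (hacc : IsHomogeneous acc) {D : Set V} {x v y : V}
    {τ r : ℝ} (hr : 0 ≤ r) (hr1 : r ≤ 1) (h : Joins acc D x v τ y) :
    ∃ z, Joins acc D x (r • v) (r ^ 2 * τ) z := by
  obtain ⟨c, c', ht, hD, rfl, rfl, rfl⟩ := h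
  refine ⟨_, _, _, ht.rescale hacc hr (by simpa using hr1), fun t ht => ?_, by simp,
    by simp, rfl⟩
  exact hD _ ⟨mul_nonneg hr ht.1, mul_le_one₀ hr1 ht.1 ht.2⟩

/-- The equation of motion of strength `τ` on a space with metric `m` and potential `q`, up to the
precise form of the force: `acc` is homogeneous and conserves the energy `m(c', c')/2 + τ q`. -/
structure IsMechanical (acc : V → V → ℝ → V) (m : V → V →L[ℝ] V →L[ℝ] ℝ) (q : V → ℝ) : Prop where
  contDiff_acc : ContDiff ℝ 1 fun z : V × V × ℝ => acc z.1 z.2.1 z.2.2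
  homogeneous : IsHomogeneous acc
  contDiff_metric : ContDiff ℝ 1 m
  symm : ∀ p u w, m p u w = m p w u
  pos : ∀ p u, u ≠ 0 → 0 < m p u u
  contDiff_potential : ContDiff ℝ 1 q
  energy : ∀ p u τ, m p (acc p u τ) u + fderiv ℝ m p u u u / 2 + τ * fderiv ℝ q p u = 0

namespace IsMechanical

variable {acc : V → V → ℝ → V} {m : V → V →L[ℝ] V →L[ℝ] ℝ} {q : V → ℝ}

lemma acc_zero (h : IsMechanical acc m q) (p : V) : acc p 0 0 = 0 := by
  have := h.homogeneous p 0 0 0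
  simpa using this

lemma nonneg (h : IsMechanical acc m q) (p u : V) : 0 ≤ m p u u := by
  rcases eq_or_ne u 0 with rfl | hu
  · simp
  · exact (h.pos p u hu).le

/-- Conservation of energy. -/
lemma energy_eq (h : IsMechanical acc m q) {τ T : ℝ} {c c' : ℝ → V}
    (hc : IsTrajectory acc τ T c c') {t : ℝ} (ht : t ∈ Icc 0 T) :
    m (c t) (c' t) (c' t) + 2 * τ * q (c t) = m (c 0) (c' 0) (c' 0) + 2 * τ * q (c 0) := by
  have key : ∀ t ∈ Icc 0 T, HasDerivWithinAt
      (fun t => m (c t) (c' t) (c' t) + 2 * τ * q (c t)) 0 (Icc 0 T) t := by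
    intro t ht
    have hm := ((h.contDiff_metric.differentiable one_ne_zero (c t)).hasFDerivAt
      ).comp_hasDerivWithinAt t (hc.deriv t ht)
    have hq := ((h.contDiff_potential.differentiable one_ne_zero (c t)).hasFDerivAt
      ).comp_hasDerivWithinAt t (hc.deriv t ht)
    have := ((hm.clm_apply (hc.deriv' t ht)).clm_apply (hc.deriv' t ht)).add
      (hq.const_mul (2 * τ))
    refine this.congr_deriv ?_
    have he := h.energy (c t) (c' t) τ
    have hs := h.symm (c t) (c' t) (acc (c t) (c' t) τ)
    simp only [Function.comp, add_apply]
    rw [hs]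
    linarith
  exact constant_of_derivWithin_zero (fun t ht => (key t ht).differentiableWithinAt)
    (fun t ht => (key t (Ico_subset_Icc_self ht)).derivWithin
      (uniqueDiffOn_Icc (ht.1.trans_lt ht.2) t (Ico_subset_Icc_self ht))) t ht

variable [FiniteDimensional ℝ V]

lemma exists_norm_bounds (h : IsMechanical acc m q) {K : Set V} (hK : IsCompact K) :
    ∃ l > 0, ∃ L > 0, ∀ p ∈ K, ∀ u, l * ‖u‖ ^ 2 ≤ m p u u ∧ m p u u ≤ L * ‖u‖ ^ 2 := by
  have hcont : Continuous fun z : V × V => m z.1 z.2 z.2 :=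
    ((h.contDiff_metric.continuous.comp continuous_fst).clm_apply continuous_snd).clm_apply
      continuous_snd
  have hKS : IsCompact (K ×ˢ Metric.sphere (0 : V) 1) := hK.prod (isCompact_sphere 0 1)
  obtain ⟨l, hl, hlb⟩ : ∃ l > 0, ∀ z ∈ K ×ˢ Metric.sphere (0 : V) 1, l ≤ m z.1 z.2 z.2 := by
    rcases (K ×ˢ Metric.sphere (0 : V) 1).eq_empty_or_nonempty with he | hne
    · exact ⟨1, one_pos, fun z hz => by simp [he] at hz⟩
    · obtain ⟨z, hz, hmin⟩ := hKS.exists_isMinOn hne hcont.continuousOn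
      refine ⟨m z.1 z.2 z.2, h.pos _ _ ?_, fun w hw => hmin hw⟩
      have : ‖z.2‖ = 1 := by simpa using hz.2
      exact norm_ne_zero_iff.1 (by rw [this]; exact one_ne_zero)
  obtain ⟨L, hLb⟩ := hKS.exists_bound_of_continuousOn hcont.continuousOn
  refine ⟨l, hl, max L 1, by positivity, fun p hp u => ?_⟩
  rcases eq_or_ne u 0 with rfl | hu
  · simp
  have hu' : 0 < ‖u‖ := norm_pos_iff.2 hu
  have hz : (p, ‖u‖⁻¹ • u) ∈ K ×ˢ Metric.sphere (0 : V) 1 := by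
    refine ⟨hp, ?_⟩
    simp [norm_smul, hu'.ne']
  have he : m p u u = ‖u‖ ^ 2 * m p (‖u‖⁻¹ • u) (‖u‖⁻¹ • u) := by
    simp only [map_smul, smul_apply, smul_eq_mul]
    field_simp
  have h1 := hlb _ hz
  have h2 := (le_abs_self _).trans ((hLb _ hz).trans (le_max_left L 1))
  simp only at h1 h2
  rw [he]
  constructor <;> nlinarith [sq_nonneg ‖u‖]

/-- Consequence of energy conservation: the velocity along a trajectory is bounded by the initial
velocity. -/
lemma exists_velocity_le (h : IsMechanical acc m q) {K : Set V} (hK : IsCompact K)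
    (δ₁ : ℝ) :
    ∃ B, ∀ δ, |δ| ≤ δ₁ → ∀ c c' : ℝ → V,
      IsTrajectory acc (δ * m (c 0) (c' 0) (c' 0)) 1 c c' → (∀ t ∈ Icc (0 : ℝ) 1, c t ∈ K) →
      ∀ t ∈ Icc (0 : ℝ) 1, ‖c' t‖ ≤ B * ‖c' 0‖ := by
  obtain ⟨l, hl, L, hL, hb⟩ := h.exists_norm_bounds hK
  obtain ⟨Q, hQ⟩ := hK.exists_bound_of_continuousOn h.contDiff_potential.continuous.continuousOn
  refine ⟨Real.sqrt ((1 + 4 * |δ₁| * |Q|) * L / l), ?_⟩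
  intro δ hδ c c' hc hcK t ht
  have h0 : (0 : ℝ) ∈ Icc (0 : ℝ) 1 := ⟨le_rfl, zero_le_one⟩
  have he := h.energy_eq hc ht
  set e := m (c 0) (c' 0) (c' 0) with hedef
  have he0 : 0 ≤ e := h.nonneg _ _
  have hq : |q (c 0) - q (c t)| ≤ 2 * |Q| := by
    have h1 := (hQ _ (hcK 0 h0)).trans (le_abs_self Q)
    have h2 := (hQ _ (hcK t ht)).trans (le_abs_self Q)
    rw [Real.norm_eq_abs] at h1 h2
    have := abs_sub (q (c 0)) (q (c t))
    linarith
  have hsmall : |2 * (δ * e) * (q (c 0) - q (c t))| ≤ 4 * |δ₁| * |Q| * e := by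
    rw [abs_mul, abs_mul, abs_mul, abs_of_nonneg he0, abs_of_pos (by norm_num : (0 : ℝ) < 2)]
    have := hδ.trans (le_abs_self δ₁)
    calc 2 * (|δ| * e) * |q (c 0) - q (c t)| ≤ 2 * (|δ₁| * e) * (2 * |Q|) := by gcongr
      _ = 4 * |δ₁| * |Q| * e := by ring
  have hup : m (c t) (c' t) (c' t) ≤ (1 + 4 * |δ₁| * |Q|) * e := by
    linarith [le_of_abs_le hsmall]
  have hbt := (hb _ (hcK t ht) (c' t)).1
  have hb0 := (hb _ (hcK 0 h0) (c' 0)).2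
  have : ‖c' t‖ ^ 2 ≤ (1 + 4 * |δ₁| * |Q|) * L / l * ‖c' 0‖ ^ 2 := by
    rw [div_mul_eq_mul_div, le_div_iff₀ hl]
    calc ‖c' t‖ ^ 2 * l = l * ‖c' t‖ ^ 2 := mul_comm _ _
      _ ≤ (1 + 4 * |δ₁| * |Q|) * e := hbt.trans hup
      _ ≤ (1 + 4 * |δ₁| * |Q|) * (L * ‖c' 0‖ ^ 2) := by gcongr
      _ = _ := by ring
  have h3 := Real.sqrt_le_sqrt this
  rwa [Real.sqrt_sq (norm_nonneg _), Real.sqrt_mul (by positivity),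
    Real.sqrt_sq (norm_nonneg _)] at h3

/-- Consequence of energy conservation, for weak potentials: a trajectory that is not at rest
initially never comes to rest, and the strength of the potential remains small relative to the
square of the velocity. -/
lemma exists_strength_le (h : IsMechanical acc m q) {K : Set V} (hK : IsCompact K)
    {η : ℝ} (hη : 0 < η) :
    ∃ δ₁ > 0, ∀ δ, |δ| ≤ δ₁ → ∀ c c' : ℝ → V,
      IsTrajectory acc (δ * m (c 0) (c' 0) (c' 0)) 1 c c' → (∀ t ∈ Icc (0 : ℝ) 1, c t ∈ K) →
      c' 0 ≠ 0 → ∀ t ∈ Icc (0 : ℝ) 1,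
        c' t ≠ 0 ∧ |δ * m (c 0) (c' 0) (c' 0)| ≤ η * ‖c' t‖ ^ 2 := by
  obtain ⟨l, hl, L, hL, hb⟩ := h.exists_norm_bounds hK
  obtain ⟨Q, hQ⟩ := hK.exists_bound_of_continuousOn h.contDiff_potential.continuous.continuousOn
  have hQ0 : 0 < |Q| + 1 := by positivity
  refine ⟨min (1 / (8 * (|Q| + 1))) (η / (2 * L)), by positivity, ?_⟩
  intro δ hδ c c' hc hcK hne t ht
  have h0 : (0 : ℝ) ∈ Icc (0 : ℝ) 1 := ⟨le_rfl, zero_le_one⟩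
  have hδ1 : |δ| * (8 * (|Q| + 1)) ≤ 1 := by
    have := hδ.trans (min_le_left _ _)
    rwa [le_div_iff₀ (by positivity)] at this
  have hδ2 : |δ| * (2 * L) ≤ η := by
    have := hδ.trans (min_le_right _ _)
    rwa [le_div_iff₀ (by positivity)] at this
  have he := h.energy_eq hc ht
  set e := m (c 0) (c' 0) (c' 0) with hedef
  have he0 : 0 < e := h.pos _ _ hne
  have hq : |q (c 0) - q (c t)| ≤ 2 * (|Q| + 1) := by
    have h1 := (hQ _ (hcK 0 h0)).trans (le_abs_self Q)
    have h2 := (hQ _ (hcK t ht)).trans (le_abs_self Q)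
    rw [Real.norm_eq_abs] at h1 h2
    have := abs_sub (q (c 0)) (q (c t))
    linarith
  have hsmall : |2 * (δ * e) * (q (c 0) - q (c t))| ≤ e / 2 := by
    rw [abs_mul, abs_mul, abs_mul, abs_of_pos he0, abs_of_pos (by norm_num : (0 : ℝ) < 2)]
    calc 2 * (|δ| * e) * |q (c 0) - q (c t)| ≤ 2 * (|δ| * e) * (2 * (|Q| + 1)) := by gcongr
      _ = (|δ| * (8 * (|Q| + 1))) * (e / 2) := by ring
      _ ≤ 1 * (e / 2) := by gcongr
      _ = e / 2 := one_mul _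
  have hlow : e / 2 ≤ m (c t) (c' t) (c' t) := by
    linarith [neg_le_of_abs_le hsmall]
  refine ⟨fun h3 => ?_, ?_⟩
  · rw [h3] at hlow
    simp only [map_zero] at hlow
    linarith
  · have hbt := (hb _ (hcK t ht) (c' t)).2
    rw [abs_mul, abs_of_pos he0]
    calc |δ| * e ≤ |δ| * (2 * (L * ‖c' t‖ ^ 2)) := by
          gcongr; linarith
      _ = |δ| * (2 * L) * ‖c' t‖ ^ 2 := by ring
      _ ≤ _ := by gcongr

end IsMechanical

end Trajectories

/-! ### Strictly convex sets -/

section Convexity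

variable {V : Type} [NormedAddCommGroup V] [NormedSpace ℝ V]

/-- `ρ` is a defining function of `D` near the boundary point `p`, and `D` is strictly convex at `p`
for the flow of strength zero: trajectories tangent to the boundary at `p` have contact of exactly
second order with it and lie outside `D`. -/
structure IsConvexBoundaryFunction (acc : V → V → ℝ → V) (D : Set V) (p : V) (ρ : V → ℝ) :
    Prop where
  contDiffAt : ContDiffAt ℝ 2 ρ p
  eq_zero : ρ p = 0
  mem_iff : ∀ᶠ z in 𝓝 p, z ∈ D ↔ 0 ≤ ρ z
  concave : ∀ u, u ≠ 0 → fderiv ℝ ρ p u = 0 →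
    fderiv ℝ (fderiv ℝ ρ) p u u + fderiv ℝ ρ p (acc p u 0) < 0

/-- Along a curve that is tangent to a level set of `ρ` and curved downwards at time `t`, the
function `ρ` has no local minimum at `t`. -/
lemma not_isLocalMin_comp {ρ : V → ℝ} {c c' : ℝ → V} {t : ℝ} {w : V}
    (hρ : ContDiffAt ℝ 2 ρ (c t)) (hc : ∀ᶠ s in 𝓝 t, HasDerivAt c (c' s) s)
    (hc' : HasDerivAt c' w t)
    (hneg : fderiv ℝ ρ (c t) (c' t) = 0 →
      fderiv ℝ (fderiv ℝ ρ) (c t) (c' t) (c' t) + fderiv ℝ ρ (c t) w < 0) :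
    ¬ IsLocalMin (ρ ∘ c) t := by
  intro hmin
  have hct : ContinuousAt c t := hc.self_of_nhds.continuousAt
  have hρd : ∀ᶠ z in 𝓝 (c t), DifferentiableAt ℝ ρ z :=
    (hρ.eventually (by simp)).mono fun z hz => hz.differentiableAt two_ne_zero
  have hψ : ∀ᶠ s in 𝓝 t, HasDerivAt (ρ ∘ c) (fderiv ℝ ρ (c s) (c' s)) s := by
    filter_upwards [hc, hct.eventually hρd] with s hs hρs
    exact hρs.hasFDerivAt.comp_hasDerivAt s hs
  have hψ' : deriv (ρ ∘ c) =ᶠ[𝓝 t] fun s => fderiv ℝ ρ (c s) (c' s) :=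
    hψ.mono fun s hs => hs.deriv
  have h0 : fderiv ℝ ρ (c t) (c' t) = 0 := by
    rw [← hψ.self_of_nhds.deriv]; exact hmin.deriv_eq_zero
  have hρ' : DifferentiableAt ℝ (fderiv ℝ ρ) (c t) :=
    (hρ.fderiv_right (m := 1) (by norm_num)).differentiableAt one_ne_zero
  have h2 : deriv (deriv (ρ ∘ c)) t < 0 := by
    have hd : HasDerivAt (fun s => fderiv ℝ ρ (c s) (c' s)) _ t :=
      (hρ'.hasFDerivAt.comp_hasDerivAt t hc.self_of_nhds).clm_apply hc'
    rw [hψ'.deriv_eq, hd.deriv]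
    exact hneg h0
  have hmax : IsLocalMax (ρ ∘ c) t := isLocalMax_of_deriv_deriv_neg h2
    (hψ.self_of_nhds.deriv.trans h0) hψ.self_of_nhds.continuousAt
  have hconst : ρ ∘ c =ᶠ[𝓝 t] fun _ => (ρ ∘ c) t := by
    filter_upwards [hmin, hmax] with s h3 h4
    exact le_antisymm h4 h3
  have h3 : deriv (ρ ∘ c) =ᶠ[𝓝 t] fun _ => 0 := by
    filter_upwards [hconst.deriv] with s hs
    rw [hs]; simp
  rw [h3.deriv_eq] at h2
  simp at h2

variable {acc : V → V → ℝ → V} {D : Set V} {p : V} {ρ : V → ℝ}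

/-- Strict convexity is stable: it persists near the boundary point and for weak potentials. The
inequality holds uniformly on the unit sphere by compactness, hence for all velocities by
homogeneity. -/
lemma IsConvexBoundaryFunction.exists_uniform [FiniteDimensional ℝ V]
    (h : IsConvexBoundaryFunction acc D p ρ)
    (hacc : Continuous fun z : V × V × ℝ => acc z.1 z.2.1 z.2.2) (hom : IsHomogeneous acc) :
    ∃ r > 0, ∃ η > 0, ∀ z ∈ Metric.ball p r, ContDiffAt ℝ 2 ρ z ∧ (z ∈ D ↔ 0 ≤ ρ z) ∧
      ∀ u τ, u ≠ 0 → |τ| ≤ η * ‖u‖ ^ 2 → fderiv ℝ ρ z u = 0 →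
        fderiv ℝ (fderiv ℝ ρ) z u u + fderiv ℝ ρ z (acc z u τ) < 0 := by
  have h1 : ContinuousAt (fderiv ℝ ρ) p :=
    (h.contDiffAt.fderiv_right (m := 1) (by norm_num)).continuousAt
  have h2 : ContinuousAt (fderiv ℝ (fderiv ℝ ρ)) p :=
    ((h.contDiffAt.fderiv_right (m := 1) (by norm_num)).fderiv_right (m := 0)
      (by norm_num)).continuousAt
  have key : ∀ᶠ z : V × ℝ in 𝓝 (p, 0), ∀ u ∈ Metric.sphere (0 : V) 1,
      fderiv ℝ ρ z.1 u = 0 →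
        fderiv ℝ (fderiv ℝ ρ) z.1 u u + fderiv ℝ ρ z.1 (acc z.1 u z.2) < 0 := by
    refine (isCompact_sphere (0 : V) 1).eventually_forall_of_forall_eventually fun u hu => ?_
    have hu0 : u ≠ 0 := by
      have : ‖u‖ = 1 := by simpa using hu
      exact norm_ne_zero_iff.1 (by rw [this]; exact one_ne_zero)
    have hfst : ContinuousAt (fun w : (V × ℝ) × V => w.1.1) ((p, 0), u) :=
      continuous_fst.fst.continuousAt
    have hsnd : ContinuousAt (fun w : (V × ℝ) × V => w.2) ((p, 0), u) := continuousAt_snd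
    have c1 : ContinuousAt (fun w : (V × ℝ) × V => fderiv ℝ ρ w.1.1) ((p, 0), u) :=
      ContinuousAt.comp (f := fun w : (V × ℝ) × V => w.1.1) (x := ((p, 0), u)) h1 hfst
    have c2 : ContinuousAt (fun w : (V × ℝ) × V => fderiv ℝ (fderiv ℝ ρ) w.1.1) ((p, 0), u) :=
      ContinuousAt.comp (f := fun w : (V × ℝ) × V => w.1.1) (x := ((p, 0), u)) h2 hfst
    have c3 : ContinuousAt (fun w : (V × ℝ) × V => acc w.1.1 w.2 w.1.2) ((p, 0), u) :=
      (hacc.comp (f := fun w : (V × ℝ) × V => (w.1.1, w.2, w.1.2)) (by fun_prop)).continuousAt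
    by_cases hz : fderiv ℝ ρ p u = 0
    · have c4 := ((c2.clm_apply hsnd).clm_apply hsnd).add (c1.clm_apply c3)
      filter_upwards [c4.eventually_lt continuousAt_const (h.concave u hu0 hz)] with w hw _
      exact hw
    · filter_upwards [(c1.clm_apply hsnd).eventually_ne hz] with w hw h3
      exact absurd h3 hw
  obtain ⟨ε, hε, hball⟩ := Metric.eventually_nhds_iff.1 key
  obtain ⟨r, hr, hrD⟩ := Metric.eventually_nhds_iff.1 (h.mem_iff.and
    (h.contDiffAt.eventually (by simp)))
  refine ⟨min r ε, lt_min hr hε, ε / 2, half_pos hε, fun z hz => ?_⟩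
  have hzr := hrD (lt_of_lt_of_le hz (min_le_left _ _))
  refine ⟨hzr.2, hzr.1, fun u τ hu hτ hzu => ?_⟩
  have hu' : 0 < ‖u‖ := norm_pos_iff.2 hu
  have hd : dist (z, (‖u‖⁻¹) ^ 2 * τ) (p, (0 : ℝ)) < ε := by
    rw [Prod.dist_eq, max_lt_iff]
    refine ⟨lt_of_lt_of_le hz (min_le_right _ _), ?_⟩
    rw [Real.dist_eq, sub_zero, abs_mul, abs_of_nonneg (by positivity)]
    calc (‖u‖⁻¹) ^ 2 * |τ| ≤ (‖u‖⁻¹) ^ 2 * (ε / 2 * ‖u‖ ^ 2) := by gcongr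
      _ = ε / 2 := by field_simp
      _ < ε := half_lt_self hε
  have h3 := hball hd (‖u‖⁻¹ • u) (by simp [norm_smul, hu'.ne']) (by
    show fderiv ℝ ρ z (‖u‖⁻¹ • u) = 0
    rw [map_smul, hzu, smul_zero])
  rw [hom z u τ ‖u‖⁻¹] at h3
  simp only [map_smul, smul_apply, smul_eq_mul] at h3
  have h4 : ‖u‖⁻¹ ^ 2 * (fderiv ℝ (fderiv ℝ ρ) z u u + fderiv ℝ ρ z (acc z u τ)) < 0 := by
    linarith
  exact (pos_iff_neg_of_mul_neg h4).1 (by positivity)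

/-- `D` is strictly convex: near each of its points that is not interior it has a convex boundary
function. -/
def IsStrictlyConvexFor (acc : V → V → ℝ → V) (D : Set V) : Prop :=
  ∀ p ∈ D, D ∈ 𝓝 p ∨ ∃ ρ, IsConvexBoundaryFunction acc D p ρ

/-- A short trajectory, in a weak potential, with end points in a strictly convex set stays in the
set: a boundary function cannot have an interior negative minimum along it. -/
theorem IsStrictlyConvexFor.exists_uniform [FiniteDimensional ℝ V]
    (h : IsStrictlyConvexFor acc D) (hD : IsCompact D)
    (hacc : Continuous fun z : V × V × ℝ => acc z.1 z.2.1 z.2.2) (hom : IsHomogeneous acc) :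
    ∃ r > 0, ∃ η > 0, ∀ p ∈ D, ∀ (a b τ : ℝ) (c c' : ℝ → V),
      (∀ t ∈ Icc a b, HasDerivWithinAt c (c' t) (Icc a b) t) →
      (∀ t ∈ Icc a b, HasDerivWithinAt c' (acc (c t) (c' t) τ) (Icc a b) t) →
      (∀ t ∈ Icc a b, c t ∈ Metric.ball p r) →
      (∀ t ∈ Icc a b, c' t ≠ 0 ∧ |τ| ≤ η * ‖c' t‖ ^ 2) → c a ∈ D → c b ∈ D →
      ∀ t ∈ Icc a b, c t ∈ D := by
  let P : Set V → Prop := fun S => ∃ r > 0, ∃ η > 0, ∀ p ∈ S, ∀ (a b τ : ℝ) (c c' : ℝ → V),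
      (∀ t ∈ Icc a b, HasDerivWithinAt c (c' t) (Icc a b) t) →
      (∀ t ∈ Icc a b, HasDerivWithinAt c' (acc (c t) (c' t) τ) (Icc a b) t) →
      (∀ t ∈ Icc a b, c t ∈ Metric.ball p r) →
      (∀ t ∈ Icc a b, c' t ≠ 0 ∧ |τ| ≤ η * ‖c' t‖ ^ 2) → c a ∈ D → c b ∈ D →
      ∀ t ∈ Icc a b, c t ∈ D
  refine hD.induction_on (p := P) ⟨1, one_pos, 1, one_pos, fun p hp => absurd hp (by simp)⟩
    ?_ ?_ ?_
  · rintro S S' hSS' ⟨r, hr, η, hη, H⟩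
    exact ⟨r, hr, η, hη, fun p hp => H p (hSS' hp)⟩
  · rintro S S' ⟨r, hr, η, hη, H⟩ ⟨r', hr', η', hη', H'⟩
    refine ⟨min r r', lt_min hr hr', min η η', lt_min hη hη', ?_⟩
    rintro p (hp | hp) a b τ c c' h1 h2 h3 h4
    · refine H p hp a b τ c c' h1 h2
        (fun t ht => Metric.ball_subset_ball (min_le_left _ _) (h3 t ht))
        fun t ht => ⟨(h4 t ht).1, (h4 t ht).2.trans ?_⟩
      gcongr; exact min_le_left _ _
    · refine H' p hp a b τ c c' h1 h2
        (fun t ht => Metric.ball_subset_ball (min_le_right _ _) (h3 t ht))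
        fun t ht => ⟨(h4 t ht).1, (h4 t ht).2.trans ?_⟩
      gcongr; exact min_le_right _ _
  · intro p hp
    rcases h p hp with hn | ⟨ρ, hρ⟩
    · obtain ⟨r, hr, hrD⟩ := Metric.mem_nhds_iff.1 hn
      refine ⟨Metric.ball p (r / 2),
        mem_nhdsWithin_of_mem_nhds (Metric.ball_mem_nhds _ (by positivity)),
        r / 2, by positivity, 1, one_pos, ?_⟩
      intro p' hp' a b τ c c' _ _ h3 _ _ _ t ht
      refine hrD (Metric.ball_subset_ball' ?_ (h3 t ht))
      have := Metric.mem_ball.1 hp'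
      linarith
    · obtain ⟨r, hr, η, hη, H⟩ := hρ.exists_uniform hacc hom
      refine ⟨Metric.ball p (r / 2),
        mem_nhdsWithin_of_mem_nhds (Metric.ball_mem_nhds _ (by positivity)),
        r / 2, by positivity, η, hη, ?_⟩
      intro p' hp' a b τ c c' h1 h2 h3 h4 ha hb
      have hball : ∀ t ∈ Icc a b, c t ∈ Metric.ball p r := fun t ht => by
        refine Metric.ball_subset_ball' ?_ (h3 t ht)
        have := Metric.mem_ball.1 hp'
        linarith
      have hcont : ContinuousOn (ρ ∘ c) (Icc a b) := fun t ht =>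
        ((H _ (hball t ht)).1.continuousAt).comp_continuousWithinAt (h1 t ht).continuousWithinAt
      by_contra! hcon
      obtain ⟨t₁, ht₁, hneg₁⟩ := hcon
      obtain ⟨t, ht, hmin⟩ := isCompact_Icc.exists_isMinOn ⟨t₁, ht₁⟩ hcont
      have hneg : ρ (c t) < 0 := by
        refine lt_of_le_of_lt (hmin ht₁) ?_
        exact not_le.1 fun h5 => hneg₁ ((H _ (hball t₁ ht₁)).2.1.2 h5)
      have hta : t ≠ a := by
        rintro rfl
        exact absurd ((H _ (hball t ht)).2.1.1 ha) (not_le.2 hneg)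
      have htb : t ≠ b := by
        rintro rfl
        exact absurd ((H _ (hball t ht)).2.1.1 hb) (not_le.2 hneg)
      have htI : t ∈ Ioo a b := ⟨lt_of_le_of_ne ht.1 hta.symm, lt_of_le_of_ne ht.2 htb⟩
      refine not_isLocalMin_comp (w := acc (c t) (c' t) τ) (c' := c') (H _ (hball t ht)).1 ?_ ?_ ?_
        (hmin.isLocalMin (Icc_mem_nhds htI.1 htI.2))
      · filter_upwards [Ioo_mem_nhds htI.1 htI.2] with s hs
        exact (h1 s (Ioo_subset_Icc_self hs)).hasDerivAt (Icc_mem_nhds hs.1 hs.2)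
      · exact (h2 t ht).hasDerivAt (Icc_mem_nhds htI.1 htI.2)
      · exact (H _ (hball t ht)).2.2 _ _ (h4 t ht).1 (h4 t ht).2

/-- A nonconstant trajectory of strength zero in a strictly convex set touches the boundary at most
at its end points. -/
lemma IsStrictlyConvexFor.mem_nhds (h : IsStrictlyConvexFor acc D) {c c' : ℝ → V}
    (hc : IsTrajectory acc 0 1 c c') (hcD : ∀ t ∈ Icc (0 : ℝ) 1, c t ∈ D) {t : ℝ}
    (ht : t ∈ Ioo (0 : ℝ) 1) (ht0 : c' t ≠ 0) : D ∈ 𝓝 (c t) := by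
  rcases h _ (hcD t (Ioo_subset_Icc_self ht)) with hn | ⟨ρ, hρ⟩
  · exact hn
  exfalso
  have hI : Icc (0 : ℝ) 1 ∈ 𝓝 t := Icc_mem_nhds ht.1 ht.2
  have hd : HasDerivAt c (c' t) t := (hc.deriv t (Ioo_subset_Icc_self ht)).hasDerivAt hI
  refine not_isLocalMin_comp (w := acc (c t) (c' t) 0) (c' := c') hρ.contDiffAt ?_
    ((hc.deriv' t (Ioo_subset_Icc_self ht)).hasDerivAt hI) (hρ.concave _ ht0) ?_
  · filter_upwards [Ioo_mem_nhds ht.1 ht.2] with s hs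
    exact (hc.deriv s (Ioo_subset_Icc_self hs)).hasDerivAt (Icc_mem_nhds hs.1 hs.2)
  · filter_upwards [hI, hd.continuousAt.eventually hρ.mem_iff] with s hs hsρ
    simp only [Function.comp, hρ.eq_zero]
    exact hsρ.1 (hcD s hs)

end Convexity

/-! ### Trajectories near a given one -/

section Perturbation

variable {V : Type} [NormedAddCommGroup V] [NormedSpace ℝ V]
  {acc : V → V → ℝ → V} {m : V → V →L[ℝ] V →L[ℝ] ℝ} {q : V → ℝ} {D : Set V}

/-- The equation of motion as a first-order system for position, velocity and strength. -/
noncomputable def phaseField (acc : V → V → ℝ → V) (z : V × V × ℝ) : V × V × ℝ :=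
  (z.2.1, acc z.1 z.2.1 z.2.2, 0)

/-- The initial value in phase space of a trajectory from `x` with velocity `v`, whose strength is
`δ` times the square of the length of `v`. The argument is `(x, v, δ)`. -/
noncomputable def initialState (m : V → V →L[ℝ] V →L[ℝ] ℝ) (w : V × V × ℝ) : V × V × ℝ :=
  (w.1, w.2.1, w.2.2 * m w.1 w.2.1 w.2.1)

lemma contDiff_initialState {n : WithTop ℕ∞} (hm : ContDiff ℝ n m) :
    ContDiff ℝ n (initialState m) := by
  refine contDiff_fst.prodMk (contDiff_snd.fst.prodMk (contDiff_snd.snd.mul ?_))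
  exact ((hm.comp contDiff_fst).clm_apply contDiff_snd.fst).clm_apply contDiff_snd.fst

/-- A flow `φ` on phase space for the equation of motion: it solves the equation inside the open
set `U`, it is smooth, and for `|δ| ≤ δ₁` it describes all trajectories in `D` with initial velocity
bounded by `R`, which remain in the closed set `K ⊆ U`. The constant `C` bounds the separation of
flow lines. -/
structure IsFlowBox (acc : V → V → ℝ → V) (m : V → V →L[ℝ] V →L[ℝ] ℝ) (D : Set V) (n : ℕ)
    (R δ₁ : ℝ) (φ : V × V × ℝ → ℝ → V × V × ℝ) (U K : Set (V × V × ℝ)) (C : ℝ) : Prop where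
  isOpen : IsOpen U
  subset : K ⊆ U
  isClosed : IsClosed K
  fst_mem : ∀ z ∈ K, z.1 ∈ D
  apply_zero : ∀ a, φ a 0 = a
  contDiff : ∀ t ∈ Icc (0 : ℝ) 1, ContDiff ℝ n fun a => φ a t
  dist_le : ∀ a b, ∀ t ∈ Icc (0 : ℝ) 1, dist (φ a t) (φ b t) ≤ dist a b * C
  continuousOn : ∀ a, ContinuousOn (φ a) (Icc 0 1)
  trajectory : ∀ a, (∀ t ∈ Icc (0 : ℝ) 1, φ a t ∈ U) →
    IsTrajectory acc a.2.2 1 (fun t => (φ a t).1) (fun t => (φ a t).2.1)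
  mem : ∀ x v δ y, ‖v‖ ≤ R → |δ| ≤ δ₁ → Joins acc D x v (δ * m x v v) y →
    (∀ t ∈ Icc (0 : ℝ) 1, φ (initialState m (x, v, δ)) t ∈ K) ∧
      (φ (initialState m (x, v, δ)) 1).1 = y

lemma hasDerivWithinAt_phase {τ : ℝ} {c c' : ℝ → V} (h : IsTrajectory acc τ 1 c c') {t : ℝ}
    (ht : t ∈ Icc (0 : ℝ) 1) :
    HasDerivWithinAt (fun t => (c t, c' t, τ)) (phaseField acc (c t, c' t, τ)) (Icc 0 1) t :=
  (h.deriv t ht).prodMk ((h.deriv' t ht).prodMk (hasDerivWithinAt_const t _ τ))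

lemma isTrajectory_of_phase {z : ℝ → V × V × ℝ}
    (h : ∀ t ∈ Icc (0 : ℝ) 1, HasDerivWithinAt z (phaseField acc (z t)) (Icc 0 1) t) :
    IsTrajectory acc (z 0).2.2 1 (fun t => (z t).1) (fun t => (z t).2.1) := by
  have hfst : ∀ t ∈ Icc (0 : ℝ) 1, HasDerivWithinAt (fun t => (z t).1) (z t).2.1 (Icc 0 1) t :=
    fun t ht => (ContinuousLinearMap.fst ℝ V (V × ℝ)).hasFDerivAt.comp_hasDerivWithinAt t (h t ht)
  have hsnd : ∀ t ∈ Icc (0 : ℝ) 1, HasDerivWithinAt (fun t => (z t).2)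
      (acc (z t).1 (z t).2.1 (z t).2.2, 0) (Icc 0 1) t :=
    fun t ht => (ContinuousLinearMap.snd ℝ V (V × ℝ)).hasFDerivAt.comp_hasDerivWithinAt t (h t ht)
  have hthd : ∀ t ∈ Icc (0 : ℝ) 1, HasDerivWithinAt (fun t => (z t).2.2) 0 (Icc 0 1) t :=
    fun t ht => (ContinuousLinearMap.snd ℝ V ℝ).hasFDerivAt.comp_hasDerivWithinAt t (hsnd t ht)
  have hτ : ∀ t ∈ Icc (0 : ℝ) 1, (z t).2.2 = (z 0).2.2 :=
    constant_of_derivWithin_zero (fun t ht => (hthd t ht).differentiableWithinAt)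
      (fun t ht => (hthd t (Ico_subset_Icc_self ht)).derivWithin
        (uniqueDiffOn_Icc zero_lt_one t (Ico_subset_Icc_self ht)))
  refine ⟨hfst, fun t ht => ?_⟩
  have : HasDerivWithinAt (fun t => (z t).2.1) (acc (z t).1 (z t).2.1 (z t).2.2) (Icc 0 1) t :=
    (ContinuousLinearMap.fst ℝ V ℝ).hasFDerivAt.comp_hasDerivWithinAt t (hsnd t ht)
  rwa [hτ t ht] at this

lemma joins_const (h : IsMechanical acc m q) {x : V} (hx : x ∈ D) (δ : ℝ) :
    Joins acc D x 0 (δ * m x 0 0) x := by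
  refine ⟨fun _ => x, fun _ => 0, ⟨fun t _ => hasDerivWithinAt_const t _ x, fun t _ => ?_⟩,
    fun _ _ => hx, rfl, rfl, rfl⟩
  have : acc x 0 (δ * m x 0 0) = 0 := by simpa using h.acc_zero x
  rw [this]
  exact hasDerivWithinAt_const t _ (0 : V)

variable [FiniteDimensional ℝ V]

lemma IsMechanical.exists_isFlowBox (h : IsMechanical acc m q) (hD : IsCompact D) {n : ℕ}
    (hn : 1 ≤ n) (hacc : ContDiff ℝ n fun z : V × V × ℝ => acc z.1 z.2.1 z.2.2) (R : ℝ)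
    {δ₁ : ℝ} (hδ₁ : 0 < δ₁) : ∃ φ U K C, IsFlowBox acc m D n R δ₁ φ U K C := by
  obtain ⟨B, hB⟩ := h.exists_velocity_le hD δ₁
  obtain ⟨l, hl, L, hL, hb⟩ := h.exists_norm_bounds hD
  set K : Set (V × V × ℝ) :=
    D ×ˢ (Metric.closedBall (0 : V) (|B| * |R|) ×ˢ Metric.closedBall (0 : ℝ) (δ₁ * (L * R ^ 2)))
    with hKdef
  have hK : IsCompact K :=
    hD.prod ((isCompact_closedBall _ _).prod (isCompact_closedBall _ _))
  have hX : ContDiff ℝ n (phaseField acc) :=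
    contDiff_snd.fst.prodMk (hacc.prodMk contDiff_const)
  obtain ⟨φ, U, C, hU, hKU, h0, hsm, hdist, hcont, hφ, huniq⟩ := exists_flow hn hX hK
  refine ⟨φ, U, K, C, hU, hKU, hK.isClosed, fun z hz => hz.1, h0, hsm, hdist, hcont,
    fun a ha => ?_, ?_⟩
  · have := isTrajectory_of_phase (acc := acc) (z := φ a)
      (fun t ht => (hφ a t ht (ha t ht)).hasDerivWithinAt)
    rwa [h0] at this
  · rintro x v δ y hv hδ ⟨c, c', hc, hcD, rfl, rfl, rfl⟩
    -- The position lies in `D`, and the velocity is bounded by conservation of energy.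
    have hmem : ∀ t ∈ Icc (0 : ℝ) 1, (c t, c' t, δ * m (c 0) (c' 0) (c' 0)) ∈ K := by
      intro t ht
      refine ⟨hcD t ht, ?_, ?_⟩
      · rw [mem_closedBall_zero_iff]
        refine (hB δ hδ c c' hc hcD t ht).trans ?_
        have := hv.trans (le_abs_self R)
        calc B * ‖c' 0‖ ≤ |B| * ‖c' 0‖ := by gcongr; exact le_abs_self B
          _ ≤ _ := by gcongr
      · rw [mem_closedBall_zero_iff, Real.norm_eq_abs, abs_mul, abs_of_nonneg (h.nonneg _ _)]
        have h1 := (hb _ (hcD 0 ⟨le_rfl, zero_le_one⟩) (c' 0)).2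
        have h2 : ‖c' 0‖ ^ 2 ≤ R ^ 2 := pow_le_pow_left₀ (norm_nonneg _) hv 2
        have h3 : L * ‖c' 0‖ ^ 2 ≤ L * R ^ 2 := by gcongr
        exact mul_le_mul hδ (h1.trans h3) (h.nonneg _ _) hδ₁.le
    have hz := huniq _ (fun t ht => hasDerivWithinAt_phase hc ht) hmem
    refine ⟨fun t ht => ?_, ?_⟩
    · have := hz t ht
      simp only [initialState]
      rw [← this]
      exact hmem t ht
    · have := hz 1 ⟨zero_le_one, le_rfl⟩
      simp only [initialState]
      rw [← this]

/-- The data of a simple manifold in global coordinates: a compact strictly convex region `D` which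
for strength zero has a differentiable global inverse `L` of the exponential map at each `x`. -/
structure IsSimpleRegion (acc : V → V → ℝ → V) (m : V → V →L[ℝ] V →L[ℝ] ℝ) (q : V → ℝ)
    (D : Set V) : Prop where
  mech : IsMechanical acc m q
  isCompact : IsCompact D
  uniqueDiffOn : UniqueDiffOn ℝ D
  convex : IsStrictlyConvexFor acc D
  simple : ∀ x ∈ D, ∃ L : V → V, DifferentiableOn ℝ L D ∧
    ∀ y ∈ D, Joins acc D x (L y) 0 y ∧ ∀ v, Joins acc D x v 0 y → v = L y

namespace IsFlowBox

variable {n : ℕ} {R δ₁ : ℝ} {φ : V × V × ℝ → ℝ → V × V × ℝ} {U K : Set (V × V × ℝ)} {C : ℝ}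

omit [FiniteDimensional ℝ V] in
lemma joins (fb : IsFlowBox acc m D n R δ₁ φ U K C) {x v : V} {δ : ℝ}
    (hU : ∀ t ∈ Icc (0 : ℝ) 1, φ (initialState m (x, v, δ)) t ∈ U)
    (hD : ∀ t ∈ Icc (0 : ℝ) 1, (φ (initialState m (x, v, δ)) t).1 ∈ D) :
    Joins acc D x v (δ * m x v v) (φ (initialState m (x, v, δ)) 1).1 :=
  ⟨_, _, fb.trajectory _ hU, hD, by simp [fb.apply_zero, initialState],
    by simp [fb.apply_zero, initialState], rfl⟩

omit [FiniteDimensional ℝ V] in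
lemma joins_of_mem (fb : IsFlowBox acc m D n R δ₁ φ U K C) {x v : V} {δ : ℝ}
    (hK : ∀ t ∈ Icc (0 : ℝ) 1, φ (initialState m (x, v, δ)) t ∈ K) :
    Joins acc D x v (δ * m x v v) (φ (initialState m (x, v, δ)) 1).1 :=
  fb.joins (fun t ht => fb.subset (hK t ht)) fun t ht => fb.fst_mem _ (hK t ht)

/-- Trajectories near a given one of strength zero in `D`, with end points in `D`, stay in `D`. The
given one is cut into short pieces; the intermediate cutting points are interior points of `D`, so
that nearby trajectories still pass through `D` there. -/
theorem eventually_mem (fb : IsFlowBox acc m D n R δ₁ φ U K C) (h : IsSimpleRegion acc m q D)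
    (hδ₁ : 0 < δ₁) {x₀ v₀ y₀ : V} (hv₀ : ‖v₀‖ < R) (hj : Joins acc D x₀ v₀ 0 y₀) :
    ∀ᶠ w : V × V × ℝ in 𝓝 (x₀, v₀, 0), w.1 ∈ D → (φ (initialState m w) 1).1 ∈ D →
      ∀ t ∈ Icc (0 : ℝ) 1, φ (initialState m w) t ∈ U ∧ (φ (initialState m w) t).1 ∈ D := by
  obtain ⟨r, hr, η, hη, hconv⟩ := h.convex.exists_uniform h.isCompact
    h.mech.contDiff_acc.continuous h.mech.homogeneous
  have hD1 : IsCompact (Metric.cthickening 1 D) := h.isCompact.cthickening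
  obtain ⟨δ₂, hδ₂, hB⟩ := h.mech.exists_strength_le hD1 hη
  set a₀ := initialState m (x₀, v₀, 0) with ha₀
  have hj0 : Joins acc D x₀ v₀ (0 * m x₀ v₀ v₀) y₀ := by rwa [zero_mul]
  have hmem := fb.mem x₀ v₀ 0 y₀ hv₀.le (by simpa using hδ₁.le) hj0
  rw [← ha₀] at hmem
  have hc₀ := fb.trajectory a₀ fun t ht => fb.subset (hmem.1 t ht)
  have hc₀D : ∀ t ∈ Icc (0 : ℝ) 1, (φ a₀ t).1 ∈ D := fun t ht => fb.fst_mem _ (hmem.1 t ht)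
  have ha₀τ : a₀.2.2 = 0 := by simp [ha₀, initialState]
  have ha₀v : (φ a₀ 0).2.1 = v₀ := by rw [fb.apply_zero]; simp [ha₀, initialState]
  -- The subdivision of the given trajectory.
  obtain ⟨N, hN, hNr, hNint⟩ : ∃ N : ℕ, 0 < N ∧
      (∀ s ∈ Icc (0 : ℝ) 1, ∀ t ∈ Icc (0 : ℝ) 1, |s - t| ≤ 1 / N →
        dist (φ a₀ s).1 (φ a₀ t).1 < r / 2) ∧
      ∀ i : ℕ, 0 < i → i < N → D ∈ 𝓝 (φ a₀ (i / N)).1 := by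
    rcases eq_or_ne v₀ 0 with rfl | hv
    · refine ⟨1, one_pos, ?_, fun i h1 h2 => by omega⟩
      have hx₀ := hj.mem_left
      have hz : ∀ t ∈ Icc (0 : ℝ) 1, (φ a₀ t).1 = x₀ := by
        have hv : ∀ t ∈ Icc (0 : ℝ) 1, (φ a₀ t).2.1 = 0 := by
          intro t ht
          obtain ⟨B', hB'⟩ := h.mech.exists_velocity_le h.isCompact 0
          have := hB' 0 (by simp) _ _ (by
            rw [zero_mul, ← ha₀τ]; exact hc₀) hc₀D t ht
          simpa [ha₀v] using this
        intro t ht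
        have := constant_of_derivWithin_zero
          (fun s hs => (hc₀.deriv s hs).differentiableWithinAt)
          (fun s hs => by
            rw [(hc₀.deriv s (Ico_subset_Icc_self hs)).derivWithin
              (uniqueDiffOn_Icc zero_lt_one s (Ico_subset_Icc_self hs)),
              hv s (Ico_subset_Icc_self hs)]) t ht
        rw [this, fb.apply_zero]
        simp [ha₀, initialState]
      intro s hs t ht _
      rw [hz s hs, hz t ht, dist_self]
      exact half_pos hr
    · have hunif := isCompact_Icc.uniformContinuousOn_of_continuous
        (continuous_fst.comp_continuousOn (fb.continuousOn a₀))
      obtain ⟨ε, hε, hεr⟩ := Metric.uniformContinuousOn_iff.1 hunif (r / 2) (half_pos hr)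
      obtain ⟨N, hN⟩ := exists_nat_one_div_lt hε
      refine ⟨N + 1, Nat.succ_pos _, fun s hs t ht hst => hεr s hs t ht ?_, fun i h1 h2 => ?_⟩
      · rw [Real.dist_eq]
        refine lt_of_le_of_lt hst ?_
        exact_mod_cast hN
      · have hi : ((i : ℝ) / ((N + 1 : ℕ) : ℝ)) ∈ Ioo (0 : ℝ) 1 := by
          have : (0 : ℝ) < i := by exact_mod_cast h1
          refine ⟨by positivity, ?_⟩
          rw [div_lt_one (by positivity)]
          exact_mod_cast h2
        obtain ⟨δ₃, hδ₃, hB'⟩ := h.mech.exists_strength_le h.isCompact hη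
        have hne := (hB' 0 (by simpa using hδ₃.le) _ _ (by
          rw [zero_mul, ← ha₀τ]; exact hc₀) hc₀D (by rwa [ha₀v]) _ (Ioo_subset_Icc_self hi)).1
        rw [ha₀τ] at hc₀
        exact h.convex.mem_nhds hc₀ hc₀D hi hne
  have hNpos : (0 : ℝ) < N := by exact_mod_cast hN
  -- Proximity of nearby trajectories.
  have hinit : Continuous (initialState m) :=
    (contDiff_initialState h.mech.contDiff_metric).continuous
  have hcomp : IsCompact (φ a₀ '' Icc 0 1) :=
    isCompact_Icc.image_of_continuousOn (fb.continuousOn a₀)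
  obtain ⟨ε, hε, hεU⟩ := hcomp.exists_thickening_subset_open fb.isOpen (by
    rintro _ ⟨t, ht, rfl⟩; exact fb.subset (hmem.1 t ht))
  have hclose : ∀ᶠ w : V × V × ℝ in 𝓝 (x₀, v₀, 0),
      dist (initialState m w) a₀ * C < min ε (min (r / 2) 1) := by
    have : Continuous fun w => dist (initialState m w) a₀ * C :=
      (hinit.dist continuous_const).mul continuous_const
    refine this.continuousAt.eventually_lt continuousAt_const ?_
    rw [← ha₀, dist_self, zero_mul]
    positivity
  have hpts : ∀ᶠ w : V × V × ℝ in 𝓝 (x₀, v₀, 0), ∀ i ∈ Finset.range N, 0 < i →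
      (φ (initialState m w) (i / N)).1 ∈ D := by
    refine (Filter.eventually_all_finset _).2 fun i hi => ?_
    rw [Finset.mem_range] at hi
    by_cases hi0 : 0 < i
    · have hiI : ((i : ℝ) / N) ∈ Icc (0 : ℝ) 1 :=
        ⟨by positivity, by rw [div_le_one hNpos]; exact_mod_cast hi.le⟩
      have : Continuous fun w => (φ (initialState m w) (i / N)).1 :=
        continuous_fst.comp ((fb.contDiff _ hiI).continuous.comp hinit)
      filter_upwards [this.continuousAt.eventually (hNint i hi0 hi)] with w hw _
      exact hw
    · exact Eventually.of_forall fun w hw => absurd hw hi0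
  have hδ : ∀ᶠ w : V × V × ℝ in 𝓝 (x₀, v₀, 0), |w.2.2| < δ₂ :=
    (continuous_snd.snd.abs.continuousAt).eventually_lt continuousAt_const (by simpa using hδ₂)
  filter_upwards [hclose, hpts, hδ] with w hw hwp hwδ hwx hwy
  have hdist : ∀ t ∈ Icc (0 : ℝ) 1, dist (φ (initialState m w) t) (φ a₀ t)
      < min ε (min (r / 2) 1) := fun t ht => (fb.dist_le _ _ t ht).trans_lt hw
  have hwU : ∀ t ∈ Icc (0 : ℝ) 1, φ (initialState m w) t ∈ U := fun t ht => by
    refine hεU (Metric.mem_thickening_iff.2 ⟨_, ⟨t, ht, rfl⟩, ?_⟩)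
    exact (hdist t ht).trans_le (min_le_left _ _)
  refine fun t ht => ⟨hwU t ht, ?_⟩
  have hfst : ∀ t ∈ Icc (0 : ℝ) 1, dist (φ (initialState m w) t).1 (φ a₀ t).1 < min (r / 2) 1 :=
    fun t ht => ((le_max_left _ _).trans_lt (hdist t ht)).trans_le (min_le_right _ _)
  have hw0 : φ (initialState m w) 0 = initialState m w := fb.apply_zero _
  -- A trajectory that starts at rest is constant.
  by_cases hv : w.2.1 = 0
  · have hj1 : Joins acc D w.1 w.2.1 (0 * m w.1 w.2.1 w.2.1) w.1 := by
      rw [hv]; exact joins_const h.mech hwx 0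
    have h1 := (fb.mem _ _ _ _ (by rw [hv, norm_zero]; exact (norm_nonneg _).trans hv₀.le)
      (by simpa using hδ₁.le) hj1).1 t ht
    have h2 : initialState m (w.1, w.2.1, 0) = initialState m w := by
      simp [initialState, hv]
    rw [h2] at h1
    exact fb.fst_mem _ h1
  have hcw := fb.trajectory _ hwU
  have hcw' : IsTrajectory acc (w.2.2 * m ((φ (initialState m w) 0).1)
      ((φ (initialState m w) 0).2.1) ((φ (initialState m w) 0).2.1)) 1
      (fun t => (φ (initialState m w) t).1) (fun t => (φ (initialState m w) t).2.1) := by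
    rw [hw0]; exact hcw
  have hvel := hB w.2.2 hwδ.le (fun t => (φ (initialState m w) t).1)
    (fun t => (φ (initialState m w) t).2.1) hcw' (fun s hs =>
      Metric.mem_cthickening_of_dist_le _ _ _ _ (hc₀D s hs)
        ((hfst s hs).le.trans (min_le_right _ _))) (by rw [hw0]; exact hv)
  have hwpt : ∀ i ≤ N, (φ (initialState m w) (i / N)).1 ∈ D := by
    intro i hi
    rcases Nat.eq_zero_or_pos i with rfl | hi0
    · rw [Nat.cast_zero, zero_div, hw0]; exact hwx
    rcases hi.lt_or_eq with hiN | rfl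
    · exact hwp i (Finset.mem_range.2 hiN) hi0
    · rw [div_self hNpos.ne']; exact hwy
  obtain ⟨i, hiN, hit, hit'⟩ : ∃ i : ℕ, i < N ∧ (i : ℝ) / N ≤ t ∧ t ≤ ((i + 1 : ℕ) : ℝ) / N := by
    rcases ht.2.lt_or_eq with ht1 | rfl
    · have h1 : 0 ≤ t * N := mul_nonneg ht.1 hNpos.le
      refine ⟨⌊t * N⌋₊, ?_, ?_, ?_⟩
      · rw [Nat.floor_lt h1]
        nlinarith
      · rw [div_le_iff₀ hNpos]
        exact Nat.floor_le h1
      · rw [le_div_iff₀ hNpos]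
        push_cast
        exact (Nat.lt_floor_add_one _).le
    · refine ⟨N - 1, by omega, ?_, ?_⟩
      · rw [div_le_one hNpos]; exact_mod_cast Nat.sub_le N 1
      · rw [Nat.sub_add_cancel hN, div_self hNpos.ne']
  have hsub : Icc ((i : ℝ) / N) (((i + 1 : ℕ) : ℝ) / N) ⊆ Icc (0 : ℝ) 1 := by
    refine Icc_subset_Icc (by positivity) ?_
    rw [div_le_one hNpos]
    exact_mod_cast hiN
  have hiI : ((i : ℝ) / N) ∈ Icc (0 : ℝ) 1 := hsub ⟨le_rfl, hit.trans hit'⟩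
  refine hconv _ (hc₀D _ hiI) _ _ _ _ _ (fun s hs => (hcw.deriv s (hsub hs)).mono hsub)
    (fun s hs => (hcw.deriv' s (hsub hs)).mono hsub) (fun s hs => ?_) (fun s hs => ?_)
    (hwpt i hiN.le) (hwpt (i + 1) hiN) t ⟨hit, hit'⟩
  · have h1 := (hfst s (hsub hs)).trans_le (min_le_left _ _)
    have h2 := hNr s (hsub hs) _ hiI (by
      rw [abs_of_nonneg (sub_nonneg.2 hs.1)]
      have := hs.2
      push_cast at this
      rw [add_div] at this
      linarith)
    rw [Metric.mem_ball]
    linarith [dist_triangle (φ (initialState m w) s).1 (φ a₀ s).1 (φ a₀ (i / N)).1]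
  · have h1 := hvel s (hsub hs)
    rw [hw0] at h1
    exact h1

end IsFlowBox

end Perturbation

/-! ### Existence and uniqueness for weak potentials -/

section Uniform

variable {V : Type} [NormedAddCommGroup V] [NormedSpace ℝ V] [FiniteDimensional ℝ V]
  {acc : V → V → ℝ → V} {m : V → V →L[ℝ] V →L[ℝ] ℝ} {q : V → ℝ} {D : Set V}

namespace IsFlowBox

variable {n : ℕ} {R δ₁ : ℝ} {φ : V × V × ℝ → ℝ → V × V × ℝ} {U K : Set (V × V × ℝ)} {C : ℝ}

omit [FiniteDimensional ℝ V] in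
lemma contDiff_exp (fb : IsFlowBox acc m D n R δ₁ φ U K C) (hm : ContDiff ℝ n m) :
    ContDiff ℝ n fun w => (φ (initialState m w) 1).1 :=
  contDiff_fst.comp ((fb.contDiff 1 ⟨zero_le_one, le_rfl⟩).comp (contDiff_initialState hm))

omit [FiniteDimensional ℝ V] in
lemma isClosed_setOf_mem (fb : IsFlowBox acc m D n R δ₁ φ U K C) (hm : Continuous m) :
    IsClosed {w | ∀ t ∈ Icc (0 : ℝ) 1, φ (initialState m w) t ∈ K} := by
  have h0 : ContDiff ℝ 0 m := contDiff_zero.2 hm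
  have : {w | ∀ t ∈ Icc (0 : ℝ) 1, φ (initialState m w) t ∈ K}
      = ⋂ t ∈ Icc (0 : ℝ) 1, (fun w => φ (initialState m w) t) ⁻¹' K := by
    ext w; simp
  rw [this]
  exact isClosed_biInter fun t ht =>
    fb.isClosed.preimage ((fb.contDiff t ht).continuous.comp (contDiff_initialState h0).continuous)

/-- The differential of the exponential map is injective where there is a differentiable right
inverse `L`. -/
lemma fderiv_exp_injective (fb : IsFlowBox acc m D n R δ₁ φ U K C)
    (hn : 1 ≤ n) (hm : ContDiff ℝ n m) (hD : UniqueDiffOn ℝ D) {x : V} {δ : ℝ} (hδ : |δ| ≤ δ₁)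
    {L : V → V} {y : V} (hy : y ∈ D) (hL : DifferentiableWithinAt ℝ L D y) (hR : ‖L y‖ < R)
    (hj : ∀ z ∈ D, Joins acc D x (L z) (δ * m x (L z) (L z)) z) {u : V}
    (hu : fderiv ℝ (fun w => (φ (initialState m w) 1).1) (x, L y, δ) (0, u, 0) = 0) : u = 0 := by
  have hn0 : (n : WithTop ℕ∞) ≠ 0 := by
    have : n ≠ 0 := by omega
    exact_mod_cast this
  set G : V × V × ℝ → V := fun w => (φ (initialState m w) 1).1 with hG
  have hGd : HasFDerivAt G (fderiv ℝ G (x, L y, δ)) (x, L y, δ) :=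
    ((fb.contDiff_exp hm).differentiable hn0 _).hasFDerivAt
  have hι : HasFDerivWithinAt (fun z => (x, L z, δ))
      ((0 : V →L[ℝ] V).prod ((fderivWithin ℝ L D y).prod (0 : V →L[ℝ] ℝ))) D y :=
    (hasFDerivWithinAt_const x y D).prodMk
      (hL.hasFDerivWithinAt.prodMk (hasFDerivWithinAt_const δ y D))
  have hcomp := hGd.comp_hasFDerivWithinAt y hι
  have hid : HasFDerivWithinAt (G ∘ fun z => (x, L z, δ)) (ContinuousLinearMap.id ℝ V) D y := by
    refine HasFDerivWithinAt.congr_of_eventuallyEq (hasFDerivWithinAt_id y D) ?_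
      (fb.mem x (L y) δ y hR.le hδ (hj y hy)).2
    have hev : ∀ᶠ z in 𝓝[D] y, ‖L z‖ < R :=
      (hL.continuousWithinAt.norm).eventually_lt continuousWithinAt_const hR
    filter_upwards [hev, self_mem_nhdsWithin] with z hz hzD
    exact (fb.mem x (L z) δ z hz.le hδ (hj z hzD)).2
  have heq := (hD y hy).eq hcomp hid
  -- Injectivity follows from surjectivity, in finite dimension.
  let A : V →ₗ[ℝ] V :=
    { toFun := fun v => fderiv ℝ G (x, L y, δ) (0, v, 0)
      map_add' := fun a b => by rw [← map_add]; simp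
      map_smul' := fun a b => by rw [RingHom.id_apply, ← map_smul]; simp }
  have hA : Function.Surjective A := fun v => ⟨fderivWithin ℝ L D y v, by
    have := DFunLike.congr_fun heq v
    show fderiv ℝ G (x, L y, δ) (0, fderivWithin ℝ L D y v, 0) = v
    simpa using this⟩
  exact (injective_iff_map_eq_zero A).1 (LinearMap.injective_iff_surjective.2 hA) u hu

/-- A differentiable global inverse of the exponential map is as smooth as the equation of
motion. -/
theorem contDiffWithinAt_inverse (fb : IsFlowBox acc m D n R δ₁ φ U K C)
    (hn : 1 ≤ n) (hm : ContDiff ℝ n m) (hD : UniqueDiffOn ℝ D) {x : V} {δ : ℝ} (hδ : |δ| ≤ δ₁)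
    {L : V → V} {y : V} (hy : y ∈ D) (hL : DifferentiableWithinAt ℝ L D y) (hR : ‖L y‖ < R)
    (hj : ∀ z ∈ D, Joins acc D x (L z) (δ * m x (L z) (L z)) z) :
    ContDiffWithinAt ℝ n L D y := by
  have hn0 : (n : WithTop ℕ∞) ≠ 0 := by
    have : n ≠ 0 := by omega
    exact_mod_cast this
  set G : V × V × ℝ → V := fun w => (φ (initialState m w) 1).1 with hG
  have hι : ContDiff ℝ n fun v : V => (x, v, δ) :=
    contDiff_const.prodMk (contDiff_id.prodMk contDiff_const)
  have hF : ContDiff ℝ n fun v => G (x, v, δ) := (fb.contDiff_exp hm).comp hι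
  have hFy : ∀ z ∈ D, ‖L z‖ ≤ R → G (x, L z, δ) = z := fun z hz hzR =>
    (fb.mem x (L z) δ z hzR hδ (hj z hz)).2
  have hιd : HasFDerivAt (fun v : V => (x, v, δ))
      ((0 : V →L[ℝ] V).prod ((ContinuousLinearMap.id ℝ V).prod (0 : V →L[ℝ] ℝ))) (L y) :=
    (hasFDerivAt_const x (L y)).prodMk ((hasFDerivAt_id (L y)).prodMk (hasFDerivAt_const δ (L y)))
  have hFd : HasFDerivAt (fun v => G (x, v, δ)) _ (L y) :=
    (((fb.contDiff_exp hm).differentiable hn0 _).hasFDerivAt).comp (L y) hιd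
  obtain ⟨S, hS, -, -, hSF⟩ := exists_contDiffAt_localInverse hn0 hF.contDiffAt hFd (by
    rw [injective_iff_map_eq_zero]
    intro u hu
    exact fb.fderiv_exp_injective hn hm hD hδ hy hL hR hj (by simpa using hu))
  simp only [hFy y hy hR.le] at hS
  refine hS.contDiffWithinAt.congr_of_eventuallyEq_of_mem ?_ hy
  have hev : ∀ᶠ z in 𝓝[D] y, ‖L z‖ < R :=
    (hL.continuousWithinAt.norm).eventually_lt continuousWithinAt_const hR
  filter_upwards [hev, self_mem_nhdsWithin, hL.continuousWithinAt.eventually hSF] with z hz hzD hzS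
  rw [hFy z hzD hz.le] at hzS
  exact hzS.symm

end IsFlowBox

namespace IsSimpleRegion

/-- Near a trajectory of strength zero in `D` the problem of joining `x` to `y` is uniquely solvable
in `D`, with a continuously differentiable solution operator, by the inverse function theorem. -/
theorem exists_local_solution (h : IsSimpleRegion acc m q D) {x₀ v₀ y₀ : V}
    (hj : Joins acc D x₀ v₀ 0 y₀) :
    ∃ S : V × V × ℝ → V, ContDiffAt ℝ 1 S (x₀, y₀, 0) ∧ S (x₀, y₀, 0) = v₀ ∧
      (∀ᶠ w : V × V × ℝ in 𝓝 (x₀, y₀, 0), w.1 ∈ D → w.2.1 ∈ D →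
        Joins acc D w.1 (S w) (w.2.2 * m w.1 (S w) (S w)) w.2.1) ∧
      ∀ᶠ w : V × V × ℝ in 𝓝 (x₀, v₀, 0), ∀ y,
        Joins acc D w.1 w.2.1 (w.2.2 * m w.1 w.2.1 w.2.1) y → S (w.1, y, w.2.2) = w.2.1 := by
  have hx₀ := hj.mem_left
  have hy₀ := hj.mem_right
  obtain ⟨φ, U, K, C, fb⟩ := h.mech.exists_isFlowBox h.isCompact (n := 1) le_rfl
    (by exact_mod_cast h.mech.contDiff_acc) (‖v₀‖ + 1) one_pos
  have hm : ContDiff ℝ (1 : ℕ) m := by exact_mod_cast h.mech.contDiff_metric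
  obtain ⟨L, hL, hLj⟩ := h.simple x₀ hx₀
  have hLy : v₀ = L y₀ := (hLj y₀ hy₀).2 v₀ hj
  set G : V × V × ℝ → V := fun w => (φ (initialState m w) 1).1 with hG
  have hGc : ContDiff ℝ (1 : ℕ) G := fb.contDiff_exp hm
  have hGd : HasFDerivAt G (fderiv ℝ G (x₀, v₀, 0)) (x₀, v₀, 0) :=
    (hGc.differentiable (by simp) _).hasFDerivAt
  have hGy : G (x₀, v₀, 0) = y₀ :=
    (fb.mem x₀ v₀ 0 y₀ (by linarith) (by simp) (by rwa [zero_mul])).2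
  let Ψ : V × V × ℝ → V × V × ℝ := fun w => (w.1, G w, w.2.2)
  have hΨ : ContDiff ℝ (1 : ℕ) Ψ := contDiff_fst.prodMk (hGc.prodMk contDiff_snd.snd)
  have hΨd : HasFDerivAt Ψ ((ContinuousLinearMap.fst ℝ V (V × ℝ)).prod
      ((fderiv ℝ G (x₀, v₀, 0)).prod
        ((ContinuousLinearMap.snd ℝ V ℝ).comp (ContinuousLinearMap.snd ℝ V (V × ℝ)))))
      (x₀, v₀, 0) :=
    hasFDerivAt_fst.prodMk (hGd.prodMk
      ((ContinuousLinearMap.snd ℝ V ℝ).comp (ContinuousLinearMap.snd ℝ V (V × ℝ))).hasFDerivAt)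
  obtain ⟨T, hT, hTa, hΨT, hTΨ⟩ := exists_contDiffAt_localInverse (by simp) hΨ.contDiffAt hΨd (by
    rw [injective_iff_map_eq_zero]
    rintro ⟨a, u, e⟩ hu
    simp only [ContinuousLinearMap.prod_apply, ContinuousLinearMap.coe_fst',
      ContinuousLinearMap.comp_apply, ContinuousLinearMap.coe_snd', Prod.mk_eq_zero] at hu
    obtain ⟨rfl, hu, rfl⟩ := hu
    have : u = 0 := by
      refine fb.fderiv_exp_injective le_rfl hm h.uniqueDiffOn (x := x₀) (δ := 0) (L := L)
        (by simp) hy₀ (hL y₀ hy₀) (by rw [← hLy]; linarith) (fun z hz => ?_)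
        (by rw [← hLy]; exact hu)
      rw [zero_mul]
      exact (hLj z hz).1
    simp [this])
  have hΨ0 : Ψ (x₀, v₀, 0) = (x₀, y₀, 0) := by simp [Ψ, hGy]
  rw [hΨ0] at hT hTa hΨT
  refine ⟨fun w => (T w).2.1, ?_, by simp [hTa], ?_, ?_⟩
  · have : ContDiffAt ℝ (1 : ℕ) (fun w => (T w).2.1) (x₀, y₀, 0) := hT.snd.fst
    exact_mod_cast this
  · have hTc : Tendsto T (𝓝 (x₀, y₀, 0)) (𝓝 (x₀, v₀, 0)) := by
      have := hT.continuousAt.tendsto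
      rwa [hTa] at this
    filter_upwards [hΨT, hTc.eventually (fb.eventually_mem h one_pos (by linarith) hj)]
      with w hw hstay hx hy
    have h1 : (Ψ (T w)).1 = w.1 := by rw [hw]
    have h2 : (Ψ (T w)).2.1 = w.2.1 := by rw [hw]
    have h3 : (Ψ (T w)).2.2 = w.2.2 := by rw [hw]
    change (T w).1 = w.1 at h1
    change G (T w) = w.2.1 at h2
    change (T w).2.2 = w.2.2 at h3
    have hst := hstay (by rwa [h1]) (by show G (T w) ∈ D; rwa [h2])
    have h4 : T w = (w.1, (T w).2.1, w.2.2) := by rw [← h1, ← h3]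
    rw [h4] at hst
    have h5 := fb.joins (fun t ht => (hst t ht).1) fun t ht => (hst t ht).2
    rw [← h4] at h5
    have h6 : (φ (initialState m (T w)) 1).1 = w.2.1 := h2
    rwa [h6] at h5
  · have e1 : ∀ᶠ w : V × V × ℝ in 𝓝 (x₀, v₀, 0), ‖w.2.1‖ < ‖v₀‖ + 1 :=
      (continuous_snd.fst.norm.continuousAt).eventually_lt continuousAt_const (by simp)
    have e2 : ∀ᶠ w : V × V × ℝ in 𝓝 (x₀, v₀, 0), |w.2.2| < 1 :=
      (continuous_snd.snd.abs.continuousAt).eventually_lt continuousAt_const (by simp)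
    filter_upwards [hTΨ, e1, e2] with w hw h1 h2 y hy
    have h3 : G w = y := (fb.mem w.1 w.2.1 w.2.2 y h1.le h2.le hy).2
    have h4 : Ψ w = (w.1, y, w.2.2) := by simp only [Ψ, h3]
    rw [h4] at hw
    rw [hw]

omit [FiniteDimensional ℝ V] in
lemma joins_zero (h : IsSimpleRegion acc m q D) {x y : V} (hx : x ∈ D) (hy : y ∈ D) :
    ∃ v, Joins acc D x v 0 y := by
  obtain ⟨L, -, hL⟩ := h.simple x hx
  exact ⟨L y, (hL y hy).1⟩

omit [FiniteDimensional ℝ V] in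
lemma joins_zero_unique (h : IsSimpleRegion acc m q D) {x y v v' : V}
    (hv : Joins acc D x v 0 y) (hv' : Joins acc D x v' 0 y) : v = v' := by
  obtain ⟨L, -, hL⟩ := h.simple x hv.mem_left
  rw [(hL y hv.mem_right).2 v hv, (hL y hv.mem_right).2 v' hv']

/-- The trajectories of strength zero in `D` have bounded initial velocity. -/
lemma exists_bound_zero (h : IsSimpleRegion acc m q D) :
    ∃ R ≥ 0, ∀ x v y, Joins acc D x v 0 y → ‖v‖ ≤ R := by
  have key : ∃ R ≥ 0, ∀ z ∈ D ×ˢ D, ∀ v, Joins acc D z.1 v 0 z.2 → ‖v‖ ≤ R := by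
    refine (h.isCompact.prod h.isCompact).induction_on
      (p := fun S => ∃ R ≥ 0, ∀ z ∈ S, ∀ v, Joins acc D z.1 v 0 z.2 → ‖v‖ ≤ R)
      ⟨0, le_rfl, fun z hz => absurd hz (by simp)⟩ ?_ ?_ ?_
    · rintro S S' hSS' ⟨R, hR, H⟩
      exact ⟨R, hR, fun z hz => H z (hSS' hz)⟩
    · rintro S S' ⟨R, hR, H⟩ ⟨R', hR', H'⟩
      refine ⟨max R R', hR.trans (le_max_left _ _), ?_⟩
      rintro z (hz | hz) v hv
      · exact (H z hz v hv).trans (le_max_left _ _)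
      · exact (H' z hz v hv).trans (le_max_right _ _)
    · rintro ⟨x₀, y₀⟩ ⟨hx₀, hy₀⟩
      obtain ⟨v₀, hv₀⟩ := h.joins_zero hx₀ hy₀
      obtain ⟨S, hS, hS0, hSj, -⟩ := h.exists_local_solution hv₀
      have hι : Continuous fun z : V × V => (z.1, z.2, (0 : ℝ)) := by fun_prop
      have hιt : Tendsto (fun z : V × V => (z.1, z.2, (0 : ℝ))) (𝓝 (x₀, y₀)) (𝓝 (x₀, y₀, 0)) :=
        hι.tendsto (x₀, y₀)
      have hlt : ∀ᶠ w in 𝓝 (x₀, y₀, (0 : ℝ)), ‖S w‖ < ‖v₀‖ + 1 :=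
        hS.continuousAt.norm.eventually_lt continuousAt_const (by rw [hS0]; linarith)
      refine ⟨{z | z ∈ D ×ˢ D ∧ ‖S (z.1, z.2, 0)‖ < ‖v₀‖ + 1 ∧
        Joins acc D z.1 (S (z.1, z.2, 0)) 0 z.2}, ?_, ‖v₀‖ + 1, by positivity, ?_⟩
      · filter_upwards [self_mem_nhdsWithin, mem_nhdsWithin_of_mem_nhds (hιt.eventually hlt),
          mem_nhdsWithin_of_mem_nhds (hιt.eventually hSj)] with z hz h1 h2
        refine ⟨hz, h1, ?_⟩
        have := h2 hz.1 hz.2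
        rwa [zero_mul] at this
      · rintro z ⟨-, h1, h2⟩ v hv
        rw [h.joins_zero_unique hv h2]
        exact h1.le
  obtain ⟨R, hR, H⟩ := key
  exact ⟨R, hR, fun x v y hv => H (x, y) ⟨hv.mem_left, hv.mem_right⟩ v hv⟩

/-- The trajectories in `D` have bounded initial velocity, uniformly for weak potentials: a faster
one has an initial piece, run through on `[0, 1]`, whose speed lies strictly above the bound for
strength zero, and such pieces are excluded near strength zero by compactness. -/
lemma exists_bound (h : IsSimpleRegion acc m q D) :
    ∃ R, ∀ᶠ δ : ℝ in 𝓝 0, ∀ x v y, Joins acc D x v (δ * m x v v) y → ‖v‖ ≤ R := by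
  obtain ⟨R, hR, H⟩ := h.exists_bound_zero
  obtain ⟨φ, U, K, C, fb⟩ := h.mech.exists_isFlowBox h.isCompact (n := 1) le_rfl
    (by exact_mod_cast h.mech.contDiff_acc) (R + 1) one_pos
  have hcl := fb.isClosed_setOf_mem h.mech.contDiff_metric.continuous
  have key : ∀ᶠ δ : ℝ in 𝓝 0, ∀ z ∈ D ×ˢ Metric.sphere (0 : V) (R + 1),
      ¬ ∀ t ∈ Icc (0 : ℝ) 1, φ (initialState m (z.1, z.2, δ)) t ∈ K := by
    refine (h.isCompact.prod (isCompact_sphere _ _)).eventually_forall_of_forall_eventually ?_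
    rintro ⟨x, v⟩ ⟨hx, hv⟩
    have hι : Continuous fun w : ℝ × V × V => (w.2.1, w.2.2, w.1) := by fun_prop
    refine hι.continuousAt.eventually (hcl.isOpen_compl.mem_nhds fun hmem => ?_)
    have h1 := fb.joins_of_mem hmem
    simp only [zero_mul] at h1
    have h2 := H _ _ _ h1
    have h3 : ‖v‖ = R + 1 := by simpa using hv
    linarith
  have hδ : ∀ᶠ δ : ℝ in 𝓝 0, |δ| < 1 :=
    (continuous_abs.continuousAt).eventually_lt continuousAt_const (by simp)
  refine ⟨R + 1, ?_⟩
  filter_upwards [key, hδ] with δ h1 h2 x v y hj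
  by_contra! hlt
  have hv : 0 < ‖v‖ := by linarith
  have hr : 0 ≤ (R + 1) / ‖v‖ := by positivity
  obtain ⟨z, hz⟩ := hj.rescale h.mech.homogeneous hr ((div_le_one hv).2 hlt.le)
  have hnorm : ‖((R + 1) / ‖v‖) • v‖ = R + 1 := by
    rw [norm_smul, Real.norm_of_nonneg hr, div_mul_cancel₀ _ hv.ne']
  refine h1 (x, ((R + 1) / ‖v‖) • v) ⟨hj.mem_left, by simpa using hnorm⟩ ?_
  refine (fb.mem x _ δ z hnorm.le h2.le ?_).1
  convert hz using 1
  simp only [map_smul, smul_apply, smul_eq_mul]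
  ring

/-- For weak potentials there is at most one trajectory in `D` joining two given points. -/
lemma eventually_unique (h : IsSimpleRegion acc m q D) :
    ∀ᶠ δ : ℝ in 𝓝 0, ∀ x v v' y, Joins acc D x v (δ * m x v v) y →
      Joins acc D x v' (δ * m x v' v') y → v = v' := by
  obtain ⟨R, hR⟩ := h.exists_bound
  obtain ⟨φ, U, K, C, fb⟩ := h.mech.exists_isFlowBox h.isCompact (n := 1) le_rfl
    (by exact_mod_cast h.mech.contDiff_acc) R one_pos
  have hm : ContDiff ℝ (1 : ℕ) m := by exact_mod_cast h.mech.contDiff_metric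
  have hcl := fb.isClosed_setOf_mem h.mech.contDiff_metric.continuous
  have hGc : Continuous fun w => (φ (initialState m w) 1).1 := (fb.contDiff_exp hm).continuous
  have hι₁ : Continuous fun w : ℝ × V × V × V => (w.2.1, w.2.2.1, w.1) := by fun_prop
  have hι₂ : Continuous fun w : ℝ × V × V × V => (w.2.1, w.2.2.2, w.1) := by fun_prop
  have key : ∀ᶠ δ : ℝ in 𝓝 0,
      ∀ z ∈ D ×ˢ (Metric.closedBall (0 : V) R ×ˢ Metric.closedBall (0 : V) R),
      (∀ t ∈ Icc (0 : ℝ) 1, φ (initialState m (z.1, z.2.1, δ)) t ∈ K) →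
      (∀ t ∈ Icc (0 : ℝ) 1, φ (initialState m (z.1, z.2.2, δ)) t ∈ K) →
      (φ (initialState m (z.1, z.2.1, δ)) 1).1 = (φ (initialState m (z.1, z.2.2, δ)) 1).1 →
      z.2.1 = z.2.2 := by
    refine (h.isCompact.prod ((isCompact_closedBall _ _).prod
      (isCompact_closedBall _ _))).eventually_forall_of_forall_eventually ?_
    rintro ⟨x, v, v'⟩ -
    let A : Set (ℝ × V × V × V) :=
      {w | (∀ t ∈ Icc (0 : ℝ) 1, φ (initialState m (w.2.1, w.2.2.1, w.1)) t ∈ K) ∧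
        (∀ t ∈ Icc (0 : ℝ) 1, φ (initialState m (w.2.1, w.2.2.2, w.1)) t ∈ K) ∧
        (φ (initialState m (w.2.1, w.2.2.1, w.1)) 1).1
          = (φ (initialState m (w.2.1, w.2.2.2, w.1)) 1).1}
    have hA : IsClosed A := (hcl.preimage hι₁).inter ((hcl.preimage hι₂).inter
      (isClosed_eq (hGc.comp hι₁) (hGc.comp hι₂)))
    -- In the limit `δ = 0` two solutions coincide, and nearby ones are given by the local solution
    -- operator; if they are not both solutions in the limit, they are not for nearby data either.
    by_cases hw : ((0 : ℝ), x, v, v') ∈ A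
    · obtain ⟨w1, w2, w3⟩ := hw
      have j1 := fb.joins_of_mem w1
      have j2 := fb.joins_of_mem w2
      simp only [zero_mul] at j1 j2 w3
      rw [← w3] at j2
      obtain rfl : v = v' := h.joins_zero_unique j1 j2
      obtain ⟨S, -, -, -, hS⟩ := h.exists_local_solution j1
      filter_upwards [(hι₁.tendsto ((0 : ℝ), x, v, v)).eventually hS,
        (hι₂.tendsto ((0 : ℝ), x, v, v)).eventually hS] with w e1 e2 k1 k2 k3
      have l1 := e1 _ (fb.joins_of_mem k1)
      have l2 := e2 _ (fb.joins_of_mem k2)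
      rw [← l1, ← l2, k3]
    · filter_upwards [hA.isOpen_compl.mem_nhds hw] with w hw' k1 k2 k3
      exact absurd ⟨k1, k2, k3⟩ hw'
  have hδ : ∀ᶠ δ : ℝ in 𝓝 0, |δ| < 1 :=
    (continuous_abs.continuousAt).eventually_lt continuousAt_const (by simp)
  filter_upwards [key, hR, hδ] with δ h1 h2 h3 x v v' y hv hv'
  have b := h2 _ _ _ hv
  have b' := h2 _ _ _ hv'
  have k := fb.mem _ _ _ _ b h3.le hv
  have k' := fb.mem _ _ _ _ b' h3.le hv'
  exact h1 (x, v, v') ⟨hv.mem_left, by simpa using b, by simpa using b'⟩ k.1 k'.1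
    (k.2.trans k'.2.symm)

/-- For weak potentials any two points of `D` are joined by a trajectory in `D`, whose initial
velocity can be chosen differentiably in the end point. -/
lemma eventually_exists (h : IsSimpleRegion acc m q D) :
    ∀ᶠ δ : ℝ in 𝓝 0, ∀ z ∈ D ×ˢ D, ∃ S : V → V, DifferentiableAt ℝ S z.2 ∧
      ∀ᶠ y in 𝓝 z.2, y ∈ D → Joins acc D z.1 (S y) (δ * m z.1 (S y) (S y)) y := by
  have key : ∀ᶠ δ : ℝ in 𝓝 0, ∀ z ∈ D ×ˢ D, z.1 ∈ D → ∃ S : V → V, DifferentiableAt ℝ S z.2 ∧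
      ∀ᶠ y in 𝓝 z.2, y ∈ D → Joins acc D z.1 (S y) (δ * m z.1 (S y) (S y)) y := by
    refine (h.isCompact.prod h.isCompact).eventually_forall_of_forall_eventually ?_
    rintro ⟨x₀, y₀⟩ ⟨hx₀, hy₀⟩
    obtain ⟨v₀, hv₀⟩ := h.joins_zero hx₀ hy₀
    obtain ⟨S, hS, -, hSj, -⟩ := h.exists_local_solution hv₀
    have hι : Continuous fun w : ℝ × V × V => (w.2.1, w.2.2, w.1) := by fun_prop
    filter_upwards [(hι.tendsto ((0 : ℝ), x₀, y₀)).eventually hSj.eventually_nhds,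
      (hι.tendsto ((0 : ℝ), x₀, y₀)).eventually (hS.eventually (by simp))] with w h1 h2 hx
    have hc : Continuous fun y : V => (w.2.1, y, w.1) := by fun_prop
    refine ⟨fun y => S (w.2.1, y, w.1), ?_, ?_⟩
    · exact (h2.differentiableAt one_ne_zero).comp w.2.2
        (DifferentiableAt.prodMk (differentiableAt_const _)
          (differentiableAt_id.prodMk (differentiableAt_const _)))
    · filter_upwards [(hc.tendsto w.2.2).eventually h1] with y hy hyD
      exact hy hx hyD
  filter_upwards [key] with δ hδ z hz
  exact hδ z hz hz.1

/-- For sufficiently weak potentials the exponential maps of a simple region have differentiable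
global inverses. -/
theorem eventually_simple (h : IsSimpleRegion acc m q D) :
    ∀ᶠ δ : ℝ in 𝓝 0, ∀ x ∈ D, ∃ L : V → V, DifferentiableOn ℝ L D ∧
      ∀ y ∈ D, Joins acc D x (L y) (δ * m x (L y) (L y)) y ∧
        ∀ v, Joins acc D x v (δ * m x v v) y → v = L y := by
  filter_upwards [h.eventually_unique, h.eventually_exists] with δ hu he x hx
  have hex : ∀ y, ∃ v, y ∈ D → Joins acc D x v (δ * m x v v) y := by
    intro y
    by_cases hy : y ∈ D
    · obtain ⟨S, -, hS⟩ := he (x, y) ⟨hx, hy⟩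
      exact ⟨S y, hS.self_of_nhds⟩
    · exact ⟨0, fun h => absurd h hy⟩
  choose L hL using hex
  refine ⟨L, fun y hy => ?_, fun y hy => ⟨hL y hy, fun v hv => hu _ _ _ _ hv (hL y hy)⟩⟩
  obtain ⟨S, hSd, hS⟩ := he (x, y) ⟨hx, hy⟩
  refine hSd.differentiableWithinAt.congr_of_eventuallyEq_of_mem ?_ hy
  filter_upwards [mem_nhdsWithin_of_mem_nhds hS, self_mem_nhdsWithin] with z hz hzD
  exact hu _ _ _ _ (hL z hzD) (hz hzD)

end IsSimpleRegion

end Uniform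

/-! ### Global coordinates -/

section GlobalCoordinates

variable {d : ℕ} [NeZero d] {M : Type*} [TopologicalSpace M]
  [ChartedSpace (EuclideanHalfSpace d) M]

/-- Global coordinates on `M`: a smooth map `E : M → ℝ^d`, with a left inverse `f` that is smooth on
the image of `E`. -/
structure IsGlobalCoordinate (f : Coord d → M) (E : M → Coord d) : Prop where
  contMDiffOn : ContMDiffOn 𝓘(ℝ, Coord d) (𝓡∂ d) ∞ f (range E)
  contMDiff : ContMDiff (𝓡∂ d) 𝓘(ℝ, Coord d) ∞ E
  left_inv : ∀ y, f (E y) = y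

/-- The expression of `E` in the chart around `x₀`. -/
noncomputable def chartRep (E : M → Coord d) (x₀ : M) : Coord d → Coord d :=
  E ∘ (extChartAt (𝓡∂ d) x₀).symm

/-- The differential of `E` at `y`. -/
noncomputable def pushVec (E : M → Coord d) (y : M) (ξ : TangentSpace (𝓡∂ d) y) : Coord d :=
  mfderiv (𝓡∂ d) 𝓘(ℝ, Coord d) E y ξ

/-- The differential of the expression of `E` in the chart around `x₀`. -/
noncomputable def chartDeriv (E : M → Coord d) (x₀ : M) (z : Coord d) : Coord d →L[ℝ] Coord d :=
  fderivWithin ℝ (chartRep E x₀) (range (𝓡∂ d)) z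

/-- The second differential of the expression of `E` in the chart around `x₀`. -/
noncomputable def chartDeriv₂ (E : M → Coord d) (x₀ : M) (z : Coord d) :
    Coord d →L[ℝ] Coord d →L[ℝ] Coord d :=
  fderivWithin ℝ (chartDeriv E x₀) (range (𝓡∂ d)) z

lemma uniqueDiffOn_halfSpace : UniqueDiffOn ℝ (range (𝓡∂ d)) := (𝓡∂ d).uniqueDiffOn

lemma chartRep_extChartAt (E : M → Coord d) {x₀ y : M}
    (hy : y ∈ (extChartAt (𝓡∂ d) x₀).source) :
    chartRep E x₀ (extChartAt (𝓡∂ d) x₀ y) = E y := by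
  simp only [chartRep, Function.comp_apply, (extChartAt (𝓡∂ d) x₀).left_inv hy]

namespace IsGlobalCoordinate

variable {f : Coord d → M} {E : M → Coord d}

lemma injective (h : IsGlobalCoordinate f E) : Function.Injective E :=
  Function.LeftInverse.injective h.left_inv

lemma apply_of_mem (h : IsGlobalCoordinate f E) {z : Coord d} (hz : z ∈ range E) :
    E (f z) = z := by
  obtain ⟨y, rfl⟩ := hz
  rw [h.left_inv]

lemma isCompact [CompactSpace M] (h : IsGlobalCoordinate f E) : IsCompact (range E) :=
  isCompact_range h.contMDiff.continuous

variable [IsManifold (𝓡∂ d) ∞ M]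

lemma contDiffWithinAt_chartRep (h : IsGlobalCoordinate f E) {x₀ : M} {z : Coord d}
    (hz : z ∈ (extChartAt (𝓡∂ d) x₀).target) :
    ContDiffWithinAt ℝ ∞ (chartRep E x₀) (range (𝓡∂ d)) z := by
  rw [← contMDiffWithinAt_iff_contDiffWithinAt]
  exact (h.contMDiff _).comp_contMDiffWithinAt z (contMDiffWithinAt_extChartAt_symm_range x₀ hz)

lemma hasFDerivWithinAt_chartRep (h : IsGlobalCoordinate f E) {x₀ : M} {z : Coord d}
    (hz : z ∈ (extChartAt (𝓡∂ d) x₀).target) :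
    HasFDerivWithinAt (chartRep E x₀) (chartDeriv E x₀ z) (range (𝓡∂ d)) z :=
  ((h.contDiffWithinAt_chartRep hz).differentiableWithinAt (by simp)).hasFDerivWithinAt

lemma contDiffWithinAt_chartDeriv (h : IsGlobalCoordinate f E) {x₀ : M} {z : Coord d}
    (hz : z ∈ (extChartAt (𝓡∂ d) x₀).target) :
    ContDiffWithinAt ℝ ∞ (chartDeriv E x₀) (range (𝓡∂ d)) z :=
  (h.contDiffWithinAt_chartRep hz).fderivWithin_right uniqueDiffOn_halfSpace (by simp)
    (extChartAt_target_subset_range x₀ hz)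

lemma hasFDerivWithinAt_chartDeriv (h : IsGlobalCoordinate f E) {x₀ : M} {z : Coord d}
    (hz : z ∈ (extChartAt (𝓡∂ d) x₀).target) :
    HasFDerivWithinAt (chartDeriv E x₀) (chartDeriv₂ E x₀ z) (range (𝓡∂ d)) z :=
  ((h.contDiffWithinAt_chartDeriv hz).differentiableWithinAt (by simp)).hasFDerivWithinAt

lemma chartDeriv₂_symm (h : IsGlobalCoordinate f E) {x₀ : M} {z : Coord d}
    (hz : z ∈ (extChartAt (𝓡∂ d) x₀).target) (u w : Coord d) :
    chartDeriv₂ E x₀ z u w = chartDeriv₂ E x₀ z w u := by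
  have hzr := extChartAt_target_subset_range x₀ hz
  exact ((h.contDiffWithinAt_chartRep hz).isSymmSndFDerivWithinAt
    (by
      rw [minSmoothness_of_isRCLikeNormedField]
      exact WithTop.coe_le_coe.2 (le_top : (2 : ℕ∞) ≤ ⊤))
    uniqueDiffOn_halfSpace ((𝓡∂ d).range_subset_closure_interior hzr) hzr).eq u w

lemma chartDeriv_injective (h : IsGlobalCoordinate f E) {x₀ : M} {z : Coord d}
    (hz : z ∈ (extChartAt (𝓡∂ d) x₀).target) : Function.Injective (chartDeriv E x₀ z) := by
  set φ := extChartAt (𝓡∂ d) x₀ with hφ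
  have hfz : f (chartRep E x₀ z) = φ.symm z := h.left_inv _
  have hk : ContMDiffWithinAt 𝓘(ℝ, Coord d) 𝓘(ℝ, Coord d) ∞ (φ ∘ f) (range E)
      (chartRep E x₀ z) := by
    refine ContMDiffAt.comp_contMDiffWithinAt _ ?_ (h.contMDiffOn _ ⟨_, rfl⟩)
    rw [hfz]
    refine contMDiffAt_extChartAt' ?_
    rw [← extChartAt_source (𝓡∂ d)]
    exact φ.map_target hz
  have hkd := (contMDiffWithinAt_iff_contDiffWithinAt.1 hk).differentiableWithinAt (by simp)
  have hcomp := hkd.hasFDerivWithinAt.comp z (h.hasFDerivWithinAt_chartRep hz)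
    (fun w _ => ⟨_, rfl⟩)
  have hid : HasFDerivWithinAt ((φ ∘ f) ∘ chartRep E x₀) (ContinuousLinearMap.id ℝ (Coord d))
      (range (𝓡∂ d)) z := by
    have hv : ∀ w ∈ φ.target, ((φ ∘ f) ∘ chartRep E x₀) w = w := fun w hw => by
      show φ (f (E (φ.symm w))) = w
      rw [h.left_inv, φ.right_inv hw]
    refine HasFDerivWithinAt.congr_of_eventuallyEq (hasFDerivWithinAt_id z _) ?_ (hv z hz)
    filter_upwards [extChartAt_target_mem_nhdsWithin_of_mem hz] with w hw
    exact hv w hw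
  have heq := (uniqueDiffOn_halfSpace z (extChartAt_target_subset_range x₀ hz)).eq hcomp hid
  refine Function.LeftInverse.injective (g := fderivWithin ℝ (φ ∘ f) (range E) (chartRep E x₀ z))
    fun u => ?_
  exact DFunLike.congr_fun heq u

lemma chartDeriv_surjective (h : IsGlobalCoordinate f E) {x₀ : M} {z : Coord d}
    (hz : z ∈ (extChartAt (𝓡∂ d) x₀).target) : Function.Surjective (chartDeriv E x₀ z) :=
  (LinearMap.injective_iff_surjective (f := (chartDeriv E x₀ z : Coord d →ₗ[ℝ] Coord d))).1
    (h.chartDeriv_injective hz)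

lemma pushVec_coordVec (h : IsGlobalCoordinate f E) {x₀ : M} {z : Coord d}
    (hz : z ∈ (extChartAt (𝓡∂ d) x₀).target) (u : Coord d) :
    pushVec E _ (coordVec x₀ z u) = chartDeriv E x₀ z u := by
  have hd : MDifferentiableWithinAt 𝓘(ℝ, Coord d) (𝓡∂ d) (extChartAt (𝓡∂ d) x₀).symm
      (range (𝓡∂ d)) z :=
    (contMDiffWithinAt_extChartAt_symm_range (n := ∞) x₀ hz).mdifferentiableWithinAt (by simp)
  have hE : MDifferentiableAt (𝓡∂ d) 𝓘(ℝ, Coord d) E ((extChartAt (𝓡∂ d) x₀).symm z) :=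
    (h.contMDiff _).mdifferentiableAt (by simp)
  have := mfderiv_comp_mfderivWithin z hE hd
    (uniqueDiffOn_halfSpace z (extChartAt_target_subset_range x₀ hz)).uniqueMDiffWithinAt
  rw [mfderivWithin_eq_fderivWithin] at this
  exact (DFunLike.congr_fun this u).symm

omit [IsManifold (𝓡∂ d) ∞ M] in
lemma pushVec_eq (h : IsGlobalCoordinate f E) (y : M) (ξ : TangentSpace (𝓡∂ d) y) :
    pushVec E y ξ = chartDeriv E y (extChartAt (𝓡∂ d) y y) ξ := by
  have hE : MDifferentiableAt (𝓡∂ d) 𝓘(ℝ, Coord d) E y :=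
    (h.contMDiff _).mdifferentiableAt (by simp)
  exact DFunLike.congr_fun hE.mfderiv ξ

lemma pushVec_injective (h : IsGlobalCoordinate f E) (y : M) :
    Function.Injective (pushVec E y) := by
  have : pushVec E y = chartDeriv E y (extChartAt (𝓡∂ d) y y) := funext (h.pushVec_eq y)
  rw [this]
  exact h.chartDeriv_injective (mem_extChartAt_target y)

lemma pushVec_surjective (h : IsGlobalCoordinate f E) (y : M) :
    Function.Surjective (pushVec E y) := by
  have : pushVec E y = chartDeriv E y (extChartAt (𝓡∂ d) y y) := funext (h.pushVec_eq y)
  rw [this]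
  exact h.chartDeriv_surjective (mem_extChartAt_target y)

lemma uniqueDiffOn (h : IsGlobalCoordinate f E) : UniqueDiffOn ℝ (range E) := by
  rintro _ ⟨y, rfl⟩
  have hy := mem_extChartAt_target (I := 𝓡∂ d) y
  have h1 := ((h.hasFDerivWithinAt_chartRep hy).mono
    (extChartAt_target_subset_range y)).uniqueDiffWithinAt
    ((uniqueDiffOn_extChartAt_target y) _ hy) (h.chartDeriv_surjective hy).denseRange
  rw [chartRep_extChartAt E (mem_extChartAt_source y)] at h1
  exact h1.mono (by rintro _ ⟨z, -, rfl⟩; exact ⟨_, rfl⟩)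

/-- Near each point the charts of `M` extend from the image of `E` to an open subset of `ℝ^d`, with
any finite order of differentiability. -/
theorem exists_chart_extension (h : IsGlobalCoordinate f E) (x : M) {n : ℕ} (hn : n ≠ 0) :
    ∃ S : Coord d → Coord d, ContDiffAt ℝ n S (E x) ∧
      (∀ᶠ y in 𝓝 x, S (E y) = extChartAt (𝓡∂ d) x y) ∧
      ∀ᶠ z in 𝓝 (E x), z ∈ range E ↔ 0 ≤ S z 0 := by
  set φ := extChartAt (𝓡∂ d) x with hφ
  have hx : φ x ∈ φ.target := mem_extChartAt_target x
  have hEx : chartRep E x (φ x) = E x := chartRep_extChartAt E (mem_extChartAt_source x)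
  have hrange : range (𝓡∂ d) = {y | 0 ≤ (EuclideanSpace.proj (0 : Fin d) : Coord d →L[ℝ] ℝ) y} := by
    rw [range_modelWithCornersEuclideanHalfSpace]; rfl
  have hx0 := extChartAt_target_subset_range x hx
  rw [hrange] at hx0
  have hsm : ContDiffWithinAt ℝ n (chartRep E x) (range (𝓡∂ d)) (φ x) :=
    (h.contDiffWithinAt_chartRep hx).of_le (by exact_mod_cast le_top)
  rw [hrange] at hsm
  obtain ⟨F, hF, hFe⟩ := exists_contDiff_extension (e := EuclideanSpace.single (0 : Fin d) (1 : ℝ))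
    (by simp) n hx0 hsm
  rw [← hrange] at hFe
  have hFx : F (φ x) = E x := by
    rw [hFe.eq_of_nhdsWithin (by rw [hrange]; exact hx0), hEx]
  have hn0 : (n : WithTop ℕ∞) ≠ 0 := by exact_mod_cast hn
  have hFd : HasFDerivAt F (chartDeriv E x (φ x)) (φ x) := by
    have h1 := (hF.differentiable hn0 (φ x)).hasFDerivAt
    have h2 := HasFDerivWithinAt.congr_of_eventuallyEq (h.hasFDerivWithinAt_chartRep hx) hFe
      (hFe.eq_of_nhdsWithin (by rw [hrange]; exact hx0))
    have h3 := (uniqueDiffOn_halfSpace _ (extChartAt_target_subset_range x hx)).eq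
      h1.hasFDerivWithinAt h2
    rwa [h3] at h1
  obtain ⟨S, hS, hSx, hFS, hSF⟩ := exists_contDiffAt_localInverse hn0 hF.contDiffAt hFd
    (h.chartDeriv_injective hx)
  rw [hFx] at hS hSx hFS
  have hFφ : ∀ᶠ y in 𝓝 x, F (φ y) = E y := by
    have hφt : Tendsto φ (𝓝 x) (𝓝[range (𝓡∂ d)] φ x) :=
      tendsto_nhdsWithin_iff.2 ⟨continuousAt_extChartAt x, by
        filter_upwards [extChartAt_source_mem_nhds (I := 𝓡∂ d) x] with y hy
        exact extChartAt_target_subset_range x (φ.map_source hy)⟩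
    filter_upwards [hφt.eventually hFe, extChartAt_source_mem_nhds (I := 𝓡∂ d) x] with y hy hys
    rw [hy, chartRep_extChartAt E hys]
  have hSE : ∀ᶠ y in 𝓝 x, S (E y) = φ y := by
    filter_upwards [hFφ, (continuousAt_extChartAt (I := 𝓡∂ d) x).eventually hSF] with y h1 h2
    rw [← h1, h2]
  refine ⟨S, hS, hSE, ?_⟩
  have hSt : Tendsto S (𝓝 (E x)) (𝓝 (φ x)) := by
    have := hS.continuousAt.tendsto
    rwa [hSx] at this
  -- `f` is continuous on the image of `E`, so that points of the image near `E x` come from points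
  -- near `x`.
  have hft : Tendsto f (𝓝[range E] E x) (𝓝 x) := by
    have := (h.contMDiffOn.continuousOn (E x) ⟨x, rfl⟩).tendsto
    rwa [h.left_inv] at this
  have h1 := eventually_nhdsWithin_iff.1
    (hft.eventually (hSE.and (extChartAt_source_mem_nhds (I := 𝓡∂ d) x)))
  have h2 := hSt.eventually (eventually_nhdsWithin_iff.1 hFe)
  filter_upwards [h1, h2, hFS] with z h1 h2 h3
  constructor
  · intro hz
    obtain ⟨h4, h5⟩ := h1 hz
    rw [h.apply_of_mem hz] at h4
    rw [h4]
    have := extChartAt_target_subset_range x (φ.map_source h5)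
    rw [hrange] at this
    exact this
  · intro hz
    rw [← h3, h2 (by rw [hrange]; exact hz)]
    exact ⟨_, rfl⟩

variable [CompactSpace M]

/-- Smooth functions on `M` extend from the image of `E` to `ℝ^d`, with any finite order of
differentiability. -/
theorem exists_extension (h : IsGlobalCoordinate f E) {F : M → ℝ}
    (hF : ContMDiff (𝓡∂ d) 𝓘(ℝ, ℝ) ∞ F) (n : ℕ) :
    ∃ G : Coord d → ℝ, ContDiff ℝ n G ∧ ∀ y, G (E y) = F y := by
  have key : ∃ G : C^(n : ℕ∞)⟮𝓘(ℝ, Coord d), Coord d; 𝓘(ℝ, ℝ), ℝ⟯,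
      ∀ z, G z ∈ {r : ℝ | ∀ y, E y = z → r = F y} := by
    refine exists_contMDiffMap_forall_mem_convex_of_local 𝓘(ℝ, Coord d) (fun z => ?_) fun z => ?_
    · intro r hr s hs a b _ _ hab y hy
      rw [hr y hy, hs y hy, ← add_smul, hab, one_smul]
    · by_cases hz : z ∈ range E
      · obtain ⟨x, rfl⟩ := hz
        obtain ⟨S, hS, hSE, -⟩ := h.exists_chart_extension x (n := n + 1) (Nat.succ_ne_zero n)
        set φ := extChartAt (𝓡∂ d) x with hφ
        have hx : φ x ∈ φ.target := mem_extChartAt_target x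
        have hrange : range (𝓡∂ d)
            = {y | 0 ≤ (EuclideanSpace.proj (0 : Fin d) : Coord d →L[ℝ] ℝ) y} := by
          rw [range_modelWithCornersEuclideanHalfSpace]; rfl
        have hx0 := extChartAt_target_subset_range x hx
        have hsm : ContDiffWithinAt ℝ n (F ∘ φ.symm) (range (𝓡∂ d)) (φ x) := by
          rw [← contMDiffWithinAt_iff_contDiffWithinAt]
          exact ((hF _).of_le (by exact_mod_cast le_top)).comp_contMDiffWithinAt _
            (contMDiffWithinAt_extChartAt_symm_range_self x)
        rw [hrange] at hsm hx0
        obtain ⟨k, hk, hke⟩ := exists_contDiff_extension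
          (e := EuclideanSpace.single (0 : Fin d) (1 : ℝ)) (by simp) n hx0 hsm
        rw [← hrange] at hke
        have hSn : ContDiffAt ℝ n S (E x) := hS.of_le (by exact_mod_cast Nat.le_succ n)
        have hkS : ContDiffAt ℝ n (k ∘ S) (E x) := hk.contDiffAt.comp _ hSn
        obtain ⟨u, hu, hku⟩ := hkS.contDiffOn le_rfl (by simp)
        have hval : ∀ᶠ y in 𝓝 x, k (S (E y)) = F y := by
          have hφt : Tendsto φ (𝓝 x) (𝓝[range (𝓡∂ d)] φ x) :=
            tendsto_nhdsWithin_iff.2 ⟨continuousAt_extChartAt x, by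
              filter_upwards [extChartAt_source_mem_nhds (I := 𝓡∂ d) x] with y hy
              exact extChartAt_target_subset_range x (φ.map_source hy)⟩
          filter_upwards [hSE, hφt.eventually hke, extChartAt_source_mem_nhds (I := 𝓡∂ d) x]
            with y h1 h2 h3
          rw [h1, h2, Function.comp_apply, φ.left_inv h3]
        have hft : Tendsto f (𝓝[range E] E x) (𝓝 x) := by
          have := (h.contMDiffOn.continuousOn (E x) ⟨x, rfl⟩).tendsto
          rwa [h.left_inv] at this
        have hval' := eventually_nhdsWithin_iff.1 (hft.eventually hval)
        refine ⟨_, inter_mem hu hval', k ∘ S, ?_, ?_⟩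
        · exact (contMDiffOn_iff_contDiffOn.2 (by exact_mod_cast hku)).mono inter_subset_left
        · rintro _ ⟨-, hw⟩ y rfl
          have := hw ⟨y, rfl⟩
          rwa [h.left_inv] at this
      · refine ⟨(range E)ᶜ, h.isCompact.isClosed.isOpen_compl.mem_nhds hz, fun _ => 0,
          contMDiffOn_const, fun w hw y hy => absurd ⟨y, hy⟩ hw⟩
  obtain ⟨G, hG⟩ := key
  exact ⟨G, by exact_mod_cast G.contMDiff.contDiff, fun y => hG (E y) y rfl⟩

end IsGlobalCoordinate

end GlobalCoordinates

/-! ### The equation of motion -/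

section Acceleration

variable {V : Type} [NormedAddCommGroup V] [NormedSpace ℝ V]
  {m : V → V →L[ℝ] V →L[ℝ] ℝ} {r : V → ℝ}

/-- The Christoffel symbols of the first kind `Γ(u, u, w)` of the metric `m` at `p`. -/
noncomputable def christoffelForm (m : V → V →L[ℝ] V →L[ℝ] ℝ) (p u w : V) : ℝ :=
  fderiv ℝ m p u u w - fderiv ℝ m p w u u / 2

/-- The force acting on a particle at `p` with velocity `u`, as a linear functional: the sum of the
inertial force of the metric `m` and of the force of the potential `τ r`. -/
noncomputable def force (m : V → V →L[ℝ] V →L[ℝ] ℝ) (r : V → ℝ) (p u : V) (τ : ℝ) : V →L[ℝ] ℝ :=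
  (1 / 2 : ℝ) • ((fderiv ℝ m p).flip u).flip u - fderiv ℝ m p u u - τ • fderiv ℝ r p

lemma force_apply (p u w : V) (τ : ℝ) :
    force m r p u τ w = -christoffelForm m p u w - τ * fderiv ℝ r p w := by
  simp [force, christoffelForm]
  ring

/-- The acceleration `c''` of the solutions of `∇_{c'} c' = -τ ∇r(c)` in terms of position and
velocity. -/
noncomputable def accel (m : V → V →L[ℝ] V →L[ℝ] ℝ) (r : V → ℝ) (p u : V) (τ : ℝ) : V :=
  (m p).inverse (force m r p u τ)

variable [FiniteDimensional ℝ V]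

lemma isInvertible_of_pos {B : V →L[ℝ] V →L[ℝ] ℝ} (hB : ∀ u, u ≠ 0 → 0 < B u u) :
    B.IsInvertible := by
  have hinj : Function.Injective (B : V →ₗ[ℝ] V →L[ℝ] ℝ) := by
    rw [injective_iff_map_eq_zero]
    intro u hu
    by_contra hne
    have := hB u hne
    have h0 : B u u = 0 := by
      have h1 : B u = 0 := hu
      rw [h1]; rfl
    linarith
  have hdim : Module.finrank ℝ V = Module.finrank ℝ (V →L[ℝ] ℝ) := by
    rw [← (LinearMap.toContinuousLinearMap (𝕜 := ℝ) (E := V) (F' := ℝ)).finrank_eq]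
    exact Subspace.dual_finrank_eq.symm
  exact ⟨(LinearEquiv.ofInjectiveOfFinrankEq _ hinj hdim).toContinuousLinearEquiv, by ext; rfl⟩

lemma metric_accel (hm : ∀ p u, u ≠ 0 → 0 < m p u u) (p u w : V) (τ : ℝ) :
    m p (accel m r p u τ) w = -christoffelForm m p u w - τ * fderiv ℝ r p w := by
  rw [accel, (isInvertible_of_pos (hm p)).self_apply_inverse, force_apply]

omit [FiniteDimensional ℝ V] in
lemma eq_of_metric_eq (hm : ∀ p u, u ≠ 0 → 0 < m p u u) {p a b : V}
    (h : ∀ w, m p a w = m p b w) : a = b := by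
  by_contra hne
  have := hm p (a - b) (sub_ne_zero.2 hne)
  rw [map_sub (m p), sub_apply, h, sub_self] at this
  exact lt_irrefl _ this

set_option maxSynthPendingDepth 4 in
lemma contDiff_accel {n : ℕ} (hm : ContDiff ℝ (n + 1) m) (hpos : ∀ p u, u ≠ 0 → 0 < m p u u)
    (hr : ContDiff ℝ (n + 1) r) :
    ContDiff ℝ n fun z : V × V × ℝ => accel m r z.1 z.2.1 z.2.2 := by
  have hDm : ContDiff ℝ n fun z : V × V × ℝ => fderiv ℝ m z.1 :=
    (hm.fderiv_right le_rfl).comp contDiff_fst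
  have hDr : ContDiff ℝ n fun z : V × V × ℝ => fderiv ℝ r z.1 :=
    (hr.fderiv_right le_rfl).comp contDiff_fst
  have hu : ContDiff ℝ n fun z : V × V × ℝ => z.2.1 := contDiff_snd.fst
  have hforce : ContDiff ℝ n fun z : V × V × ℝ => force m r z.1 z.2.1 z.2.2 := by
    rw [contDiff_clm_apply_iff]
    intro w
    simp only [force_apply, christoffelForm]
    have h1 := ((hDm.clm_apply hu).clm_apply hu).clm_apply (contDiff_const (c := w))
    have h2 := ((hDm.clm_apply (contDiff_const (c := w))).clm_apply hu).clm_apply hu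
    have h3 := hDr.clm_apply (contDiff_const (c := w))
    exact (h1.sub (h2.div_const 2)).neg.sub (contDiff_snd.snd.mul h3)
  have hinv : ContDiff ℝ n fun z : V × V × ℝ => (m z.1).inverse := by
    rw [contDiff_iff_contDiffAt]
    intro z
    have h1 : ContDiffAt ℝ n (fun z : V × V × ℝ => m z.1) z :=
      ((hm.of_le (by exact_mod_cast Nat.le_succ n)).comp contDiff_fst).contDiffAt
    exact (isInvertible_of_pos (hpos z.1)).contDiffAt_map_inverse.comp z h1
  exact hinv.clm_apply hforce

lemma isMechanical_accel (hm : ContDiff ℝ 2 m) (hsymm : ∀ p u w, m p u w = m p w u)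
    (hpos : ∀ p u, u ≠ 0 → 0 < m p u u) (hr : ContDiff ℝ 2 r) :
    IsMechanical (accel m r) m r where
  contDiff_acc := by
    have := contDiff_accel (n := 1) (m := m) (r := r) (by exact_mod_cast hm) hpos
      (by exact_mod_cast hr)
    exact_mod_cast this
  homogeneous := by
    intro p u τ s
    refine eq_of_metric_eq hpos (p := p) fun w => ?_
    rw [metric_accel hpos, map_smul, smul_apply, metric_accel hpos]
    simp only [christoffelForm, map_smul, smul_apply, smul_eq_mul]
    ring
  contDiff_metric := hm.of_le one_le_two
  symm := hsymm
  pos := hpos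
  contDiff_potential := hr.of_le one_le_two
  energy := by
    intro p u τ
    rw [metric_accel hpos, christoffelForm]
    ring

end Acceleration

/-! ### Extension of positive definite forms -/

section PosDef

variable {V : Type} [NormedAddCommGroup V] [InnerProductSpace ℝ V] [FiniteDimensional ℝ V]

/-- A bilinear form depending smoothly on a point, symmetric and positive definite on a closed set,
can be changed away from this set so as to be symmetric and positive definite everywhere: it is
symmetrized and glued to the inner product by a cutoff function. -/
theorem exists_posDef_extension {m₀ : V → V →L[ℝ] V →L[ℝ] ℝ} {n : ℕ} (hm₀ : ContDiff ℝ n m₀)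
    {D : Set V} (hD : IsClosed D) (hsymm : ∀ p ∈ D, ∀ u w, m₀ p u w = m₀ p w u)
    (hpos : ∀ p ∈ D, ∀ u, u ≠ 0 → 0 < m₀ p u u) :
    ∃ m : V → V →L[ℝ] V →L[ℝ] ℝ, ContDiff ℝ n m ∧ (∀ p u w, m p u w = m p w u) ∧
      (∀ p u, u ≠ 0 → 0 < m p u u) ∧ ∀ p ∈ D, m p = m₀ p := by
  let m₁ : V → V →L[ℝ] V →L[ℝ] ℝ := fun z => (1 / 2 : ℝ) • (m₀ z + (m₀ z).flip)
  have hm₁a : ∀ z u w, m₁ z u w = (m₀ z u w + m₀ z w u) / 2 := by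
    intro z u w
    simp [m₁]
    ring
  have hm₁ : ContDiff ℝ n m₁ := by
    refine contDiff_clm_apply_iff.2 fun u => contDiff_clm_apply_iff.2 fun w => ?_
    simp only [hm₁a]
    exact (((hm₀.clm_apply contDiff_const).clm_apply contDiff_const).add
      ((hm₀.clm_apply contDiff_const).clm_apply contDiff_const)).div_const 2
  have hm₁D : ∀ p ∈ D, m₁ p = m₀ p := by
    intro p hp
    ext u w
    rw [hm₁a, ← hsymm p hp u w]
    ring
  let O : Set V := {z | ∀ u ∈ Metric.sphere (0 : V) 1, 0 < m₁ z u u}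
  have hO : IsOpen O := by
    refine isOpen_iff_eventually.2 fun z hz => ?_
    refine (isCompact_sphere (0 : V) 1).eventually_forall_of_forall_eventually fun u hu => ?_
    have hc : Continuous fun p : V × V => m₁ p.1 p.2 p.2 :=
      ((hm₁.continuous.comp continuous_fst).clm_apply continuous_snd).clm_apply continuous_snd
    exact hc.continuousAt.eventually (lt_mem_nhds (hz u hu))
  have hOpos : ∀ z ∈ O, ∀ u, u ≠ 0 → 0 < m₁ z u u := by
    intro z hz u hu
    have hu' : 0 < ‖u‖ := norm_pos_iff.2 hu
    have h1 := hz (‖u‖⁻¹ • u) (by simp [norm_smul, hu])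
    simp only [map_smul, smul_apply, smul_eq_mul] at h1
    have h2 : 0 < ‖u‖⁻¹ := inv_pos.2 hu'
    exact pos_of_mul_pos_right (pos_of_mul_pos_right h1 h2.le) h2.le
  have hDO : D ⊆ O := by
    intro p hp u hu
    rw [hm₁D p hp]
    exact hpos p hp u (by rintro rfl; simp at hu)
  obtain ⟨χ, hχ0, hχ1, hχ⟩ := exists_contMDiffMap_zero_one_of_isClosed (n := (n : ℕ∞))
    𝓘(ℝ, V) hO.isClosed_compl hD (disjoint_compl_left_iff_subset.2 hDO)
  have hχc : ContDiff ℝ n χ := by exact_mod_cast χ.contMDiff.contDiff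
  let B : V →L[ℝ] V →L[ℝ] ℝ := innerSL ℝ
  have hB : ∀ u w, B u w = inner ℝ u w := fun u w => rfl
  refine ⟨fun z => χ z • m₁ z + (1 - χ z) • B, ?_, fun p u w => ?_, fun p u hu => ?_,
    fun p hp => ?_⟩
  · refine contDiff_clm_apply_iff.2 fun u => contDiff_clm_apply_iff.2 fun w => ?_
    simp only [add_apply, smul_apply, smul_eq_mul]
    exact (hχc.mul ((hm₁.clm_apply contDiff_const).clm_apply contDiff_const)).add
      ((contDiff_const.sub hχc).mul contDiff_const)
  · simp only [add_apply, smul_apply, hB, hm₁a, real_inner_comm u w, add_comm (m₀ p u w)]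
  · simp only [add_apply, smul_apply, hB, smul_eq_mul, real_inner_self_eq_norm_sq]
    have hu' : 0 < ‖u‖ ^ 2 := by positivity
    by_cases hp : p ∈ O
    · have h1 := hOpos p hp u hu
      rcases (hχ p).1.eq_or_lt with h0 | h0
      · rw [← h0]
        simpa using hu'
      · have := mul_nonneg (sub_nonneg.2 (hχ p).2) hu'.le
        have := mul_pos h0 h1
        linarith
    · rw [hχ0 hp]
      simpa using hu'
  · simp only [hχ1 hp, hm₁D p hp]
    ext u w
    simp

end PosDef

/-! ### The metric and the potential in global coordinates -/

section Representation

open Bundle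

variable {d : ℕ} [NeZero d] {M : Type*} [TopologicalSpace M]
  [ChartedSpace (EuclideanHalfSpace d) M] [IsManifold (𝓡∂ d) ∞ M]

/-- The metric `m` and the potential `r` on `ℝ^d`, both of class `C^n`, represent `g` and `q` in the
global coordinates `E`. -/
structure Represents (g : Metric d M) (q : M → ℝ) (E : M → Coord d) (n : ℕ)
    (m : Coord d → Coord d →L[ℝ] Coord d →L[ℝ] ℝ) (r : Coord d → ℝ) : Prop where
  contDiff_metric : ContDiff ℝ n m
  symm : ∀ p u w, m p u w = m p w u
  pos : ∀ p u, u ≠ 0 → 0 < m p u u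
  contDiff_potential : ContDiff ℝ n r
  metric_apply : ∀ y ξ η, m (E y) (pushVec E y ξ) (pushVec E y η) = g.inner y ξ η
  potential_apply : ∀ y, r (E y) = q y

/-- The tangent vector at `y` with components `u` in the global coordinates. -/
noncomputable def pullVec (f : Coord d → M) (E : M → Coord d) (y : M) (u : Coord d) :
    TangentSpace (𝓡∂ d) y :=
  (mfderivWithin 𝓘(ℝ, Coord d) (𝓡∂ d) f (range E) (E y) u : Coord d)

namespace IsGlobalCoordinate

variable {f : Coord d → M} {E : M → Coord d}

lemma pushVec_pullVec (h : IsGlobalCoordinate f E) (y : M) (u : Coord d) :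
    pushVec E y (pullVec f E y u) = u := by
  have hf : MDifferentiableWithinAt 𝓘(ℝ, Coord d) (𝓡∂ d) f (range E) (E y) :=
    (h.contMDiffOn _ ⟨y, rfl⟩).mdifferentiableWithinAt (by simp)
  have hE : MDifferentiableAt (𝓡∂ d) 𝓘(ℝ, Coord d) E (f (E y)) :=
    (h.contMDiff _).mdifferentiableAt (by simp)
  have hu := (h.uniqueDiffOn (E y) ⟨y, rfl⟩).uniqueMDiffWithinAt
  have h1 := mfderiv_comp_mfderivWithin (E y) hE hf hu
  have h2 : fderivWithin ℝ (E ∘ f) (range E) (E y) = ContinuousLinearMap.id ℝ (Coord d) := by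
    rw [← fderivWithin_id (h.uniqueDiffOn (E y) ⟨y, rfl⟩)]
    exact fderivWithin_congr (fun z hz => h.apply_of_mem hz) (h.apply_of_mem ⟨y, rfl⟩)
  rw [mfderivWithin_eq_fderivWithin] at h1
  have h3 : ∀ (y' : M) (v : Coord d), y' = y → pushVec E y' v = pushVec E y v := by
    rintro y' v rfl; rfl
  have h4 : fderivWithin ℝ (E ∘ f) (range E) (E y) u
      = pushVec E (f (E y)) (pullVec f E y u) := DFunLike.congr_fun h1 u
  rw [h2] at h4
  exact (h3 _ _ (h.left_inv y)).symm.trans h4.symm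

lemma contMDiff_pullVec (h : IsGlobalCoordinate f E) (u : Coord d) :
    ContMDiff (𝓡∂ d) ((𝓡∂ d).prod 𝓘(ℝ, Coord d)) ∞
      fun y => TotalSpace.mk' (Coord d) (E := fun y : M => TangentSpace (𝓡∂ d) y) y
        (pullVec f E y u) := by
  have h1 : ContMDiff 𝓘(ℝ, Coord d) 𝓘(ℝ, Coord d).tangent ∞
      (fun z : Coord d => (⟨z, u⟩ : TangentBundle 𝓘(ℝ, Coord d) (Coord d))) :=
    fun z => contMDiffAt_vectorSpace_iff_contDiffAt.2 contDiffAt_const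
  have h2 := h.contMDiffOn.contMDiffOn_tangentMapWithin (m := ∞) (by simp)
    (h.uniqueDiffOn.uniqueMDiffOn)
  have h3 : ContMDiff (𝓡∂ d) (𝓡∂ d).tangent ∞ (fun y =>
      tangentMapWithin 𝓘(ℝ, Coord d) (𝓡∂ d) f (range E) ⟨E y, u⟩) :=
    h2.comp_contMDiff (h1.comp h.contMDiff) fun y => ⟨y, rfl⟩
  have h4 : ∀ (y y' : M) (v : Coord d), y' = y →
      (⟨y', v⟩ : TangentBundle (𝓡∂ d) M) = ⟨y, v⟩ := by
    rintro y y' v rfl; rfl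
  refine h3.congr fun y => ?_
  exact (h4 _ _ _ (h.left_inv y)).symm

lemma contMDiff_inner_pullVec (h : IsGlobalCoordinate f E) (g : Metric d M) (u w : Coord d) :
    ContMDiff (𝓡∂ d) 𝓘(ℝ, ℝ) ∞ fun y => g.inner y (pullVec f E y u) (pullVec f E y w) := by
  intro y
  have : ContMDiffAt (𝓡∂ d) ((𝓡∂ d).prod 𝓘(ℝ)) ∞
      (fun y => TotalSpace.mk' ℝ (E := Bundle.Trivial M ℝ) y
        (g.inner y (pullVec f E y u) (pullVec f E y w))) y := by
    apply ContMDiffAt.clm_bundle_apply₂ (F₁ := Coord d) (F₂ := Coord d)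
    · exact g.contMDiff y
    · exact h.contMDiff_pullVec u y
    · exact h.contMDiff_pullVec w y
  simp only [contMDiffAt_totalSpace] at this
  exact this.2

variable [CompactSpace M]

/-- A smooth metric and a smooth function on `M` are represented by a metric and a function on all
of `ℝ^d`, with any finite order of differentiability. -/
theorem exists_represents (h : IsGlobalCoordinate f E) (g : Metric d M) {q : M → ℝ}
    (hq : ContMDiff (𝓡∂ d) 𝓘(ℝ, ℝ) ∞ q) (n : ℕ) : ∃ m r, Represents g q E n m r := by
  obtain ⟨r, hr, hrE⟩ := h.exists_extension hq n
  have hext : ∀ i j : Fin d, ∃ G : Coord d → ℝ, ContDiff ℝ n G ∧ ∀ y, G (E y)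
      = g.inner y (pullVec f E y (EuclideanSpace.single i 1))
        (pullVec f E y (EuclideanSpace.single j 1)) := fun i j =>
    h.exists_extension (h.contMDiff_inner_pullVec g _ _) n
  choose G hG hGE using hext
  let pr : Fin d → Coord d →L[ℝ] ℝ := fun i => EuclideanSpace.proj i
  -- An extension of the metric, which need not be symmetric or definite away from the image of `E`.
  let m₀ : Coord d → Coord d →L[ℝ] Coord d →L[ℝ] ℝ := fun z =>
    ∑ i, ∑ j, G i j z • (pr i).smulRight (pr j)
  have hm₀a : ∀ z u w, m₀ z u w = ∑ i, ∑ j, G i j z * (u i * w j) := by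
    intro z u w
    simp [m₀, pr]
  have hm₀ : ContDiff ℝ n m₀ := by
    refine contDiff_clm_apply_iff.2 fun u => contDiff_clm_apply_iff.2 fun w => ?_
    simp only [hm₀a]
    exact ContDiff.sum fun i _ => ContDiff.sum fun j _ => (hG i j).mul contDiff_const
  have hm₀E : ∀ y ξ η, m₀ (E y) (pushVec E y ξ) (pushVec E y η) = g.inner y ξ η := by
    intro y ξ η
    let A : Coord d →ₗ[ℝ] Coord d :=
      { toFun := fun u => pullVec f E y u
        map_add' := fun a b => map_add (mfderivWithin 𝓘(ℝ, Coord d) (𝓡∂ d) f (range E) (E y)) a b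
        map_smul' := fun a b =>
          map_smul (mfderivWithin 𝓘(ℝ, Coord d) (𝓡∂ d) f (range E) (E y)) a b }
    have hinv : ∀ ζ : TangentSpace (𝓡∂ d) y, A (pushVec E y ζ) = ζ := fun ζ =>
      h.pushVec_injective y (h.pushVec_pullVec y _)
    have hexp : ∀ u : Coord d, A u = ∑ i, u i • A (EuclideanSpace.single i 1) := by
      intro u
      conv_lhs => rw [← (EuclideanSpace.basisFun (Fin d) ℝ).sum_repr u]
      simp
    let B : Coord d →L[ℝ] Coord d →L[ℝ] ℝ := g.inner y
    have hGB : ∀ i j, G i j (E y)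
        = B (A (EuclideanSpace.single i 1)) (A (EuclideanSpace.single j 1)) := fun i j => hGE i j y
    have hB : ∀ u w : Coord d, B (A u) (A w) = m₀ (E y) u w := by
      intro u w
      rw [hm₀a, hexp u, hexp w]
      simp only [map_sum, sum_apply, map_smul, smul_apply, smul_eq_mul, hGB, Finset.mul_sum]
      rw [Finset.sum_comm]
      refine Finset.sum_congr rfl fun i _ => Finset.sum_congr rfl fun j _ => ?_
      ring
    rw [← hB, hinv, hinv]
    rfl
  obtain ⟨m, hm, hsymm, hpos, hmD⟩ := exists_posDef_extension hm₀ h.isCompact.isClosed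
    (by
      rintro _ ⟨y, rfl⟩ u w
      obtain ⟨ξ, rfl⟩ := h.pushVec_surjective y u
      obtain ⟨η, rfl⟩ := h.pushVec_surjective y w
      rw [hm₀E, hm₀E, g.symm])
    (by
      rintro _ ⟨y, rfl⟩ u hu
      obtain ⟨ξ, rfl⟩ := h.pushVec_surjective y u
      rw [hm₀E]
      refine g.pos y ξ ?_
      rintro rfl
      exact hu (map_zero (mfderiv (𝓡∂ d) 𝓘(ℝ, Coord d) E y)))
  exact ⟨m, r, hm, hsymm, hpos, hr, fun y ξ η => by rw [hmD _ ⟨y, rfl⟩, hm₀E], hrE⟩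

end IsGlobalCoordinate

end Representation

/-! ### Derivatives along curves -/

section Curves

variable {V : Type*} [NormedAddCommGroup V] [NormedSpace ℝ V]

lemma hasDerivWithinAt_derivWithin {b : ℝ → V} {s : Set ℝ} {t : ℝ}
    (hb : ContDiffWithinAt ℝ 2 b s t) (hs : UniqueDiffOn ℝ s) (ht : t ∈ s) :
    HasDerivWithinAt (derivWithin b s) (derivWithin (derivWithin b s) s t) s t := by
  have h1 : ContDiffWithinAt ℝ 1 (fderivWithin ℝ b s) s t :=
    hb.fderivWithin_right hs (by norm_num) ht
  have h2 : ContDiffWithinAt ℝ 1 (derivWithin b s) s t := h1.clm_apply contDiffWithinAt_const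
  exact (h2.differentiableWithinAt one_ne_zero).hasDerivWithinAt

lemma hasDerivWithinAt_apply_comp {A : V → V →L[ℝ] V} {A' : V →L[ℝ] V →L[ℝ] V}
    {b b' : ℝ → V} {v w : V} {S : Set V} {s : Set ℝ} {t : ℝ} (hA : HasFDerivWithinAt A A' S (b t))
    (hb : HasDerivWithinAt b v s t) (hb' : HasDerivWithinAt b' w s t) (hS : MapsTo b s S) :
    HasDerivWithinAt (fun x => A (b x) (b' x)) (A' v (b' t) + A (b t) w) s t :=
  (hA.comp_hasDerivWithinAt t hb hS).clm_apply hb'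

set_option maxSynthPendingDepth 4 in
lemma fderivWithin_bilinear_comp {m : V → V →L[ℝ] V →L[ℝ] ℝ} {e a b : V → V} {e' a' b' : V →L[ℝ] V}
    {S : Set V} {z : V} (hS : UniqueDiffWithinAt ℝ S z) (hm : DifferentiableAt ℝ m (e z))
    (he : HasFDerivWithinAt e e' S z) (ha : HasFDerivWithinAt a a' S z)
    (hb : HasFDerivWithinAt b b' S z) (k : V) :
    fderivWithin ℝ (fun z => m (e z) (a z) (b z)) S z k
      = fderiv ℝ m (e z) (e' k) (a z) (b z) + m (e z) (a' k) (b z) + m (e z) (a z) (b' k) := by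
  have h1 := hm.hasFDerivAt.comp_hasFDerivWithinAt z he
  have h2 := (h1.clm_apply ha).clm_apply hb
  have h3 : fderivWithin ℝ (fun z => m (e z) (a z) (b z)) S z = _ := h2.fderivWithin hS
  rw [h3]
  simp
  ring

end Curves

/-! ### Newton's equation in global coordinates -/

section Transformation

variable {d : ℕ} [NeZero d] {M : Type*} [TopologicalSpace M]
  [ChartedSpace (EuclideanHalfSpace d) M] [IsManifold (𝓡∂ d) ∞ M]
  {f : Coord d → M} {E : M → Coord d} {g : Metric d M} {q : M → ℝ} {n : ℕ}
  {m : Coord d → Coord d →L[ℝ] Coord d →L[ℝ] ℝ} {r : Coord d → ℝ}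

namespace Represents

lemma differential_eq (h : IsGlobalCoordinate f E) (hn : n ≠ 0) (hr : Represents g q E n m r)
    (y : M) (ξ : TangentSpace (𝓡∂ d) y) :
    differential q y ξ = fderiv ℝ r (E y) (pushVec E y ξ) := by
  have hq : q = r ∘ E := funext fun y => (hr.potential_apply y).symm
  have hn0 : (n : WithTop ℕ∞) ≠ 0 := by exact_mod_cast hn
  have hrd : MDifferentiableAt 𝓘(ℝ, Coord d) 𝓘(ℝ, ℝ) r (E y) :=
    (hr.contDiff_potential.differentiable hn0 _).mdifferentiableAt
  have hE : MDifferentiableAt (𝓡∂ d) 𝓘(ℝ, Coord d) E y :=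
    (h.contMDiff _).mdifferentiableAt (by simp)
  have h1 := mfderiv_comp y hrd hE
  rw [mfderiv_eq_fderiv] at h1
  rw [differential, hq]
  exact DFunLike.congr_fun h1 ξ

variable {x₀ : M} {z : Coord d}

lemma metricCoord_eq (h : IsGlobalCoordinate f E) (hr : Represents g q E n m r)
    (hz : z ∈ (extChartAt (𝓡∂ d) x₀).target) (u w : Coord d) :
    metricCoord g x₀ z u w
      = m (chartRep E x₀ z) (chartDeriv E x₀ z u) (chartDeriv E x₀ z w) := by
  rw [metricCoord, ← hr.metric_apply, h.pushVec_coordVec hz, h.pushVec_coordVec hz]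
  rfl

lemma fderivWithin_metricCoord (h : IsGlobalCoordinate f E) (hn : n ≠ 0)
    (hr : Represents g q E n m r) (hz : z ∈ (extChartAt (𝓡∂ d) x₀).target) (u w k : Coord d) :
    fderivWithin ℝ (fun z => metricCoord g x₀ z u w) (range (𝓡∂ d)) z k
      = fderiv ℝ m (chartRep E x₀ z) (chartDeriv E x₀ z k) (chartDeriv E x₀ z u)
          (chartDeriv E x₀ z w)
        + m (chartRep E x₀ z) (chartDeriv₂ E x₀ z k u) (chartDeriv E x₀ z w)
        + m (chartRep E x₀ z) (chartDeriv E x₀ z u) (chartDeriv₂ E x₀ z k w) := by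
  have hn0 : (n : WithTop ℕ∞) ≠ 0 := by exact_mod_cast hn
  have hD : ∀ v : Coord d, HasFDerivWithinAt (fun z => chartDeriv E x₀ z v)
      ((chartDeriv₂ E x₀ z).flip v) (range (𝓡∂ d)) z := fun v => by
    simpa using (h.hasFDerivWithinAt_chartDeriv hz).clm_apply (hasFDerivWithinAt_const v z _)
  have h1 : (fun z => metricCoord g x₀ z u w) =ᶠ[𝓝[range (𝓡∂ d)] z]
      fun z => m (chartRep E x₀ z) (chartDeriv E x₀ z u) (chartDeriv E x₀ z w) := by
    filter_upwards [extChartAt_target_mem_nhdsWithin_of_mem hz] with y hy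
    exact hr.metricCoord_eq h hy u w
  rw [h1.fderivWithin_eq (hr.metricCoord_eq h hz u w)]
  exact fderivWithin_bilinear_comp
    (uniqueDiffOn_halfSpace z (extChartAt_target_subset_range x₀ hz))
    (hr.contDiff_metric.differentiable hn0 _) (h.hasFDerivWithinAt_chartRep hz) (hD u) (hD w) k

/-- The transformation law of the Christoffel symbols. -/
theorem christoffel_eq (h : IsGlobalCoordinate f E) (hn : n ≠ 0) (hr : Represents g q E n m r)
    (hz : z ∈ (extChartAt (𝓡∂ d) x₀).target) (u w : Coord d) :
    christoffel g x₀ z u u w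
      = christoffelForm m (chartRep E x₀ z) (chartDeriv E x₀ z u) (chartDeriv E x₀ z w)
        + m (chartRep E x₀ z) (chartDeriv₂ E x₀ z u u) (chartDeriv E x₀ z w) := by
  rw [christoffel, hr.fderivWithin_metricCoord h hn hz, hr.fderivWithin_metricCoord h hn hz,
    h.chartDeriv₂_symm hz w u, hr.symm _ (chartDeriv₂ E x₀ z u w) (chartDeriv E x₀ z u),
    christoffelForm]
  ring

end Represents

namespace IsGlobalCoordinate

/-- The velocity and the acceleration of a curve in `M` in global coordinates, in terms of those in
the chart around `x₀`. -/
lemma derivWithin_eq (h : IsGlobalCoordinate f E) {γ : ℝ → M} {T : ℝ} (hT : 0 < T)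
    (hγ : ContMDiffOn 𝓘(ℝ, ℝ) (𝓡∂ d) 2 γ (Icc 0 T)) {x₀ : M} {t : ℝ} (ht : t ∈ Icc 0 T)
    (hs : γ t ∈ (extChartAt (𝓡∂ d) x₀).source) :
    let b : ℝ → Coord d := fun s => extChartAt (𝓡∂ d) x₀ (γ s)
    let b' := derivWithin b (Icc 0 T)
    derivWithin (E ∘ γ) (Icc 0 T) t = chartDeriv E x₀ (b t) (b' t) ∧
      derivWithin (derivWithin (E ∘ γ) (Icc 0 T)) (Icc 0 T) t
        = chartDeriv₂ E x₀ (b t) (b' t) (b' t)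
          + chartDeriv E x₀ (b t) (derivWithin b' (Icc 0 T) t) := by
  intro b b'
  have hu : UniqueDiffOn ℝ (Icc 0 T) := uniqueDiffOn_Icc hT
  have hb : ∀ s ∈ Icc 0 T, γ s ∈ (extChartAt (𝓡∂ d) x₀).source →
      ContDiffWithinAt ℝ 2 b (Icc 0 T) s := fun s hs hsrc => by
    rw [← contMDiffWithinAt_iff_contDiffWithinAt]
    refine ContMDiffAt.comp_contMDiffWithinAt s ?_ (hγ s hs)
    exact (contMDiffAt_extChartAt' (n := ∞) (by rwa [← extChartAt_source (𝓡∂ d)])).of_le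
      (WithTop.coe_le_coe.2 (le_top : (2 : ℕ∞) ≤ ⊤))
  have hsrc : ∀ᶠ s in 𝓝[Icc 0 T] t, γ s ∈ (extChartAt (𝓡∂ d) x₀).source :=
    (hγ.continuousOn t ht).eventually ((isOpen_extChartAt_source x₀).mem_nhds hs)
  have hmaps : MapsTo b (Icc 0 T) (range (𝓡∂ d)) := fun s _ => ⟨chartAt _ x₀ (γ s), rfl⟩
  have hfirst : ∀ s ∈ Icc 0 T, γ s ∈ (extChartAt (𝓡∂ d) x₀).source →
      derivWithin (E ∘ γ) (Icc 0 T) s = chartDeriv E x₀ (b s) (b' s) := by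
    intro s hs hss
    have h1 := ((hb s hs hss).differentiableWithinAt two_ne_zero).hasDerivWithinAt
    have h2 := (h.hasFDerivWithinAt_chartRep ((extChartAt (𝓡∂ d) x₀).map_source hss)
      ).comp_hasDerivWithinAt s h1 hmaps
    have h3 : HasDerivWithinAt (E ∘ γ) (chartDeriv E x₀ (b s) (b' s)) (Icc 0 T) s := by
      refine HasDerivWithinAt.congr_of_eventuallyEq h2 ?_ (chartRep_extChartAt E hss).symm
      have : ∀ᶠ s' in 𝓝[Icc 0 T] s, γ s' ∈ (extChartAt (𝓡∂ d) x₀).source :=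
        (hγ.continuousOn s hs).eventually ((isOpen_extChartAt_source x₀).mem_nhds hss)
      filter_upwards [this] with s' hs'
      exact (chartRep_extChartAt E hs').symm
    exact h3.derivWithin (hu s hs)
  refine ⟨hfirst t ht hs, ?_⟩
  have h1 := ((hb t ht hs).differentiableWithinAt two_ne_zero).hasDerivWithinAt
  have h2 := hasDerivWithinAt_derivWithin (hb t ht hs) hu ht
  have h3 := hasDerivWithinAt_apply_comp
    (h.hasFDerivWithinAt_chartDeriv ((extChartAt (𝓡∂ d) x₀).map_source hs)) h1 h2 hmaps
  refine HasDerivWithinAt.derivWithin (HasDerivWithinAt.congr_of_eventuallyEq h3 ?_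
    (hfirst t ht hs)) (hu t ht)
  filter_upwards [hsrc, self_mem_nhdsWithin] with s hs hsI
  exact hfirst s hsI hs

omit [IsManifold (𝓡∂ d) ∞ M] in
lemma derivWithin_zero (h : IsGlobalCoordinate f E) {γ : ℝ → M} {T : ℝ} (hT : 0 < T)
    (hγ : ContMDiffOn 𝓘(ℝ, ℝ) (𝓡∂ d) 2 γ (Icc 0 T)) :
    derivWithin (E ∘ γ) (Icc 0 T) 0
      = pushVec E (γ 0) (mfderivWithin 𝓘(ℝ, ℝ) (𝓡∂ d) γ (Icc 0 T) 0 (1 : ℝ)) := by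
  have h0 : (0 : ℝ) ∈ Icc 0 T := ⟨le_rfl, hT.le⟩
  have h1 := mfderiv_comp_mfderivWithin (0 : ℝ)
    ((h.contMDiff (γ 0)).mdifferentiableAt (by simp))
    ((hγ 0 h0).mdifferentiableWithinAt two_ne_zero)
    ((uniqueDiffOn_Icc hT) 0 h0).uniqueMDiffWithinAt
  rw [mfderivWithin_eq_fderivWithin] at h1
  exact DFunLike.congr_fun h1 (1 : ℝ)

omit [IsManifold (𝓡∂ d) ∞ M] in
lemma contDiffOn_comp (h : IsGlobalCoordinate f E) {γ : ℝ → M} {T : ℝ}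
    (hγ : ContMDiffOn 𝓘(ℝ, ℝ) (𝓡∂ d) 2 γ (Icc 0 T)) : ContDiffOn ℝ 2 (E ∘ γ) (Icc 0 T) := by
  rw [← contMDiffOn_iff_contDiffOn]
  exact (h.contMDiff.of_le (WithTop.coe_le_coe.2 (le_top : (2 : ℕ∞) ≤ ⊤))).comp_contMDiffOn hγ

end IsGlobalCoordinate

namespace Represents

/-- Newton's equation of strength `τ` for a curve in `M`, in the chart around `x₀`, says that the
curve solves the equation of motion in global coordinates. -/
lemma newton_iff (h : IsGlobalCoordinate f E) (hn : n ≠ 0) (hr : Represents g q E n m r)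
    {γ : ℝ → M} {T : ℝ} (hT : 0 < T) (hγ : ContMDiffOn 𝓘(ℝ, ℝ) (𝓡∂ d) 2 γ (Icc 0 T))
    (hq : MDifferentiable (𝓡∂ d) 𝓘(ℝ, ℝ) q)
    {x₀ : M} {t : ℝ} (ht : t ∈ Icc 0 T) (hs : γ t ∈ (extChartAt (𝓡∂ d) x₀).source) (τ : ℝ) :
    let b : ℝ → Coord d := fun s => extChartAt (𝓡∂ d) x₀ (γ s)
    let b' := derivWithin b (Icc 0 T)
    let b'' := derivWithin b' (Icc 0 T)
    (∀ w, metricCoord g x₀ (b t) (b'' t) w + christoffel g x₀ (b t) (b' t) (b' t) w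
      = - differential (fun y => τ * q y) ((extChartAt (𝓡∂ d) x₀).symm (b t))
          (coordVec x₀ (b t) w)) ↔
    derivWithin (derivWithin (E ∘ γ) (Icc 0 T)) (Icc 0 T) t
      = accel m r (E (γ t)) (derivWithin (E ∘ γ) (Icc 0 T) t) τ := by
  intro b b' b''
  have hz : b t ∈ (extChartAt (𝓡∂ d) x₀).target := (extChartAt (𝓡∂ d) x₀).map_source hs
  have hbt : chartRep E x₀ (b t) = E (γ t) := chartRep_extChartAt E hs
  obtain ⟨h1, h2⟩ := h.derivWithin_eq hT hγ ht hs
  change _ = chartDeriv E x₀ (b t) (b' t) at h1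
  change _ = chartDeriv₂ E x₀ (b t) (b' t) (b' t) + chartDeriv E x₀ (b t) (b'' t) at h2
  have hdiff : ∀ w, differential (fun y => τ * q y) ((extChartAt (𝓡∂ d) x₀).symm (b t))
      (coordVec x₀ (b t) w) = τ * fderiv ℝ r (E (γ t)) (chartDeriv E x₀ (b t) w) := by
    intro w
    have e1 : differential (fun y => τ * q y) ((extChartAt (𝓡∂ d) x₀).symm (b t))
        (coordVec x₀ (b t) w) = τ * differential q ((extChartAt (𝓡∂ d) x₀).symm (b t))
        (coordVec x₀ (b t) w) :=
      DFunLike.congr_fun (const_smul_mfderiv (hq _) τ) (coordVec x₀ (b t) w)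
    rw [e1, hr.differential_eq h hn, h.pushVec_coordVec hz, ← hbt]
    rfl
  have key : ∀ w, (metricCoord g x₀ (b t) (b'' t) w + christoffel g x₀ (b t) (b' t) (b' t) w
      = - differential (fun y => τ * q y) ((extChartAt (𝓡∂ d) x₀).symm (b t))
          (coordVec x₀ (b t) w)) ↔
      m (E (γ t)) (derivWithin (derivWithin (E ∘ γ) (Icc 0 T)) (Icc 0 T) t)
        (chartDeriv E x₀ (b t) w)
      = m (E (γ t)) (accel m r (E (γ t)) (derivWithin (E ∘ γ) (Icc 0 T) t) τ)
        (chartDeriv E x₀ (b t) w) := by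
    intro w
    rw [hdiff, hr.metricCoord_eq h hz, hr.christoffel_eq h hn hz, metric_accel hr.pos, h1, h2, hbt,
      map_add, add_apply]
    constructor <;> intro e <;> linarith
  constructor
  · intro hw
    refine eq_of_metric_eq hr.pos (p := E (γ t)) fun w => ?_
    obtain ⟨w, rfl⟩ := h.chartDeriv_surjective hz w
    exact (key w).1 (hw w)
  · intro he w
    rw [key w, he]

end Represents

end Transformation

/-! ### The exponential maps in global coordinates -/

section Graphs

variable {d : ℕ} [NeZero d] {M : Type*} [TopologicalSpace M]
  [ChartedSpace (EuclideanHalfSpace d) M] [IsManifold (𝓡∂ d) ∞ M]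
  {f : Coord d → M} {E : M → Coord d} {g : Metric d M} {q : M → ℝ} {n : ℕ}
  {m : Coord d → Coord d →L[ℝ] Coord d →L[ℝ] ℝ} {r : Coord d → ℝ}

lemma IsTrajectory.derivWithin_eq {V : Type} [NormedAddCommGroup V] [NormedSpace ℝ V]
    {acc : V → V → ℝ → V} {τ T : ℝ} {c c' e : ℝ → V} (h : IsTrajectory acc τ T c c') (hT : 0 < T)
    (he : EqOn e c (Icc 0 T)) {t : ℝ} (ht : t ∈ Icc 0 T) :
    derivWithin e (Icc 0 T) t = c' t := by
  rw [derivWithin_congr he (he ht)]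
  exact (h.deriv t ht).derivWithin (uniqueDiffOn_Icc hT t ht)

lemma IsTrajectory.contDiffOn {V : Type} [NormedAddCommGroup V] [NormedSpace ℝ V]
    {acc : V → V → ℝ → V} (hacc : Continuous fun z : V × V × ℝ => acc z.1 z.2.1 z.2.2)
    {τ T : ℝ} {c c' : ℝ → V} (h : IsTrajectory acc τ T c c') (hT : 0 < T) :
    ContDiffOn ℝ 2 c (Icc 0 T) := by
  have hu : UniqueDiffOn ℝ (Icc 0 T) := uniqueDiffOn_Icc hT
  have hc : ContinuousOn c (Icc 0 T) := fun t ht => (h.deriv t ht).continuousWithinAt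
  have hc' : ContinuousOn c' (Icc 0 T) := fun t ht => (h.deriv' t ht).continuousWithinAt
  have h1 : ContDiffOn ℝ 1 c' (Icc 0 T) := by
    rw [show (1 : WithTop ℕ∞) = 0 + 1 from (zero_add 1).symm, contDiffOn_succ_iff_derivWithin hu]
    refine ⟨fun t ht => (h.deriv' t ht).differentiableWithinAt, by simp, ?_⟩
    rw [contDiffOn_zero]
    refine ContinuousOn.congr (f := fun t => acc (c t) (c' t) τ) ?_
      fun t ht => (h.deriv' t ht).derivWithin (hu t ht)
    exact hacc.comp_continuousOn (hc.prodMk (hc'.prodMk continuousOn_const))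
  rw [show (2 : WithTop ℕ∞) = 1 + 1 from one_add_one_eq_two.symm,
    contDiffOn_succ_iff_derivWithin hu]
  exact ⟨fun t ht => (h.deriv t ht).differentiableWithinAt, by simp,
    h1.congr fun t ht => (h.deriv t ht).derivWithin (hu t ht)⟩

namespace Represents

lemma isMechanical (hr : Represents g q E n m r) (hn : 2 ≤ n) : IsMechanical (accel m r) m r :=
  isMechanical_accel (hr.contDiff_metric.of_le (by exact_mod_cast hn)) hr.symm hr.pos
    (hr.contDiff_potential.of_le (by exact_mod_cast hn))

/-- Curves in `M` that solve Newton's equation correspond to trajectories in the image of the global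
coordinates. -/
theorem exists_isHGeodesic_iff (h : IsGlobalCoordinate f E) (hn : 2 ≤ n)
    (hr : Represents g q E n m r) (hq : MDifferentiable (𝓡∂ d) 𝓘(ℝ, ℝ) q) {T : ℝ} (hT : 0 < T)
    {τ : ℝ} {x y : M} {ξ : TangentSpace (𝓡∂ d) x} :
    (∃ γ : ℝ → M, IsHGeodesic g (fun y => τ * q y) T γ ∧ StartsAt x ξ T γ ∧ γ T = y) ↔
      ∃ c c' : ℝ → Coord d, IsTrajectory (accel m r) τ T c c' ∧ (∀ t ∈ Icc 0 T, c t ∈ range E) ∧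
        c 0 = E x ∧ c' 0 = pushVec E x ξ ∧ c T = E y := by
  have hn0 : n ≠ 0 := by omega
  have h0 : (0 : ℝ) ∈ Icc 0 T := ⟨le_rfl, hT.le⟩
  have hTT : T ∈ Icc 0 T := ⟨hT.le, le_rfl⟩
  have hu : UniqueDiffOn ℝ (Icc 0 T) := uniqueDiffOn_Icc hT
  constructor
  · rintro ⟨γ, hγ, ⟨rfl, rfl⟩, rfl⟩
    have hc := h.contDiffOn_comp hγ.contMDiffOn
    refine ⟨E ∘ γ, derivWithin (E ∘ γ) (Icc 0 T), ⟨fun t ht =>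
      ((hc t ht).differentiableWithinAt two_ne_zero).hasDerivWithinAt, fun t ht => ?_⟩,
      fun t _ => ⟨_, rfl⟩, rfl, h.derivWithin_zero hT hγ.contMDiffOn, rfl⟩
    have h1 := (hr.newton_iff h hn0 hT hγ.contMDiffOn hq ht (mem_extChartAt_source (γ t)) τ).1
      fun w => hγ.newton t ht (γ t) (mem_extChartAt_source (γ t)) w
    have h2 := hasDerivWithinAt_derivWithin (hc t ht) hu ht
    rwa [h1] at h2
  · rintro ⟨c, c', hc, hcD, hc0, hc0', hcT⟩
    have hEf : EqOn (E ∘ (f ∘ c)) c (Icc 0 T) := fun t ht => h.apply_of_mem (hcD t ht)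
    have hacc := ((hr.isMechanical hn).contDiff_acc).continuous
    have hγ : ContMDiffOn 𝓘(ℝ, ℝ) (𝓡∂ d) 2 (f ∘ c) (Icc 0 T) :=
      (h.contMDiffOn.of_le (WithTop.coe_le_coe.2 (le_top : (2 : ℕ∞) ≤ ⊤))).comp
        (contMDiffOn_iff_contDiffOn.2 (hc.contDiffOn hacc hT)) hcD
    have hder : EqOn (derivWithin (E ∘ (f ∘ c)) (Icc 0 T)) c' (Icc 0 T) := fun t ht =>
      hc.derivWithin_eq hT hEf ht
    have hx : (f ∘ c) 0 = x := by rw [Function.comp_apply, hc0, h.left_inv]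
    refine ⟨f ∘ c, ⟨hγ, fun t ht x₀ hs => ?_⟩, ⟨hx, ?_⟩, by
      rw [Function.comp_apply, hcT, h.left_inv]⟩
    · refine (hr.newton_iff h hn0 hT hγ hq ht hs τ).2 ?_
      rw [derivWithin_congr hder (hder ht), hder ht,
        (hc.deriv' t ht).derivWithin (hu t ht)]
      rw [← hEf ht]
      rfl
    · have h1 := h.derivWithin_zero hT hγ
      rw [hder h0, hc0'] at h1
      have h3 : ∀ (y' : M) (v : Coord d), y' = x → pushVec E y' v = pushVec E x v := by
        rintro y' v rfl; rfl
      refine h.pushVec_injective x ?_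
      rw [h1]
      exact (h3 _ _ hx).symm

theorem expGraph_iff (h : IsGlobalCoordinate f E) (hn : 2 ≤ n)
    (hr : Represents g q E n m r) (hq : MDifferentiable (𝓡∂ d) 𝓘(ℝ, ℝ) q) {x y : M}
    {v : TangentSpace (𝓡∂ d) x} :
    ExpGraph g x v y ↔ Joins (accel m r) (range E) (E x) (pushVec E x v) 0 (E y) := by
  have h1 := hr.exists_isHGeodesic_iff h hn hq one_pos (τ := 0) (x := x) (y := y) (ξ := v)
  simp only [zero_mul] at h1
  exact h1

/-- A trajectory starting at rest is constant. -/
lemma joins_zero_vec_iff [CompactSpace M] (h : IsGlobalCoordinate f E) (hn : 2 ≤ n)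
    (hr : Represents g q E n m r) {x : M} {y : Coord d} {δ : ℝ} :
    Joins (accel m r) (range E) (E x) 0 (δ * m (E x) 0 0) y ↔ y = E x := by
  have hmech := hr.isMechanical hn
  constructor
  · intro hj
    obtain ⟨φ, U, K, C, fb⟩ := hmech.exists_isFlowBox h.isCompact (n := 1) le_rfl
      (by exact_mod_cast hmech.contDiff_acc) 0 one_pos
    have hz : ∀ y', Joins (accel m r) (range E) (E x) 0 (0 * m (E x) 0 0) y' →
        (φ (initialState m (E x, 0, 0)) 1).1 = y' := fun y' hy' =>
      (fb.mem (E x) 0 0 y' (by simp) (by simp) hy').2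
    have hj' : Joins (accel m r) (range E) (E x) 0 (0 * m (E x) 0 0) y := by simpa using hj
    rw [← hz y hj', hz (E x) (joins_const hmech (mem_range_self x) 0)]
  · rintro rfl
    exact joins_const hmech (mem_range_self x) δ

/-- The Hamiltonian exponential map at energy `H₀` in global coordinates. Reparametrizing an
`H`-geodesic of energy `H₀` so that it is run through on `[0, 1]` with initial velocity `v` makes
the strength of the potential `δ |v|²`, where `2 δ (H₀ - q(x)) = 1`. -/
theorem hExpGraph_iff [CompactSpace M] (h : IsGlobalCoordinate f E) (hn : 2 ≤ n)
    (hr : Represents g q E n m r) (hq : MDifferentiable (𝓡∂ d) 𝓘(ℝ, ℝ) q) {H₀ : ℝ} {x y : M}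
    (hH : q x < H₀) {v : TangentSpace (𝓡∂ d) x} :
    HExpGraph g q H₀ x v y ↔ Joins (accel m r) (range E) (E x) (pushVec E x v)
      (1 / (2 * (H₀ - q x)) * m (E x) (pushVec E x v) (pushVec E x v)) (E y) := by
  have hmech := hr.isMechanical hn
  have hH' : 0 < 2 * (H₀ - q x) := by linarith
  have hHne : H₀ - q x ≠ 0 := (sub_pos.2 hH).ne'
  have hpush0 : pushVec E x 0 = 0 := map_zero (mfderiv (𝓡∂ d) 𝓘(ℝ, Coord d) E x)
  have hpush : ∀ (t : ℝ) (ξ : TangentSpace (𝓡∂ d) x), pushVec E x (t • ξ) = t • pushVec E x ξ :=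
    fun t ξ => map_smul (mfderiv (𝓡∂ d) 𝓘(ℝ, Coord d) E x) t ξ
  have hgeo : ∀ (t : ℝ) (ξ : TangentSpace (𝓡∂ d) x), 0 < t →
      ((∃ γ : ℝ → M, IsHGeodesic g q t γ ∧ StartsAt x ξ t γ ∧ γ t = y) ↔
      ∃ c c' : ℝ → Coord d, IsTrajectory (accel m r) 1 t c c' ∧ (∀ s ∈ Icc 0 t, c s ∈ range E) ∧
        c 0 = E x ∧ c' 0 = pushVec E x ξ ∧ c t = E y) := by
    intro t ξ ht
    have h1 := hr.exists_isHGeodesic_iff h hn hq ht (τ := 1) (x := x) (y := y) (ξ := ξ)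
    simp only [one_mul] at h1
    exact h1
  constructor
  · rintro ⟨t, ξ, hξ, rfl, ⟨rfl, rfl⟩ | ⟨ht, hγ⟩⟩
    · rw [zero_smul, hpush0]
      exact (hr.joins_zero_vec_iff h hn).2 rfl
    · obtain ⟨c, c', hc, hcD, hc0, hc0', hct⟩ := (hgeo t ξ ht).1 hγ
      have hen : g.inner x ξ ξ = 2 * (H₀ - q x) := by
        rw [energy] at hξ; linarith
      have hτ : 1 / (2 * (H₀ - q x)) * m (E x) (pushVec E x (t • ξ)) (pushVec E x (t • ξ))
          = t ^ 2 * 1 := by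
        rw [hpush]
        simp only [map_smul, smul_apply, smul_eq_mul]
        rw [hr.metric_apply, hen]
        field_simp
      rw [hτ, hpush]
      refine ⟨_, _, hc.rescale hmech.homogeneous ht.le (S := 1) (by simp), fun s hs => ?_,
        by simpa using hc0, by simp [hc0'], by simpa using hct⟩
      exact hcD _ ⟨mul_nonneg ht.le hs.1, mul_le_of_le_one_right ht.le hs.2⟩
  · intro hj
    by_cases hv : v = 0
    · subst hv
      rw [hpush0] at hj
      have hy := h.injective ((hr.joins_zero_vec_iff h hn).1 hj)
      -- Some vector of energy `H₀` is needed.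
      obtain ⟨ζ, hζ⟩ : ∃ ζ : TangentSpace (𝓡∂ d) x, ζ ≠ 0 :=
        ⟨(EuclideanSpace.single (0 : Fin d) (1 : ℝ) : Coord d), by
          intro h0
          have h1 : (EuclideanSpace.single (0 : Fin d) (1 : ℝ) : Coord d) = 0 := h0
          simp at h1⟩
      have hζp := g.pos x ζ hζ
      refine ⟨0, Real.sqrt (2 * (H₀ - q x) / g.inner x ζ ζ) • ζ, ?_, by rw [zero_smul],
        Or.inl ⟨rfl, hy⟩⟩
      rw [energy]
      simp only [map_smul, smul_apply, smul_eq_mul]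
      rw [← mul_assoc, Real.mul_self_sqrt (by positivity), div_mul_cancel₀ _ hζp.ne']
      ring
    · have hvp := g.pos x v hv
      rw [hr.metric_apply] at hj
      set τ := 1 / (2 * (H₀ - q x)) * g.inner x v v with hτdef
      have hτ : 0 < τ := by positivity
      have ht : 0 < Real.sqrt τ := Real.sqrt_pos.2 hτ
      have ht2 : (Real.sqrt τ)⁻¹ ^ 2 * τ = 1 := by
        rw [inv_pow, Real.sq_sqrt hτ.le, inv_mul_cancel₀ hτ.ne']
      obtain ⟨c, c', hc, hcD, hc0, hc0', hc1⟩ := hj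
      refine ⟨Real.sqrt τ, (Real.sqrt τ)⁻¹ • v, ?_, ?_, Or.inr ⟨ht, (hgeo _ _ ht).2 ?_⟩⟩
      · rw [energy]
        simp only [map_smul, smul_apply, smul_eq_mul]
        rw [← mul_assoc, ← pow_two]
        have h1 : g.inner x v v = 2 * (H₀ - q x) * τ := by
          rw [hτdef]; field_simp
        rw [h1]
        have h2 : (Real.sqrt τ)⁻¹ ^ 2 * (2 * (H₀ - q x) * τ) = 2 * (H₀ - q x) := by
          rw [mul_left_comm, ht2, mul_one]
        rw [h2]
        ring
      · rw [smul_inv_smul₀ ht.ne']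
      · have h1 := hc.rescale hmech.homogeneous (inv_nonneg.2 ht.le) (S := Real.sqrt τ)
          (by rw [inv_mul_cancel₀ ht.ne'])
        rw [ht2] at h1
        refine ⟨_, _, h1, fun s hs => ?_, by simpa using hc0, by simp [hc0', hpush],
          by simpa [inv_mul_cancel₀ ht.ne'] using hc1⟩
        refine hcD _ ⟨mul_nonneg (inv_nonneg.2 ht.le) hs.1, ?_⟩
        rw [inv_mul_le_iff₀ ht, mul_one]
        exact hs.2

end Represents

end Graphs

/-! ### The boundary in global coordinates -/

section Boundary

variable {d : ℕ} [NeZero d] {M : Type*} [TopologicalSpace M]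
  [ChartedSpace (EuclideanHalfSpace d) M] [IsManifold (𝓡∂ d) ∞ M]
  {f : Coord d → M} {E : M → Coord d} {g : Metric d M} {q : M → ℝ} {n : ℕ}
  {m : Coord d → Coord d →L[ℝ] Coord d →L[ℝ] ℝ} {r : Coord d → ℝ}

omit [IsManifold (𝓡∂ d) ∞ M] in
lemma extChartAt_nonneg {x₀ y : M} :
    0 ≤ extChartAt (𝓡∂ d) x₀ y 0 := by
  have : extChartAt (𝓡∂ d) x₀ y ∈ range (𝓡∂ d) := ⟨chartAt _ x₀ y, rfl⟩
  rwa [range_modelWithCornersEuclideanHalfSpace] at this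

lemma mem_boundary_iff {x₀ y : M} (hy : y ∈ (extChartAt (𝓡∂ d) x₀).source) :
    y ∈ (𝓡∂ d).boundary M ↔ extChartAt (𝓡∂ d) x₀ y 0 = 0 := by
  have hy' : y ∈ (chartAt (EuclideanHalfSpace d) x₀).source := by rwa [← extChartAt_source (𝓡∂ d)]
  have h1 : (𝓡∂ d).IsInteriorPoint y ↔ 0 < extChartAt (𝓡∂ d) x₀ y 0 := by
    rw [ModelWithCorners.isInteriorPoint_iff_of_mem_atlas (I := 𝓡∂ d) (n := ∞) (by simp)
      (chart_mem_atlas _ x₀) hy',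
      ((chartAt (EuclideanHalfSpace d) x₀).extend_target_eventuallyEq hy').mem_interior_iff,
      interior_range_modelWithCornersEuclideanHalfSpace]
    rfl
  show (𝓡∂ d).IsBoundaryPoint y ↔ _
  rw [(𝓡∂ d).isBoundaryPoint_iff_not_isInteriorPoint, h1, not_lt]
  exact ⟨fun h => le_antisymm h extChartAt_nonneg, fun h => h.le⟩

/-- A function that vanishes on the boundary of the half-space, transported by `chartRep E x`: its
first and second derivatives in directions tangent to the boundary. -/
lemma IsGlobalCoordinate.fderiv_of_vanishing (h : IsGlobalCoordinate f E) {x : M}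
    (hx : x ∈ (𝓡∂ d).boundary M) {ρ : Coord d → ℝ} (hρ : ContDiffAt ℝ 2 ρ (E x))
    (hv : ∀ᶠ z in 𝓝[range (𝓡∂ d)] extChartAt (𝓡∂ d) x x, z 0 = 0 → ρ (chartRep E x z) = 0)
    {ξ : TangentSpace (𝓡∂ d) x} (hξ : transversal x ξ = 0) :
    fderiv ℝ ρ (E x) (pushVec E x ξ) = 0 ∧
      fderiv ℝ (fderiv ℝ ρ) (E x) (pushVec E x ξ) (pushVec E x ξ)
        + fderiv ℝ ρ (E x) (chartDeriv₂ E x (extChartAt (𝓡∂ d) x x) ξ ξ) = 0 := by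
  set z₀ := extChartAt (𝓡∂ d) x x with hz₀
  have hz00 : z₀ 0 = 0 := (mem_boundary_iff (mem_extChartAt_source x)).1 hx
  have hz₀t : z₀ ∈ (extChartAt (𝓡∂ d) x).target := mem_extChartAt_target x
  have hEx : chartRep E x z₀ = E x := chartRep_extChartAt E (mem_extChartAt_source x)
  rw [h.pushVec_eq, ← hEx]
  rw [← hEx] at hρ
  obtain ⟨ξ, rfl⟩ : ∃ ξ' : Coord d, ξ' = ξ := ⟨ξ, rfl⟩
  replace hξ : ξ 0 = 0 := hξ
  let b : ℝ → Coord d := fun s => z₀ + s • ξ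
  have hb : ∀ s, HasDerivAt b ξ s := fun s => by
    simpa [b] using ((hasDerivAt_id s).smul_const ξ).const_add z₀
  have hb0 : b 0 = z₀ := by simp [b]
  have hbr : ∀ s, b s ∈ range (𝓡∂ d) := fun s => by
    rw [range_modelWithCornersEuclideanHalfSpace]
    simp [b, hz00, hξ]
  have hbt : Tendsto b (𝓝 0) (𝓝[range (𝓡∂ d)] z₀) := by
    refine tendsto_nhdsWithin_iff.2 ⟨?_, Eventually.of_forall hbr⟩
    have := (hb 0).continuousAt.tendsto
    rwa [hb0] at this
  have htar : ∀ᶠ s in 𝓝 (0 : ℝ), b s ∈ (extChartAt (𝓡∂ d) x).target :=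
    hbt.eventually (extChartAt_target_mem_nhdsWithin x)
  let c : ℝ → Coord d := fun s => chartRep E x (b s)
  let c' : ℝ → Coord d := fun s => chartDeriv E x (b s) ξ
  have hc : ∀ᶠ s in 𝓝 (0 : ℝ), HasDerivAt c (c' s) s := by
    filter_upwards [htar] with s hs
    exact (h.hasFDerivWithinAt_chartRep hs).comp_hasDerivAt s (hb s) (Eventually.of_forall hbr)
  have hc' : HasDerivAt c' (chartDeriv₂ E x z₀ ξ ξ) 0 := by
    have h1 := h.hasFDerivWithinAt_chartDeriv hz₀t
    rw [← hb0] at h1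
    have h2 := (h1.comp_hasDerivAt 0 (hb 0) (Eventually.of_forall hbr)).clm_apply
      (hasDerivAt_const (0 : ℝ) ξ)
    simpa [hb0] using h2
  have hc0 : c 0 = chartRep E x z₀ := by simp only [c, hb0]
  have hc0' : c' 0 = chartDeriv E x z₀ ξ := by simp only [c', hb0]
  have hρd : ∀ᶠ z in 𝓝 (chartRep E x z₀), DifferentiableAt ℝ ρ z :=
    (hρ.eventually (by simp)).mono fun z hz => hz.differentiableAt two_ne_zero
  have hct : Tendsto c (𝓝 0) (𝓝 (chartRep E x z₀)) := by
    have := hc.self_of_nhds.continuousAt.tendsto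
    rwa [hc0] at this
  have hψ : ∀ᶠ s in 𝓝 (0 : ℝ), HasDerivAt (ρ ∘ c) (fderiv ℝ ρ (c s) (c' s)) s := by
    filter_upwards [hc, hct.eventually hρd] with s hs hρs
    exact hρs.hasFDerivAt.comp_hasDerivAt s hs
  have hzero : (ρ ∘ c) =ᶠ[𝓝 0] fun _ => 0 := by
    filter_upwards [hbt.eventually hv] with s hs
    exact hs (by simp [b, hz00, hξ])
  have hfirst : (fun s => fderiv ℝ ρ (c s) (c' s)) =ᶠ[𝓝 0] fun _ => 0 := by
    filter_upwards [hψ, hzero.eventuallyEq_nhds] with s h1 h2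
    rw [← h1.deriv, h2.deriv_eq, deriv_const]
  have hρ' : DifferentiableAt ℝ (fderiv ℝ ρ) (c 0) := by
    rw [hc0]
    exact (hρ.fderiv_right (m := 1) (by norm_num)).differentiableAt one_ne_zero
  have hsecond := (hρ'.hasFDerivAt.comp_hasDerivAt 0 hc.self_of_nhds).clm_apply hc'
  have h1 := hfirst.self_of_nhds
  have h2 := hsecond.deriv
  have h3 : deriv (fun s => fderiv ℝ ρ (c s) (c' s)) 0 = 0 := by
    rw [hfirst.deriv_eq, deriv_const]
  simp only [Function.comp_apply, hc0, hc0'] at h1 h2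
  exact ⟨h1, h2.symm.trans h3⟩

/-- A function that is nonnegative on the half-space and vanishes on its boundary, transported by
`chartRep E x`, has a differential at boundary points that is a nonnegative multiple of the
transversal component. -/
lemma IsGlobalCoordinate.exists_fderiv_eq (h : IsGlobalCoordinate f E) {x : M}
    (hx : x ∈ (𝓡∂ d).boundary M) {ρ : Coord d → ℝ} (hρ : ContDiffAt ℝ 2 ρ (E x))
    (hv : ∀ᶠ z in 𝓝[range (𝓡∂ d)] extChartAt (𝓡∂ d) x x, z 0 = 0 → ρ (chartRep E x z) = 0)
    (hnn : ∀ᶠ z in 𝓝[range (𝓡∂ d)] extChartAt (𝓡∂ d) x x, 0 ≤ ρ (chartRep E x z)) :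
    ∃ k : ℝ, 0 ≤ k ∧ ∀ w : TangentSpace (𝓡∂ d) x,
      fderiv ℝ ρ (E x) (pushVec E x w) = k * transversal x w := by
  set z₀ := extChartAt (𝓡∂ d) x x with hz₀
  have hz00 : z₀ 0 = 0 := (mem_boundary_iff (mem_extChartAt_source x)).1 hx
  have hz₀t : z₀ ∈ (extChartAt (𝓡∂ d) x).target := mem_extChartAt_target x
  have hEx : chartRep E x z₀ = E x := chartRep_extChartAt E (mem_extChartAt_source x)
  let e : Coord d := EuclideanSpace.single 0 1
  have he : e 0 = 1 := by simp [e]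
  have hp : ∀ w : Coord d, pushVec E x w = chartDeriv E x z₀ w := fun w => h.pushVec_eq x w
  refine ⟨fderiv ℝ ρ (E x) (chartDeriv E x z₀ e), ?_, fun w => ?_⟩
  · let b : ℝ → Coord d := fun s => z₀ + s • e
    have hb0 : b 0 = z₀ := by simp [b]
    have hb' : ∀ s, HasDerivAt b e s := fun s => by
      simpa [b] using ((hasDerivAt_id s).smul_const e).const_add z₀
    have hb : HasDerivWithinAt b e (Ici 0) 0 := (hb' 0).hasDerivWithinAt
    have hbr : MapsTo b (Ici 0) (range (𝓡∂ d)) := fun s hs => by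
      rw [range_modelWithCornersEuclideanHalfSpace]
      simpa [b, hz00, he] using hs
    have h1 := h.hasFDerivWithinAt_chartRep hz₀t
    rw [← hb0] at h1
    have h2 := h1.comp_hasDerivWithinAt 0 hb hbr
    have hρd : HasFDerivAt ρ (fderiv ℝ ρ (E x)) ((chartRep E x ∘ b) 0) := by
      rw [Function.comp_apply, hb0, hEx]
      exact (hρ.differentiableAt two_ne_zero).hasFDerivAt
    have h3 := hρd.comp_hasDerivWithinAt 0 h2
    rw [hb0] at h3
    have h4 := (hasDerivWithinAt_iff_tendsto_slope' (by simp)).1 (h3.mono Ioi_subset_Ici_self)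
    refine ge_of_tendsto h4 ?_
    have hbt : Tendsto b (𝓝[>] 0) (𝓝[range (𝓡∂ d)] z₀) := by
      refine tendsto_nhdsWithin_iff.2 ⟨?_, ?_⟩
      · have := (hb.mono Ioi_subset_Ici_self).continuousWithinAt.tendsto
        rwa [hb0] at this
      · filter_upwards [self_mem_nhdsWithin] with s hs
        exact hbr (Ioi_subset_Ici_self hs)
    have hv0 : ρ (chartRep E x (b 0)) = 0 := by
      rw [hb0]
      exact hv.self_of_nhdsWithin (extChartAt_target_subset_range x hz₀t) hz00
    filter_upwards [hbt.eventually hnn, self_mem_nhdsWithin] with s hs hs0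
    rw [slope_def_field]
    simp only [Function.comp_apply, hv0, sub_zero]
    exact div_nonneg hs (le_of_lt hs0)
  · obtain ⟨w, rfl⟩ : ∃ w' : Coord d, w' = w := ⟨w, rfl⟩
    have hw : (w - w 0 • e) 0 = 0 := by simp [he]
    have h1 := (h.fderiv_of_vanishing hx hρ hv (ξ := w - w 0 • e) hw).1
    replace h1 : fderiv ℝ ρ (E x) (chartDeriv E x z₀ (w - w 0 • e)) = 0 :=
      (congrArg _ (hp _)).symm.trans h1
    rw [map_sub, map_sub, map_smul, map_smul, sub_eq_zero, smul_eq_mul] at h1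
    exact (congrArg _ (hp w)).trans (h1.trans (mul_comm _ _))

namespace Represents

/-- The second fundamental form in terms of a function `ρ` that vanishes on the boundary and
increases inwards: up to the factor `k`, it is minus the second derivative of `ρ` along a
trajectory that is tangent to the boundary. -/
theorem secondFundamentalForm_eq (h : IsGlobalCoordinate f E) (hn : n ≠ 0)
    (hr : Represents g q E n m r) {x : M} (hx : x ∈ (𝓡∂ d).boundary M) {ρ : Coord d → ℝ}
    (hρ : ContDiffAt ℝ 2 ρ (E x))
    (hv : ∀ᶠ z in 𝓝[range (𝓡∂ d)] extChartAt (𝓡∂ d) x x, z 0 = 0 → ρ (chartRep E x z) = 0)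
    {l : ℝ} (hρl : ∀ w : TangentSpace (𝓡∂ d) x,
      fderiv ℝ ρ (E x) (pushVec E x w) = l * transversal x w)
    {ν : TangentSpace (𝓡∂ d) x} (hν : IsInwardUnitNormal g x ν)
    {ξ : TangentSpace (𝓡∂ d) x} (hξ : transversal x ξ = 0) (τ : ℝ) :
    fderiv ℝ (fderiv ℝ ρ) (E x) (pushVec E x ξ) (pushVec E x ξ)
        + fderiv ℝ ρ (E x) (accel m r (E x) (pushVec E x ξ) τ)
      = -(l * transversal x ν * (secondFundamentalForm g x ν ξ + τ * differential q x ν)) := by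
  have hz₀t : extChartAt (𝓡∂ d) x x ∈ (extChartAt (𝓡∂ d) x).target := mem_extChartAt_target x
  have hEx : chartRep E x (extChartAt (𝓡∂ d) x x) = E x :=
    chartRep_extChartAt E (mem_extChartAt_source x)
  have h2 := (h.fderiv_of_vanishing hx hρ hv (ξ := ξ) hξ).2
  -- The differential of `ρ` is a multiple of the inner product with the normal.
  have hgrad : ∀ a : Coord d,
      fderiv ℝ ρ (E x) a = l * transversal x ν * m (E x) a (pushVec E x ν) := by
    intro a
    obtain ⟨w, rfl⟩ := h.pushVec_surjective x a
    have hw : g.inner x ν w * transversal x ν = transversal x w := by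
      have h3 : transversal x (transversal x ν • w - transversal x w • ν) = 0 := by
        have : ∀ a b : Coord d, (a 0 • b - b 0 • a) 0 = 0 := fun a b => by
          simp [mul_comm]
        exact this ν w
      have h4 := hν.orthogonal _ h3
      rw [map_sub, map_smul, map_smul, hν.unit] at h4
      simp only [smul_eq_mul] at h4
      linarith
    rw [hr.metric_apply, g.symm, hρl w]
    rw [← hw]
    ring
  have hΛ : secondFundamentalForm g x ν ξ
      = christoffelForm m (E x) (pushVec E x ξ) (pushVec E x ν)
        + m (E x) (chartDeriv₂ E x (extChartAt (𝓡∂ d) x x) ξ ξ) (pushVec E x ν) := by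
    rw [h.pushVec_eq, h.pushVec_eq, ← hEx]
    exact hr.christoffel_eq h hn hz₀t ξ ν
  rw [hgrad (chartDeriv₂ E x _ ξ ξ)] at h2
  rw [hgrad (accel m r (E x) _ τ), metric_accel hr.pos, hr.differential_eq h hn, hΛ]
  linear_combination h2

end Represents

/-- The boundary function given by the transversal coordinate of a chart. -/
theorem IsGlobalCoordinate.exists_boundaryFunction (h : IsGlobalCoordinate f E) (x : M) :
    ∃ ρ : Coord d → ℝ, ContDiffAt ℝ 2 ρ (E x) ∧ (∀ᶠ z in 𝓝 (E x), z ∈ range E ↔ 0 ≤ ρ z) ∧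
      ∀ᶠ y in 𝓝 x, ρ (E y) = extChartAt (𝓡∂ d) x y 0 := by
  obtain ⟨S, hS, hSE, hSD⟩ := h.exists_chart_extension x (n := 2) two_ne_zero
  refine ⟨fun z => S z 0, ?_, hSD, hSE.mono fun y hy => by
    show S (E y) 0 = _
    rw [hy]⟩
  exact (EuclideanSpace.proj (0 : Fin d) : Coord d →L[ℝ] ℝ).contDiff.contDiffAt.comp (E x)
    (by exact_mod_cast hS)

lemma IsGlobalCoordinate.mem_nhds_of_interior (h : IsGlobalCoordinate f E) {x : M}
    (hx : x ∉ (𝓡∂ d).boundary M) : range E ∈ 𝓝 (E x) := by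
  obtain ⟨ρ, hρ, hρD, hρE⟩ := h.exists_boundaryFunction x
  have h0 : 0 < ρ (E x) := by
    rw [hρE.self_of_nhds]
    exact lt_of_le_of_ne extChartAt_nonneg fun h0 =>
      hx ((mem_boundary_iff (mem_extChartAt_source x)).2 h0.symm)
  filter_upwards [hρD, hρ.continuousAt.eventually (lt_mem_nhds h0)] with z h1 h2
  exact h1.2 h2.le

omit [IsManifold (𝓡∂ d) ∞ M] in
/-- Statements about points near `x` in `M`, read in the chart around `x`. -/
lemma eventually_chart {x : M} {P : M → Prop} (hP : ∀ᶠ y in 𝓝 x, P y) :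
    ∀ᶠ z in 𝓝[range (𝓡∂ d)] extChartAt (𝓡∂ d) x x,
      z ∈ (extChartAt (𝓡∂ d) x).target ∧ P ((extChartAt (𝓡∂ d) x).symm z) := by
  have h1 : Tendsto (extChartAt (𝓡∂ d) x).symm (𝓝 (extChartAt (𝓡∂ d) x x)) (𝓝 x) := by
    have := (continuousAt_extChartAt_symm (I := 𝓡∂ d) x).tendsto
    rwa [extChartAt_to_inv] at this
  have h2 : ∀ᶠ z in 𝓝[range (𝓡∂ d)] extChartAt (𝓡∂ d) x x, z ∈ (extChartAt (𝓡∂ d) x).target :=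
    extChartAt_target_mem_nhdsWithin x
  exact h2.and (mem_nhdsWithin_of_mem_nhds (h1.eventually hP))

/-- At a boundary point, the transversal coordinate of the chart, extended to coordinate space, has
the transversal component as its differential. -/
lemma IsGlobalCoordinate.fderiv_boundaryFunction (h : IsGlobalCoordinate f E) {x : M}
    {ρ : Coord d → ℝ} (hρ : DifferentiableAt ℝ ρ (E x))
    (hρE : ∀ᶠ y in 𝓝 x, ρ (E y) = extChartAt (𝓡∂ d) x y 0) (w : TangentSpace (𝓡∂ d) x) :
    fderiv ℝ ρ (E x) (pushVec E x w) = transversal x w := by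
  set z₀ := extChartAt (𝓡∂ d) x x with hz₀
  have hz₀t : z₀ ∈ (extChartAt (𝓡∂ d) x).target := mem_extChartAt_target x
  have hEx : chartRep E x z₀ = E x := chartRep_extChartAt E (mem_extChartAt_source x)
  have hρd : HasFDerivAt ρ (fderiv ℝ ρ (E x)) (chartRep E x z₀) := by
    rw [hEx]
    exact hρ.hasFDerivAt
  have h1 := hρd.comp_hasFDerivWithinAt z₀ (h.hasFDerivWithinAt_chartRep hz₀t)
  have h2 : HasFDerivWithinAt (fun z : Coord d => z 0)
      (EuclideanSpace.proj (0 : Fin d) : Coord d →L[ℝ] ℝ) (range (𝓡∂ d)) z₀ :=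
    (EuclideanSpace.proj (0 : Fin d) : Coord d →L[ℝ] ℝ).hasFDerivAt.hasFDerivWithinAt
  have hev : (fun z : Coord d => z 0) =ᶠ[𝓝[range (𝓡∂ d)] z₀] ρ ∘ chartRep E x := by
    filter_upwards [eventually_chart hρE] with z hz
    have h3 := hz.2
    rw [(extChartAt (𝓡∂ d) x).right_inv hz.1] at h3
    exact h3.symm
  have h3 := HasFDerivWithinAt.congr_of_eventuallyEq h2 hev.symm
    (hev.symm.self_of_nhdsWithin (extChartAt_target_subset_range x hz₀t))
  have h4 := (uniqueDiffOn_halfSpace z₀ (extChartAt_target_subset_range x hz₀t)).eq h1 h3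
  have h5 : pushVec E x w = chartDeriv E x z₀ w := h.pushVec_eq x w
  rw [h5]
  exact DFunLike.congr_fun h4 (show Coord d from w)

namespace Represents

lemma exists_isInwardUnitNormal (h : IsGlobalCoordinate f E) (hr : Represents g q E n m r)
    (x : M) : ∃ ν, IsInwardUnitNormal g x ν := by
  obtain ⟨ρ, hρ, -, hρE⟩ := h.exists_boundaryFunction x
  have hρ' := h.fderiv_boundaryFunction (hρ.differentiableAt two_ne_zero) hρE
  obtain ⟨e, he⟩ : ∃ e : TangentSpace (𝓡∂ d) x, transversal x e = 1 :=
    ⟨(EuclideanSpace.single 0 1 : Coord d), by simp [transversal]⟩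
  -- The gradient of the transversal coordinate.
  let a : Coord d := (m (E x)).inverse (fderiv ℝ ρ (E x))
  have ha : m (E x) a = fderiv ℝ ρ (E x) :=
    (isInvertible_of_pos (hr.pos (E x))).self_apply_inverse _
  obtain ⟨n₀, hn₀⟩ := h.pushVec_surjective x a
  have hn₀' : ∀ w, g.inner x n₀ w = transversal x w := fun w => by
    rw [← hr.metric_apply, hn₀, ha, hρ']
  have hpos : 0 < transversal x n₀ := by
    rw [← hn₀', ← hr.metric_apply, hn₀]
    refine hr.pos _ _ fun h0 => ?_
    have := hρ' e
    rw [← ha, h0, map_zero, he] at this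
    simp at this
  set s := transversal x n₀ with hs
  have hsq : 0 < Real.sqrt s := Real.sqrt_pos.2 hpos
  have htr : ∀ (c : ℝ) (w : TangentSpace (𝓡∂ d) x), transversal x (c • w) = c * transversal x w :=
    fun c w => rfl
  refine ⟨(Real.sqrt s)⁻¹ • n₀, ?_, ?_, ?_⟩
  · rw [htr]
    positivity
  · rw [map_smul, map_smul, smul_apply, hn₀', ← hs, smul_eq_mul, smul_eq_mul]
    nth_rewrite 3 [← Real.mul_self_sqrt hpos.le]
    field_simp
  · intro w hw
    rw [map_smul, smul_apply, hn₀', hw, smul_zero]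

/-- The transversal coordinate of a chart at a boundary point, extended to coordinate space, is a
convex boundary function. -/
lemma isConvexBoundaryFunction (h : IsGlobalCoordinate f E) (hn : n ≠ 0)
    (hr : Represents g q E n m r) (hg : IsStrictlyConvexBoundary g) {x : M}
    (hx : x ∈ (𝓡∂ d).boundary M) {ρ : Coord d → ℝ} (hρ : ContDiffAt ℝ 2 ρ (E x))
    (hρD : ∀ᶠ z in 𝓝 (E x), z ∈ range E ↔ 0 ≤ ρ z)
    (hρE : ∀ᶠ y in 𝓝 x, ρ (E y) = extChartAt (𝓡∂ d) x y 0) :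
    IsConvexBoundaryFunction (accel m r) (range E) (E x) ρ := by
  have hρ' := h.fderiv_boundaryFunction (hρ.differentiableAt two_ne_zero) hρE
  have hv : ∀ᶠ z in 𝓝[range (𝓡∂ d)] extChartAt (𝓡∂ d) x x,
      z 0 = 0 → ρ (chartRep E x z) = 0 := by
    filter_upwards [eventually_chart hρE] with z hz hz0
    have h3 := hz.2
    rw [(extChartAt (𝓡∂ d) x).right_inv hz.1, hz0] at h3
    exact h3
  obtain ⟨ν, hν⟩ := hr.exists_isInwardUnitNormal h x
  refine ⟨hρ, ?_, hρD, fun u hu hu0 => ?_⟩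
  · rw [hρE.self_of_nhds]
    exact (mem_boundary_iff (mem_extChartAt_source x)).1 hx
  · obtain ⟨ξ, rfl⟩ := h.pushVec_surjective x u
    rw [hρ'] at hu0
    have hξ : ξ ≠ 0 := by
      rintro rfl
      exact hu (map_zero (mfderiv (𝓡∂ d) 𝓘(ℝ, Coord d) E x))
    rw [hr.secondFundamentalForm_eq h hn hx hρ hv (l := 1) (fun w => by rw [hρ', one_mul]) hν hu0,
      zero_mul, add_zero, one_mul, neg_lt_zero]
    exact mul_pos hν.inward (hg x hx ν hν ξ hu0 hξ)

/-- Strict convexity of the boundary in global coordinates. -/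
theorem isStrictlyConvexFor (h : IsGlobalCoordinate f E) (hn : n ≠ 0)
    (hr : Represents g q E n m r) (hg : IsStrictlyConvexBoundary g) :
    IsStrictlyConvexFor (accel m r) (range E) := by
  rintro _ ⟨x, rfl⟩
  by_cases hx : x ∈ (𝓡∂ d).boundary M
  · obtain ⟨ρ, hρ, hρD, hρE⟩ := h.exists_boundaryFunction x
    exact Or.inr ⟨ρ, hr.isConvexBoundaryFunction h hn hg hx hρ hρD hρE⟩
  · exact Or.inl (h.mem_nhds_of_interior hx)

/-- Strict convexity in the presence of a potential, near a given point and for fast directions. -/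
lemma exists_eventually_pos (h : IsGlobalCoordinate f E) (hn : 2 ≤ n)
    (hr : Represents g q E n m r) (hg : IsStrictlyConvexBoundary g) (x : M) :
    ∃ η > 0, ∀ᶠ y in 𝓝 x, y ∈ (𝓡∂ d).boundary M → ∀ ν, IsInwardUnitNormal g y ν →
      ∀ ξ : TangentSpace (𝓡∂ d) y, transversal y ξ = 0 → ξ ≠ 0 →
        1 ≤ η * ‖pushVec E y ξ‖ ^ 2 →
        0 < secondFundamentalForm g y ν ξ + differential q y ν := by
  have hn0 : n ≠ 0 := by omega
  have hsrc : ∀ᶠ y in 𝓝 x, y ∈ (extChartAt (𝓡∂ d) x).source := extChartAt_source_mem_nhds x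
  obtain ⟨ρ, hρ, hρD, hρE⟩ := h.exists_boundaryFunction x
  by_cases hx : x ∈ (𝓡∂ d).boundary M
  swap
  -- There are no boundary points near an interior point.
  · refine ⟨1, one_pos, ?_⟩
    have hpos : 0 < extChartAt (𝓡∂ d) x x 0 := lt_of_le_of_ne extChartAt_nonneg fun h0 =>
      hx ((mem_boundary_iff (mem_extChartAt_source x)).2 h0.symm)
    have hcont : ContinuousAt (fun y => extChartAt (𝓡∂ d) x y 0) x :=
      (EuclideanSpace.proj (0 : Fin d) : Coord d →L[ℝ] ℝ).continuous.continuousAt.comp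
        (continuousAt_extChartAt x)
    filter_upwards [hsrc, hcont.eventually (lt_mem_nhds hpos)] with y hy hy0 hyb
    exact absurd ((mem_boundary_iff hy).1 hyb) hy0.ne'
  have hmech := hr.isMechanical hn
  obtain ⟨s, hs, η, hη, H⟩ := (hr.isConvexBoundaryFunction h hn0 hg hx hρ hρD hρE).exists_uniform
    hmech.contDiff_acc.continuous hmech.homogeneous
  refine ⟨η, hη, ?_⟩
  have hball : ∀ᶠ y in 𝓝 x, E y ∈ Metric.ball (E x) s :=
    h.contMDiff.continuous.continuousAt.eventually (Metric.ball_mem_nhds _ hs)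
  have hval : ∀ᶠ y in 𝓝 x, (y ∈ (𝓡∂ d).boundary M → ρ (E y) = 0) ∧ 0 ≤ ρ (E y) := by
    filter_upwards [hsrc, hρE] with y hy hyE
    rw [hyE]
    exact ⟨(mem_boundary_iff hy).1, extChartAt_nonneg⟩
  filter_upwards [hball, hval.eventually_nhds] with y hyb hyv hy ν hν ξ hξ hξ0 hle
  obtain ⟨hρy, -, hneg⟩ := H _ hyb
  have hchart := eventually_chart (d := d) hyv
  have hv : ∀ᶠ z in 𝓝[range (𝓡∂ d)] extChartAt (𝓡∂ d) y y,
      z 0 = 0 → ρ (chartRep E y z) = 0 := by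
    filter_upwards [hchart] with z hz hz0
    refine hz.2.1 ((mem_boundary_iff ((extChartAt (𝓡∂ d) y).map_target hz.1)).2 ?_)
    rw [(extChartAt (𝓡∂ d) y).right_inv hz.1, hz0]
  obtain ⟨l, hl, hρl⟩ := h.exists_fderiv_eq hy hρy hv (hchart.mono fun z hz => hz.2.2)
  have h1 := hneg (pushVec E y ξ) 1
    (fun h0 => hξ0 (h.pushVec_injective y (h0.trans
      (map_zero (mfderiv (𝓡∂ d) 𝓘(ℝ, Coord d) E y)).symm)))
    (by rwa [abs_one]) (by rw [hρl, hξ, mul_zero])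
  rw [hr.secondFundamentalForm_eq h hn0 hy hρy hv hρl hν hξ, neg_lt_zero, one_mul] at h1
  exact pos_of_mul_pos_right h1 (mul_nonneg hl hν.inward.le)

/-- At high energy the boundary is strictly convex: the second fundamental form grows quadratically
with the speed. -/
theorem exists_isStrictlyConvexBoundaryAtEnergy [CompactSpace M] (h : IsGlobalCoordinate f E)
    (hn : 2 ≤ n) (hr : Represents g q E n m r) (hq : Continuous q)
    (hg : IsStrictlyConvexBoundary g) :
    ∃ E₀ : ℝ, ∀ H₀, E₀ ≤ H₀ → IsStrictlyConvexBoundaryAtEnergy g q H₀ := by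
  obtain ⟨η, hη, H⟩ : ∃ η > 0, ∀ y ∈ (univ : Set M), y ∈ (𝓡∂ d).boundary M →
      ∀ ν, IsInwardUnitNormal g y ν → ∀ ξ : TangentSpace (𝓡∂ d) y, transversal y ξ = 0 → ξ ≠ 0 →
        1 ≤ η * ‖pushVec E y ξ‖ ^ 2 →
        0 < secondFundamentalForm g y ν ξ + differential q y ν := by
    refine isCompact_univ.induction_on (p := fun S : Set M => ∃ η > 0, ∀ y ∈ S,
      y ∈ (𝓡∂ d).boundary M →
      ∀ ν, IsInwardUnitNormal g y ν → ∀ ξ : TangentSpace (𝓡∂ d) y, transversal y ξ = 0 → ξ ≠ 0 →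
        1 ≤ η * ‖pushVec E y ξ‖ ^ 2 →
        0 < secondFundamentalForm g y ν ξ + differential q y ν) ?_ ?_ ?_ ?_
    · exact ⟨1, one_pos, fun y hy => absurd hy (notMem_empty y)⟩
    · rintro S T hST ⟨η, hη, H⟩
      exact ⟨η, hη, fun y hy => H y (hST hy)⟩
    · rintro S T ⟨η₁, hη₁, H₁⟩ ⟨η₂, hη₂, H₂⟩
      refine ⟨min η₁ η₂, lt_min hη₁ hη₂, ?_⟩
      rintro y (hy | hy) hyb ν hν ξ hξ hξ0 hle
      · exact H₁ y hy hyb ν hν ξ hξ hξ0 (hle.trans (by gcongr; exact min_le_left _ _))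
      · exact H₂ y hy hyb ν hν ξ hξ hξ0 (hle.trans (by gcongr; exact min_le_right _ _))
    · intro x _
      obtain ⟨η, hη, H⟩ := hr.exists_eventually_pos h hn hg x
      exact ⟨_, mem_nhdsWithin_of_mem_nhds H, η, hη, fun y hy => hy⟩
  obtain ⟨Q, hQ⟩ := isCompact_univ.exists_bound_of_continuousOn (f := q) hq.continuousOn
  obtain ⟨l, hl, L, hL, hb⟩ := (hr.isMechanical hn).exists_norm_bounds h.isCompact
  -- At energy `Q + L / η` and above the norm of `ξ` in coordinates is at least `1 / √η`.
  refine ⟨Q + L / η, fun H₀ hH x hx ν hν ξ hξ he => ?_⟩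
  have hqx : q x ≤ Q := (le_abs_self _).trans (hQ x (mem_univ x))
  have hnorm : 1 ≤ η * ‖pushVec E x ξ‖ ^ 2 := by
    have h1 := (hb (E x) ⟨x, rfl⟩ (pushVec E x ξ)).2
    rw [hr.metric_apply] at h1
    rw [energy] at he
    have h2 : L / η ≤ L * ‖pushVec E x ξ‖ ^ 2 := by
      have h3 : 0 < L / η := by positivity
      linarith
    rw [div_le_iff₀ hη] at h2
    have h3 : L * 1 ≤ L * (η * ‖pushVec E x ξ‖ ^ 2) := by linarith
    exact le_of_mul_le_mul_left h3 hL
  have hξ0 : ξ ≠ 0 := by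
    rintro rfl
    have h0 : pushVec E x 0 = 0 := map_zero (mfderiv (𝓡∂ d) 𝓘(ℝ, Coord d) E x)
    rw [h0, norm_zero] at hnorm
    norm_num at hnorm
  linarith [H x (mem_univ x) hx ν hν ξ hξ hξ0 hnorm]

end Represents

end Boundary

/-! ### Uniqueness of the end point -/

section Determinism

variable {V : Type} [NormedAddCommGroup V] [NormedSpace ℝ V] [FiniteDimensional ℝ V]
  {acc : V → V → ℝ → V} {m : V → V →L[ℝ] V →L[ℝ] ℝ} {q : V → ℝ} {D : Set V}

/-- The end point of a trajectory is determined by its initial values. -/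
lemma IsMechanical.joins_unique (h : IsMechanical acc m q) (hD : IsCompact D) {x v y y' : V} {δ : ℝ}
    (hy : Joins acc D x v (δ * m x v v) y) (hy' : Joins acc D x v (δ * m x v v) y') : y = y' := by
  obtain ⟨φ, U, K, C, fb⟩ := h.exists_isFlowBox hD (n := 1) le_rfl
    (by exact_mod_cast h.contDiff_acc) ‖v‖ (δ₁ := |δ| + 1) (by positivity)
  rw [← (fb.mem x v δ y le_rfl (by linarith) hy).2, (fb.mem x v δ y' le_rfl (by linarith) hy').2]

end Determinism

/-! ### Simple manifolds in global coordinates -/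

section Exponential

variable {d : ℕ} [NeZero d] {M : Type*} [TopologicalSpace M]
  [ChartedSpace (EuclideanHalfSpace d) M] [IsManifold (𝓡∂ d) ∞ M]
  {f : Coord d → M} {E : M → Coord d} {g : Metric d M} {q : M → ℝ} {n : ℕ}
  {m : Coord d → Coord d →L[ℝ] Coord d →L[ℝ] ℝ} {r : Coord d → ℝ}

lemma expGraph_expMap {x : M} {v : TangentSpace (𝓡∂ d) x} (hv : v ∈ expDomain g x) :
    ExpGraph g x v (expMap g x v) := by
  have hv' : ∃ y, ExpGraph g x v y := hv
  rw [expMap, dif_pos hv']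
  exact hv'.choose_spec

lemma hExpGraph_hExpMap {H₀ : ℝ} {x : M} {v : TangentSpace (𝓡∂ d) x}
    (hv : v ∈ hExpDomain g q H₀ x) : HExpGraph g q H₀ x v (hExpMap g q H₀ x v) := by
  have hv' : ∃ y, HExpGraph g q H₀ x v y := hv
  rw [hExpMap, dif_pos hv']
  exact hv'.choose_spec

/-- The inverse of one exponential map of a simple manifold is a global coordinate. -/
lemma IsSimple.exists_isGlobalCoordinate (hg : IsSimple g) (x : M) :
    ∃ (f : Coord d → M) (E : M → Coord d), IsGlobalCoordinate f E := by
  obtain ⟨hf, L, hL, hLf, hfL⟩ := hg.2 x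
  have hr : range L = expDomain g x := by
    ext v
    exact ⟨by rintro ⟨y, rfl⟩; exact (hfL y).1, fun hv => ⟨_, hLf v hv⟩⟩
  refine ⟨expMap g x, L, ?_, hL, fun y => (hfL y).2⟩
  rw [hr]
  exact hf

/-- The differential of a global coordinate at a point is a linear isomorphism. -/
lemma IsGlobalCoordinate.exists_pushVec_equiv (h : IsGlobalCoordinate f E) (x : M) :
    ∃ A : Coord d ≃L[ℝ] Coord d, ∀ v : Coord d, A v = pushVec E x v := by
  let A₀ : Coord d →L[ℝ] Coord d := chartDeriv E x (extChartAt (𝓡∂ d) x x)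
  have hA₀ : Function.Bijective A₀ := ⟨h.chartDeriv_injective (mem_extChartAt_target x),
    h.chartDeriv_surjective (mem_extChartAt_target x)⟩
  exact ⟨(LinearEquiv.ofBijective (A₀ : Coord d →ₗ[ℝ] Coord d) hA₀).toContinuousLinearEquiv,
    fun v => (h.pushVec_eq x v).symm⟩

namespace Represents

variable [CompactSpace M]

/-- A simple manifold in global coordinates. -/
theorem isSimpleRegion (h : IsGlobalCoordinate f E) (hn : 2 ≤ n) (hr : Represents g q E n m r)
    (hq : MDifferentiable (𝓡∂ d) 𝓘(ℝ, ℝ) q) (hg : IsSimple g) :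
    IsSimpleRegion (accel m r) m r (range E) where
  mech := hr.isMechanical hn
  isCompact := h.isCompact
  uniqueDiffOn := h.uniqueDiffOn
  convex := hr.isStrictlyConvexFor h (by omega) hg.1
  simple := by
    rintro _ ⟨x, rfl⟩
    obtain ⟨-, L, hL, hLf, hfL⟩ := hg.2 x
    obtain ⟨A, hA⟩ := h.exists_pushVec_equiv x
    refine ⟨fun z => A (L (f z)), ?_, ?_⟩
    · have h1 : ContMDiffOn 𝓘(ℝ, Coord d) 𝓘(ℝ, Coord d) ∞ (L ∘ f) (range E) :=
        hL.comp_contMDiffOn h.contMDiffOn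
      exact A.differentiable.comp_differentiableOn
        ((contMDiffOn_iff_contDiffOn.1 h1).differentiableOn (by simp))
    · rintro _ ⟨y, rfl⟩
      simp only [h.left_inv]
      refine ⟨?_, fun v hv => ?_⟩
      · rw [hA]
        refine (hr.expGraph_iff h hn hq).1 ?_
        have := expGraph_expMap (hfL y).1
        rwa [(hfL y).2] at this
      · obtain ⟨w, rfl⟩ := h.pushVec_surjective x v
        have hw := (hr.expGraph_iff h hn hq).2 hv
        have hdom : w ∈ expDomain g x := ⟨y, hw⟩
        -- The exponential map is single-valued.
        have hy : expMap g x w = y := by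
          have h1 := (hr.expGraph_iff h hn hq).1 (expGraph_expMap hdom)
          refine h.injective ((hr.isMechanical hn).joins_unique h.isCompact (x := E x)
            (v := pushVec E x w) (δ := 0) ?_ ?_)
          · rwa [zero_mul]
          · rwa [zero_mul]
        have hLw := hLf w hdom
        rw [hy] at hLw
        rw [hLw]
        exact (hA w).symm

/-- A differentiable inverse of the Hamiltonian exponential map, in global coordinates, makes it a
diffeomorphism. Smoothness of any finite order is obtained from a representation of higher order. -/
theorem isDiffeoOnto_hExpMap (h : IsGlobalCoordinate f E) (hn : 2 ≤ n)
    (hr : Represents g q E n m r) (hq : ContMDiff (𝓡∂ d) 𝓘(ℝ, ℝ) ∞ q) {H₀ : ℝ} {x : M}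
    (hH : q x < H₀) {L : Coord d → Coord d} (hL : DifferentiableOn ℝ L (range E))
    (hLj : ∀ y ∈ range E, Joins (accel m r) (range E) (E x) (L y)
        (1 / (2 * (H₀ - q x)) * m (E x) (L y) (L y)) y ∧
      ∀ v, Joins (accel m r) (range E) (E x) v (1 / (2 * (H₀ - q x)) * m (E x) v v) y → v = L y) :
    IsDiffeoOnto (hExpMap g q H₀ x) (hExpDomain g q H₀ x) := by
  have hqd : MDifferentiable (𝓡∂ d) 𝓘(ℝ, ℝ) q := hq.mdifferentiable (by simp)
  obtain ⟨A, hA⟩ := h.exists_pushVec_equiv x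
  set δ := 1 / (2 * (H₀ - q x)) with hδ
  -- Flow boxes of every order of smoothness and every velocity range.
  have hbox : ∀ (k : ℕ) (R : ℝ), ∃ (m' : Coord d → Coord d →L[ℝ] Coord d →L[ℝ] ℝ)
      (r' : Coord d → ℝ), Represents g q E (k + 2) m' r' ∧ ∃ φ U K C,
        IsFlowBox (accel m' r') m' (range E) (k + 1) R (|δ| + 1) φ U K C := by
    intro k R
    obtain ⟨m', r', hr'⟩ := h.exists_represents g hq (k + 2)
    refine ⟨m', r', hr', (hr'.isMechanical (by omega)).exists_isFlowBox h.isCompact (by omega) ?_ R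
      (by positivity)⟩
    exact contDiff_accel (by exact_mod_cast hr'.contDiff_metric) hr'.pos
      (by exact_mod_cast hr'.contDiff_potential)
  obtain ⟨F, hFdef⟩ : ∃ F : Coord d → M, F = hExpMap g q H₀ x := ⟨_, rfl⟩
  obtain ⟨S, hSdef⟩ : ∃ S : Set (Coord d), S = hExpDomain g q H₀ x := ⟨_, rfl⟩
  suffices IsDiffeoOnto F S by
    rw [hFdef, hSdef] at this
    exact this
  have hjoins : ∀ {n' : ℕ} {m' : Coord d → Coord d →L[ℝ] Coord d →L[ℝ] ℝ} {r' : Coord d → ℝ},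
      2 ≤ n' → Represents g q E n' m' r' → ∀ (y : M) (v : Coord d), HExpGraph g q H₀ x v y ↔
        Joins (accel m' r') (range E) (E x) (A v) (δ * m' (E x) (A v) (A v)) (E y) := by
    intro n' m' r' hn' hr' y v
    have key : ∀ u : Coord d, u = pushVec E x v → (HExpGraph g q H₀ x v y ↔
        Joins (accel m' r') (range E) (E x) u (δ * m' (E x) u u) (E y)) := by
      rintro _ rfl
      exact hr'.hExpGraph_iff h hn' hqd hH
    exact key _ (hA v)
  have hgraph : ∀ (y : M) (v : Coord d), HExpGraph g q H₀ x v y ↔ v = A.symm (L (E y)) := by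
    intro y v
    refine (hjoins hn hr y v).trans ?_
    rw [ContinuousLinearEquiv.eq_symm_apply]
    refine ⟨fun hv => (hLj _ (mem_range_self y)).2 _ hv, fun hv => ?_⟩
    rw [hv]
    exact (hLj _ (mem_range_self y)).1
  have hF : ∀ v ∈ S, HExpGraph g q H₀ x v (F v) := by
    rw [hFdef, hSdef]
    exact fun v hv => hExpGraph_hExpMap hv
  have hS : ∀ y, A.symm (L (E y)) ∈ S := by
    rw [hSdef]
    exact fun y => ⟨y, (hgraph y _).2 rfl⟩
  refine ⟨?_, fun y => A.symm (L (E y)), ?_, fun v hv => ((hgraph _ v).1 (hF v hv)).symm,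
    fun y => ⟨hS y, ?_⟩⟩
  · have hE : ContDiffOn ℝ ∞ (fun v => E (F v)) S := by
      refine contDiffOn_infty.2 fun k v hv => ?_
      obtain ⟨m', r', hr', φ, U, K, C, fb⟩ := hbox k (‖A v‖ + 1)
      have hm' : ContDiff ℝ (k + 1 : ℕ) m' :=
        hr'.contDiff_metric.of_le (by exact_mod_cast Nat.le_succ _)
      have hG : ContDiff ℝ (k + 1 : ℕ) fun w : Coord d =>
          (φ (initialState m' (E x, A w, δ)) 1).1 :=
        (fb.contDiff_exp hm').comp (contDiff_const.prodMk (A.contDiff.prodMk contDiff_const))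
      refine ContDiffWithinAt.congr_of_eventuallyEq_of_mem
        (hG.of_le (by exact_mod_cast Nat.le_succ _)).contDiffWithinAt ?_ hv
      have hev : ∀ᶠ w in 𝓝[S] v, ‖A w‖ < ‖A v‖ + 1 :=
        mem_nhdsWithin_of_mem_nhds
          (A.continuous.norm.continuousAt.eventually_lt continuousAt_const (by linarith))
      filter_upwards [hev, self_mem_nhdsWithin] with w hw hwS
      exact (fb.mem _ _ δ _ hw.le (by linarith)
        ((hjoins (by omega) hr' _ w).1 (hF w hwS))).2.symm
    have h1 := h.contMDiffOn.comp (contMDiffOn_iff_contDiffOn.2 hE)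
      (fun v _ => mem_range_self (F v))
    exact h1.congr fun v _ => (h.left_inv _).symm
  · have hLs : ContDiffOn ℝ ∞ L (range E) := by
      refine contDiffOn_infty.2 fun k z hz => ?_
      obtain ⟨m', r', hr', φ, U, K, C, fb⟩ := hbox k (‖L z‖ + 1)
      have hm' : ContDiff ℝ (k + 1 : ℕ) m' :=
        hr'.contDiff_metric.of_le (by exact_mod_cast Nat.le_succ _)
      refine (fb.contDiffWithinAt_inverse (by omega) hm' h.uniqueDiffOn (x := E x) (δ := δ)
        (by linarith) hz (hL z hz) (by linarith) ?_).of_le (by exact_mod_cast Nat.le_succ _)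
      rintro _ ⟨y, rfl⟩
      have hj := (hjoins (by omega) hr' y _).1 ((hgraph y _).2 rfl)
      rwa [A.apply_symm_apply] at hj
    have h1 : ContMDiff (𝓡∂ d) 𝓘(ℝ, Coord d) ∞ (L ∘ E) :=
      (contMDiffOn_iff_contDiffOn.2 hLs).comp_contMDiff h.contMDiff fun y => mem_range_self y
    exact A.symm.contDiff.contMDiff.comp h1
  · refine h.injective ((hr.isMechanical hn).joins_unique h.isCompact
      ((hjoins hn hr _ _).1 (hF _ (hS y))) ?_)
    rw [A.apply_symm_apply]
    exact (hLj _ (mem_range_self y)).1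

end Represents

end Exponential

end PotentialFlow

theorem mainTheorem6 {d : ℕ} [NeZero d] {M : Type*} [TopologicalSpace M] [T2Space M]
    [CompactSpace M] [ChartedSpace (EuclideanHalfSpace d) M] [IsManifold (𝓡∂ d) ∞ M]
    (g : PotentialFlow.Metric d M) (hg : PotentialFlow.IsSimple g)
    (q : M → ℝ) (hq : ContMDiff (𝓡∂ d) 𝓘(ℝ, ℝ) ∞ q) :
    ∃ E₀ : ℝ, ∀ H₀ : ℝ, E₀ ≤ H₀ → PotentialFlow.IsSimpleAtEnergy g q H₀ := by
  rcases isEmpty_or_nonempty M with hM | ⟨⟨x₀⟩⟩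
  · exact ⟨0, fun H₀ _ => ⟨fun x => hM.elim x, fun x => hM.elim x⟩⟩
  obtain ⟨f, E, h⟩ := hg.exists_isGlobalCoordinate x₀
  obtain ⟨m, r, hr⟩ := h.exists_represents g hq 2
  obtain ⟨E₁, hE₁⟩ :=
    hr.exists_isStrictlyConvexBoundaryAtEnergy h le_rfl hq.continuous hg.1
  obtain ⟨ε, hε, H⟩ := Metric.eventually_nhds_iff.1
    (hr.isSimpleRegion h le_rfl (hq.mdifferentiable (by simp)) hg).eventually_simple
  obtain ⟨Q, hQ⟩ := isCompact_univ.exists_bound_of_continuousOn (f := q) hq.continuous.continuousOn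
  -- The second bound makes `1 / (2 * (H₀ - q x))` smaller than `ε`.
  refine ⟨max E₁ (Q + 1 / ε), fun H₀ hH => ⟨hE₁ H₀ ((le_max_left _ _).trans hH), fun x => ?_⟩⟩
  have hqx : q x ≤ Q := (le_abs_self _).trans (hQ x (mem_univ x))
  have hgap : 1 / ε ≤ H₀ - q x := by linarith [(le_max_right E₁ (Q + 1 / ε)).trans hH]
  have hpos : 0 < H₀ - q x := lt_of_lt_of_le (by positivity) hgap
  obtain ⟨L, hL, hLj⟩ := H (y := 1 / (2 * (H₀ - q x))) (by
    rw [Real.dist_eq, sub_zero, abs_of_pos (by positivity), div_lt_iff₀ (by positivity)]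
    rw [div_le_iff₀ hε] at hgap
    linarith) (E x) ⟨x, rfl⟩
  exact hr.isDiffeoOnto_hExpMap h le_rfl hq (sub_pos.1 hpos) hL hLj
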